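/- Let $G$ be a finite group. All products and subspaces are formed in the category of compactly generated spaces; a pointed $G$-space is a space with continuous $G$-action and a $G$-fixed basepoint $0$. **$G$-partial monoids.** A $G$-partial monoid is a pointed $G$-space $M$ with $G$-invariant subsets $M_n\subset M^n$ ($n\ge 0$) of summable tuples and continuous $G$-maps $M_n\to M$, $(a_1,\dots,a_n)\mapsto a_1+\cdots+a_n$, such that $M_0\to M$ is the inclusion of $0$; $M_1=M$ with sum the identity; and whenever $\{1,\dots,n\}$ is the disjoint union of $J_1,\dots,J_r$ and each $(a_j)_{j\in J_k}$ is summable, $(a_1,\dots,a_n)$ is summable if and only if $(\sum_{j\in J_1}a_j,\dots,\sum_{j\in J_r}a_j)$ is, and then the two sums agree. Maps of $G$-partial monoids are continuous $G$-maps preserving summable tuples and their sums; $M^2$ is given the summable tuples $(M^2)_n=M_n\times M_n$. $M$ is *homotopically invertible* if there are a map of $G$-partial monoids $\tau:M\to M$ and a homotopy $h_t:M\to M^2$ $(0\le t\le 1)$ through maps of $G$-partial monoids with $h_0=(1,\tau)$ and $h_1(M)\subset M_2$, such that the composite $M\xrightarrow{h_1}M_2\xrightarrow{+}M$ is homotopic,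 through maps of $G$-partial monoids, to the constant map $0$. **Configuration spaces.** A $G$-universe is a real inner product space $V$ with $G$-action that is linearly and equivariantly isometric to the direct sum of countably many copies of the regular representation $\mathbb R[G]$. $C(V,M)$ is the set of pairs $(c,a)$ with $c\subset V$ finite and $a:c\to M$, modulo discarding points with label $0$, with action $g(c,a)=(gc,gag^{-1})$ and basepoint $\emptyset$. It carries the quotient topology from the disjoint union over $n$ of the spaces of tuples $((v_i),(a_i))\in V^n\times M^n$ such that labels at coinciding points are summable; such labels are added. Given a $G$-linear isometry $l:V\times V\to V$ and distinct points $e_1,e_2\in V^G$, the multiplication $\mu$ of $C(V,M)$ sends a pair of configurations to the union of their images under the embeddings $v\mapsto l(e_1,v)$ and $v\mapsto l(e_2,v)$, with the same labels. **Strings.** $I(\mathbb R)$ is the set of all finite unions $P$ of pairwise disjoint bounded intervals of positive length such that $\mathbb R\setminus P$ has no isolated point. It carries the quotient topology from the disjoint union of the spaces of end points of finite families of pairwise disjoint bounded intervals of prescribed types (open, closed or half-open) with union in $I(\mathbb R)$; here half-open intervals, and only these, may have length $0$ and are then empty. A tuple in $I(\mathbb R)$ is summable if its members are pairwise disjoint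 with union in $I(\mathbb R)$, and the union is its sum; $G$ acts trivially. For a $G$-partial monoid $M$, a tuple $(x_1,\dots,x_n)$ of elements of the smash product $I(\mathbb R)\wedge M$ is summable with sum $z$ if the formal sum $x_1+\cdots+x_n$ equals $z$ modulo the congruence generated by the distributivity relations $\sum_i (P_i\wedge a)=(\sum_i P_i)\wedge a$ and $\sum_i (P\wedge a_i)=P\wedge(\sum_i a_i)$ for summable $(P_i)$, $(a_i)$. Put $I(V,M)=C(V,I(\mathbb R)\wedge M)$, formed with these sums and the quotient topology above. A *grouplike Hopf $G$-space* is a pointed $G$-space $Y$ with a continuous pointed $G$-map $\mu:Y\times Y\to Y$ such that, up to basepoint preserving $G$-homotopy, $0$ is a two-sided unit, $\mu$ is associative, and some continuous pointed $G$-map $\nu:Y\to Y$ is a two-sided inversion ($\mu(1,\nu)\simeq 0\simeq\mu(\nu,1)$). **Proposition.** Let $V$ be a $G$-universe. Then choices $(l,e_1,e_2)$ as above exist, and for every such choice and every $G$-partial monoid $M$: 1. if $M$ is homotopically invertible, then $C(V,M)$ with the multiplication $\mu$ and unit $\emptyset$ is a grouplike Hopf $G$-space; 2. $I(V,M)$ with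 the multiplication $\mu$ and unit $\emptyset$ is a grouplike Hopf $G$-space (for every $M$). -/

import Mathlib

open Topology

universe u v w

noncomputable section

/-! ### Compactly generated products and pointed `G`-spaces -/

/-- The product of two spaces in the category of compactly generated spaces: the set `X × Y` with
the compactly generated refinement of the product topology. -/
def KProd (X : Type u) (Y : Type v) : Type (max u v) := X × Y

namespace KProd

instance (X : Type u) (Y : Type v) [TopologicalSpace X] [TopologicalSpace Y] :
    TopologicalSpace (KProd X Y) :=
  TopologicalSpace.compactlyGenerated.{max u v} (X × Y)

instance (X : Type u) (Y : Type v) [Zero X] [Zero Y] : Zero (KProd X Y) :=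
  inferInstanceAs (Zero (X × Y))

instance (G : Type w) [Group G] (X : Type u) (Y : Type v) [MulAction G X] [MulAction G Y] :
    MulAction G (KProd X Y) :=
  inferInstanceAs (MulAction G (X × Y))

end KProd

/-- `X`, with basepoint `0`, is a pointed `G`-space (`G` being discrete). -/
class IsPointedGSpace (G : Type w) [Group G] (X : Type u) [TopologicalSpace X] [Zero X]
    [MulAction G X] : Prop where
  smul_basepoint : ∀ g : G, g • (0 : X) = 0
  continuous_smul : ∀ g : G, Continuous fun x : X => g • x

/-- Basepoint preserving `G`-homotopy of maps `X → Y`. -/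
def GHomotopic (G : Type w) [Group G] {X : Type u} {Y : Type v}
    [TopologicalSpace X] [Zero X] [MulAction G X] [TopologicalSpace Y] [Zero Y] [MulAction G Y]
    (f₀ f₁ : X → Y) : Prop :=
  ∃ H : unitInterval × X → Y, Continuous H ∧
    (∀ x, H (0, x) = f₀ x) ∧ (∀ x, H (1, x) = f₁ x) ∧
    (∀ t (g : G) x, H (t, g • x) = g • H (t, x)) ∧
    (∀ t, H (t, 0) = 0)

/-- `Y` with multiplication `μ` and unit `0` is a grouplike Hopf `G`-space: `μ` is a pointed
`G`-map, `0` is a unit up to `G`-homotopy, `μ` is associative up to `G`-homotopy, and there is an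
inversion up to `G`-homotopy. -/
structure IsGrouplikeHopfGSpace (G : Type w) [Group G] (Y : Type u) [TopologicalSpace Y] [Zero Y]
    [MulAction G Y] (μ : KProd Y Y → Y) : Prop where
  pointedGSpace : IsPointedGSpace G Y
  continuous_mul : Continuous μ
  mul_smul : ∀ (g : G) (p : KProd Y Y), μ (g • p) = g • μ p
  mul_basepoint : μ 0 = 0
  unit_left : GHomotopic G (fun y : Y => μ ((0, y) : Y × Y)) (fun y => y)
  unit_right : GHomotopic G (fun y : Y => μ ((y, 0) : Y × Y)) (fun y => y)
  assoc : GHomotopic G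
    (fun p : KProd (KProd Y Y) Y => μ ((μ p.1, p.2) : Y × Y))
    (fun p : KProd (KProd Y Y) Y => μ ((p.1.1, μ ((p.1.2, p.2) : Y × Y)) : Y × Y))
  inverse : ∃ ν : Y → Y, Continuous ν ∧ (∀ (g : G) y, ν (g • y) = g • ν y) ∧ ν 0 = 0 ∧
    GHomotopic G (fun y : Y => μ ((y, ν y) : Y × Y)) (fun _ => (0 : Y)) ∧
    GHomotopic G (fun y : Y => μ ((ν y, y) : Y × Y)) (fun _ => (0 : Y))

/-! ### Partial monoids -/

/-- The algebraic part of a partial abelian monoid with `G`-action: the invariant sets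
`dom n ⊆ Mⁿ` of summable `n`-tuples and the equivariant sums `dom n → M`.  Only the values of
`sum` on `dom n` are meaningful.  In `assoc`, a decomposition of `{1, …, n}` into disjoint blocks
`J₁, …, J_r` is given by the sizes `m k` of the blocks and an enumeration `e ⟨k, ·⟩` of each. -/
structure PartialMonoid (G : Type w) [Group G] (M : Type u) [Zero M] [MulAction G M] where
  dom : ∀ n : ℕ, Set (Fin n → M)
  sum : ∀ {n : ℕ}, (Fin n → M) → M
  smul_mem : ∀ {n : ℕ} (g : G) (a : Fin n → M), a ∈ dom n → (fun i => g • a i) ∈ dom n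
  sum_smul : ∀ {n : ℕ} (g : G) (a : Fin n → M), a ∈ dom n → sum (fun i => g • a i) = g • sum a
  dom_zero : ∀ a : Fin 0 → M, a ∈ dom 0 ∧ sum a = 0
  dom_one : ∀ a : Fin 1 → M, a ∈ dom 1 ∧ sum a = a 0
  assoc : ∀ {n r : ℕ} (m : Fin r → ℕ) (e : (Σ k : Fin r, Fin (m k)) ≃ Fin n) (a : Fin n → M),
    (∀ k, (fun i => a (e ⟨k, i⟩)) ∈ dom (m k)) →
      (a ∈ dom n ↔ (fun k => sum fun i => a (e ⟨k, i⟩)) ∈ dom r) ∧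
      (a ∈ dom n → sum a = sum fun k => sum fun i => a (e ⟨k, i⟩))

/-- A `G`-partial monoid: in addition the sums `dom n → M` are continuous, where `dom n` is a
subspace of `Mⁿ` in the compactly generated sense. -/
structure GPartialMonoid (G : Type w) [Group G] (M : Type u) [TopologicalSpace M] [Zero M]
    [MulAction G M] extends PartialMonoid G M where
  continuous_sum : ∀ n : ℕ, Continuous[TopologicalSpace.compactlyGenerated.{u} (dom n), inferInstance]
    fun a : dom n => sum a.1

namespace PartialMonoid

variable {G : Type w} [Group G] {M : Type u} [Zero M] [MulAction G M]
  {N : Type v} [Zero N] [MulAction G N]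

/-- The subfamily `(a i)_{i ∈ s}`, listed in increasing order of the indices. -/
def restrict {n : ℕ} (s : Finset (Fin n)) (a : Fin n → M) : Fin s.card → M :=
  fun k => a (s.orderEmbOfFin rfl k)

theorem sum_eq_zero (A : PartialMonoid G M) {n : ℕ} (hn : n = 0) (a : Fin n → M) :
    A.sum a = 0 := by
  subst hn
  exact (A.dom_zero a).2

theorem smul_basepoint (A : PartialMonoid G M) (g : G) : g • (0 : M) = 0 := by
  have h := A.sum_smul g (Fin.elim0 : Fin 0 → M) (A.dom_zero _).1
  rw [(A.dom_zero _).2, (A.dom_zero _).2] at h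
  exact h.symm

/-- Maps of `G`-partial monoids. -/
structure IsHom [TopologicalSpace M] [TopologicalSpace N] (A : PartialMonoid G M)
    (B : PartialMonoid G N) (f : M → N) : Prop where
  continuous : Continuous f
  map_smul : ∀ (g : G) (a : M), f (g • a) = g • f a
  map_dom : ∀ {n : ℕ} (a : Fin n → M), a ∈ A.dom n → (fun i => f (a i)) ∈ B.dom n
  map_sum : ∀ {n : ℕ} (a : Fin n → M), a ∈ A.dom n → f (A.sum a) = B.sum fun i => f (a i)

/-- The product of partial monoids, with `(M × N)_n = M_n × N_n`. -/
def prod (A : PartialMonoid G M) (B : PartialMonoid G N) : PartialMonoid G (KProd M N) where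
  dom n := {a | (fun i => (a i).1) ∈ A.dom n ∧ (fun i => (a i).2) ∈ B.dom n}
  sum a := (A.sum fun i => (a i).1, B.sum fun i => (a i).2)
  smul_mem g a h := ⟨A.smul_mem g _ h.1, B.smul_mem g _ h.2⟩
  sum_smul g a h := Prod.ext (A.sum_smul g _ h.1) (B.sum_smul g _ h.2)
  dom_zero a := ⟨⟨(A.dom_zero _).1, (B.dom_zero _).1⟩,
    Prod.ext (A.dom_zero _).2 (B.dom_zero _).2⟩
  dom_one a := ⟨⟨(A.dom_one _).1, (B.dom_one _).1⟩, Prod.ext (A.dom_one _).2 (B.dom_one _).2⟩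
  assoc m e a h := by
    have hA := A.assoc m e (fun i => (a i).1) fun k => (h k).1
    have hB := B.assoc m e (fun i => (a i).2) fun k => (h k).2
    exact ⟨and_congr hA.1 hB.1, fun ha => Prod.ext (hA.2 ha.1) (hB.2 ha.2)⟩

/-- Homotopically invertible partial monoids: there are a homotopy inversion `τ` and a homotopy
`h t : M → M²` through maps of partial monoids from `(1, τ)` to a map `h 1` into `M_2` whose
composite with the sum `M_2 → M` is null-homotopic through maps of partial monoids. -/
def HomotopicallyInvertible [TopologicalSpace M] (A : PartialMonoid G M) : Prop :=
  ∃ (τ : M → M) (h : unitInterval × M → KProd M M),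
    A.IsHom A τ ∧ Continuous h ∧
    (∀ t, A.IsHom (A.prod A) fun a => h (t, a)) ∧
    (∀ a, h (0, a) = ((a, τ a) : M × M)) ∧
    (∀ a, ![(h (1, a)).1, (h (1, a)).2] ∈ A.dom 2) ∧
    ∃ k : unitInterval × M → M, Continuous k ∧
      (∀ t, A.IsHom A fun a => k (t, a)) ∧
      (∀ a, k (0, a) = A.sum ![(h (1, a)).1, (h (1, a)).2]) ∧
      (∀ a, k (1, a) = 0)

end PartialMonoid

/-! ### Labeled configuration spaces -/

/-- The set underlying `C(V, M)`: a pair of a finite subset `c` of `V` and a map `c → M`, up to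
discarding the points labeled by `0`, is the same as a finitely supported function `V → M`. -/
def Conf (V : Type u) {G : Type w} [Group G] {M : Type u} [Zero M] [MulAction G M]
    (_ : PartialMonoid G M) : Type u := V →₀ M

namespace Conf

variable {V : Type u} {G : Type w} [Group G] {M : Type u} [Zero M] [MulAction G M]

instance (A : PartialMonoid G M) : Zero (Conf V A) := inferInstanceAs (Zero (V →₀ M))

/-- `g (c, a) = (g c, g a g⁻¹)`. -/
instance [MulAction G V] (A : PartialMonoid G M) : MulAction G (Conf V A) where
  smul g f := Finsupp.equivMapDomain (MulAction.toPerm g)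
    (Finsupp.mapRange (fun m : M => g • m) (A.smul_basepoint g) f)
  one_smul f := by
    refine Finsupp.ext fun x => ?_
    change (1 : G) • DFunLike.coe (F := V →₀ M) f ((1 : G)⁻¹ • x) = DFunLike.coe (F := V →₀ M) f x
    simp
  mul_smul g h f := by
    refine Finsupp.ext fun x => ?_
    change (g * h) • DFunLike.coe (F := V →₀ M) f ((g * h)⁻¹ • x) =
      g • h • DFunLike.coe (F := V →₀ M) f (h⁻¹ • g⁻¹ • x)
    simp [mul_smul]

/-- The indices of the particles that sit at the point `x`. -/
def indices {n : ℕ} (x : Fin n → V) (y : V) : Finset (Fin n) :=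
  letI := Classical.decEq V
  Finset.univ.filter fun i => x i = y

/-- The space of `n`-tuples of labeled particles such that the labels of particles with the same
position are summable. -/
def tuples (V : Type u) (A : PartialMonoid G M) (n : ℕ) : Set ((Fin n → V) × (Fin n → M)) :=
  {p | ∀ y : V, PartialMonoid.restrict (indices p.1 y) p.2 ∈ A.dom _}

/-- The labeled configuration of an `n`-tuple of labeled particles: the labels of particles
with the same position are added. -/
def ofTuple (A : PartialMonoid G M) (n : ℕ) (p : tuples V A n) : Conf V A :=
  letI := Classical.decEq V
  Finsupp.onFinset (Finset.univ.image p.1.1)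
    (fun y => A.sum (PartialMonoid.restrict (indices p.1.1 y) p.1.2)) (by
      intro y hy
      by_contra hne
      refine hy (A.sum_eq_zero ?_ _)
      rw [Finset.card_eq_zero, Finset.eq_empty_iff_forall_notMem]
      intro i hi
      exact hne (Finset.mem_image.2 ⟨i, Finset.mem_univ i, (Finset.mem_filter.1 hi).2⟩))

/-- `C(V, M)` is a quotient space of the disjoint union over `n` of the (compactly generated)
spaces of `n`-tuples of labeled particles. -/
instance [TopologicalSpace V] [TopologicalSpace M] (A : PartialMonoid G M) :
    TopologicalSpace (Conf V A) :=
  ⨆ n : ℕ, TopologicalSpace.coinduced (ofTuple A n)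
    (TopologicalSpace.compactlyGenerated.{u} (tuples V A n))

end Conf

/-! ### `G`-universes and the multiplication of `C(V, M)` -/

/-- `V` is a `G`-universe: it is linearly and equivariantly isometric to the direct sum of
countably many copies of the real regular representation of `G`. -/
def IsGUniverse (G : Type w) [Group G] [Fintype G] (V : Type u) [NormedAddCommGroup V]
    [InnerProductSpace ℝ V] [MulAction G V] : Prop :=
  ∃ φ : V ≃ₗ[ℝ] (ℕ →₀ EuclideanSpace ℝ G),
    (∀ x y : V, inner ℝ x y = (φ x).sum fun n a => inner ℝ a (φ y n)) ∧
    (∀ (g : G) (x : V) (n : ℕ) (h : G), φ (g • x) n h = φ x n (g⁻¹ * h))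

/-- The choices that determine the multiplication of `C(V, M)`: a `G`-linear isometry
`V × V → V` and an embedding of the two-point set into `V^G`. -/
structure HopfData (G : Type w) [Group G] (V : Type u) [NormedAddCommGroup V]
    [InnerProductSpace ℝ V] [MulAction G V] where
  isometry : WithLp 2 (V × V) →ₗᵢ[ℝ] V
  isometry_smul : ∀ (g : G) (x y : V),
    isometry (WithLp.toLp 2 (g • x, g • y)) = g • isometry (WithLp.toLp 2 (x, y))
  point₁ : V
  point₂ : V
  point_ne : point₁ ≠ point₂
  smul_point₁ : ∀ g : G, g • point₁ = point₁
  smul_point₂ : ∀ g : G, g • point₂ = point₂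

namespace HopfData

variable {G : Type w} [Group G] {V : Type u} [NormedAddCommGroup V] [InnerProductSpace ℝ V]
  [MulAction G V]

/-- The equivariant embedding `{1, 2} × V → V`, `(p, x) ↦ l (e p, x)`. -/
def embedding (d : HopfData G V) : V ⊕ V ↪ V where
  toFun := Sum.elim (fun x => d.isometry (WithLp.toLp 2 (d.point₁, x)))
    (fun x => d.isometry (WithLp.toLp 2 (d.point₂, x)))
  inj' := by
    have key : ∀ a b c e : V, d.isometry (WithLp.toLp 2 (a, b)) = d.isometry (WithLp.toLp 2 (c, e)) →
        a = c ∧ b = e := by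
      intro a b c e h
      have h2 := (WithLp.toLp_injective 2) (d.isometry.injective h)
      exact Prod.mk.inj h2
    rintro (x | x) (y | y) h
    · exact congrArg Sum.inl (key _ _ _ _ h).2
    · exact absurd (key _ _ _ _ h).1 d.point_ne
    · exact absurd (key _ _ _ _ h).1.symm d.point_ne
    · exact congrArg Sum.inr (key _ _ _ _ h).2

/-- The multiplication of `C(V, M)`: the two labeled configurations are placed side by side in
`{1, 2} × V`, which is then embedded into `V`. -/
def mul (d : HopfData G V) {M : Type u} [Zero M] [MulAction G M] (A : PartialMonoid G M)
    (p : KProd (Conf V A) (Conf V A)) : Conf V A :=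
  Finsupp.embDomain d.embedding (Finsupp.sumElim (p.1 : V →₀ M) (p.2 : V →₀ M))

end HopfData

/-! ### Smash products of partial monoids -/

/-- The relation on `M × N` that collapses the wedge `M × 0 ∪ 0 × N` to a point. -/
def smashSetoid (M : Type u) (N : Type v) [Zero M] [Zero N] : Setoid (KProd M N) where
  r p q := p = q ∨ ((p.1 = 0 ∨ p.2 = 0) ∧ (q.1 = 0 ∨ q.2 = 0))
  iseqv :=
    { refl := fun _ => Or.inl rfl
      symm := by
        rintro p q (h | h)
        · exact Or.inl h.symm
        · exact Or.inr ⟨h.2, h.1⟩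
      trans := by
        rintro p q r (rfl | h) (rfl | h')
        · exact Or.inl rfl
        · exact Or.inr h'
        · exact Or.inr h
        · exact Or.inr ⟨h.1, h'.2⟩ }

/-- The smash product of pointed spaces, with the quotient topology. -/
def Smash (M : Type u) (N : Type v) [Zero M] [Zero N] : Type (max u v) :=
  Quotient (smashSetoid M N)

namespace Smash

variable {M : Type u} {N : Type v} [Zero M] [Zero N]

instance [TopologicalSpace M] [TopologicalSpace N] : TopologicalSpace (Smash M N) :=
  TopologicalSpace.coinduced (Quotient.mk (smashSetoid M N)) inferInstance

/-- The class `a ∧ b`. -/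
def mk (a : M) (b : N) : Smash M N := Quotient.mk (smashSetoid M N) ((a, b) : M × N)

instance : Zero (Smash M N) := ⟨mk 0 0⟩

theorem mk_zero_left (b : N) : (mk 0 b : Smash M N) = 0 :=
  Quotient.sound (s := smashSetoid M N) (Or.inr ⟨Or.inl rfl, Or.inl rfl⟩)

theorem mk_zero_right (a : M) : (mk a 0 : Smash M N) = 0 :=
  Quotient.sound (s := smashSetoid M N) (Or.inr ⟨Or.inr rfl, Or.inl rfl⟩)

theorem ind {P : Smash M N → Prop} (h : ∀ a b, P (mk a b)) (x : Smash M N) : P x :=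
  Quotient.ind (s := smashSetoid M N) (fun p : M × N => h p.1 p.2) x

variable {G : Type w} [Group G] [TopologicalSpace M] [TopologicalSpace N]
  [MulAction G M] [MulAction G N] [IsPointedGSpace G M] [IsPointedGSpace G N]

/-- The diagonal action `g (a ∧ b) = g a ∧ g b`. -/
instance : MulAction G (Smash M N) where
  smul g := Quotient.map (sa := smashSetoid M N) (sb := smashSetoid M N)
    (fun p : M × N => (g • p.1, g • p.2)) (by
      rintro p q (rfl | ⟨h, h'⟩)
      · exact Or.inl rfl
      · refine Or.inr ⟨h.imp ?_ ?_, h'.imp ?_ ?_⟩ <;>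
        · intro h0
          change g • _ = _
          rw [h0]
          exact IsPointedGSpace.smul_basepoint g)
  one_smul := by
    refine ind fun a b => ?_
    change mk ((1 : G) • a) ((1 : G) • b) = mk a b
    simp
  mul_smul g h := by
    refine ind fun a b => ?_
    change mk ((g * h) • a) ((g * h) • b) = mk (g • h • a) (g • h • b)
    simp [mul_smul]

theorem smul_mk (g : G) (a : M) (b : N) : g • (mk a b : Smash M N) = mk (g • a) (g • b) := rfl

end Smash

namespace PartialMonoid

variable {G : Type w} [Group G] {M : Type u} [Zero M] [MulAction G M]

/-- The relations `a₁ + ⋯ + a_n = (a₁ + ⋯ + a_n)` for summable tuples, between finite multisets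
of elements of `M` (regarded as formal sums). -/
inductive SumRel (A : PartialMonoid G M) : Multiset M → Multiset M → Prop
  | of {n : ℕ} (a : Fin n → M) (ha : a ∈ A.dom n) : SumRel A (∑ i, {a i}) {A.sum a}

/-- The formal sum `S` is summable with sum `s`. -/
def FormalSum (A : PartialMonoid G M) (S : Multiset M) (s : M) : Prop :=
  ∃ (n : ℕ) (a : Fin n → M), S = ∑ i, {a i} ∧ a ∈ A.dom n ∧ A.sum a = s

theorem perm (A : PartialMonoid G M) {n : ℕ} (σ : Equiv.Perm (Fin n)) (a : Fin n → M)
    (h : (fun i => a (σ i)) ∈ A.dom n) : a ∈ A.dom n ∧ A.sum a = A.sum fun i => a (σ i) := by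
  have key := A.assoc (n := n) (r := n) (fun _ => 1)
    ((Equiv.sigmaUnique (Fin n) fun _ => Fin 1).trans σ) a fun k => (A.dom_one _).1
  have e : (fun k : Fin n => A.sum fun i : Fin 1 =>
      a (((Equiv.sigmaUnique (Fin n) fun _ => Fin 1).trans σ) ⟨k, i⟩)) = fun i => a (σ i) := by
    funext k
    exact (A.dom_one _).2
  rw [e] at key
  have hm := key.1.2 h
  exact ⟨hm, key.2 hm⟩

theorem sum_singleton_eq_map {ι : Type*} [Fintype ι] {X : Type*} (a : ι → X) :
    (∑ i, ({a i} : Multiset X)) = Finset.univ.val.map a := by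
  have h := Multiset.sum_map_singleton (Finset.univ.val.map a)
  rw [Multiset.map_map] at h
  exact h

theorem exists_perm {n : ℕ} {X : Type*} (a b : Fin n → X)
    (h : (∑ i, ({a i} : Multiset X)) = ∑ i, {b i}) :
    ∃ σ : Equiv.Perm (Fin n), ∀ i, b (σ i) = a i := by
  classical
  rw [sum_singleton_eq_map, sum_singleton_eq_map] at h
  have hc : ∀ x, Nonempty ({i // a i = x} ≃ {i // b i = x}) := by
    intro x
    have := congrArg (Multiset.count x) h
    rw [Multiset.count_map, Multiset.count_map] at this
    refine ⟨Fintype.equivOfCardEq ?_⟩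
    rw [Fintype.card_subtype, Fintype.card_subtype]
    simp only [eq_comm (b := x)]
    simpa [Finset.card, Finset.filter] using this
  exact ⟨Equiv.ofFiberEquiv fun x => (hc x).some, fun i => Equiv.ofFiberEquiv_map _ i⟩

theorem FormalSum.tuple {A : PartialMonoid G M} {n : ℕ} {a : Fin n → M} {s : M}
    (h : A.FormalSum (∑ i, {a i}) s) : a ∈ A.dom n ∧ A.sum a = s := by
  obtain ⟨m, b, hS, hb, rfl⟩ := h
  have hc := congrArg Multiset.card hS
  simp only [Multiset.card_sum, Multiset.card_singleton, Finset.sum_const, Finset.card_univ,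
    Fintype.card_fin, smul_eq_mul, mul_one] at hc
  subst hc
  obtain ⟨σ, hσ⟩ := exists_perm b a hS.symm
  obtain rfl : (fun i => a (σ i)) = b := funext hσ
  exact A.perm σ a hb

theorem formalSum_block (A : PartialMonoid G M) {n : ℕ} (a : Fin n → M) (ha : a ∈ A.dom n)
    (W : Multiset M) (s : M) :
    A.FormalSum ((∑ i, {a i}) + W) s ↔ A.FormalSum ({A.sum a} + W) s := by
  obtain ⟨w, rfl⟩ : ∃ w : List M, W = w := ⟨W.toList, W.coe_toList.symm⟩
  have hw : ((w : List M) : Multiset M) = ∑ j, {w.get j} := by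
    rw [sum_singleton_eq_map]
    simp
  let m : Fin (w.length + 1) → ℕ := Fin.cons n fun _ => 1
  let val : (Σ k, Fin (m k)) → M := fun x =>
    Fin.cases (motive := fun k => Fin (m k) → M) (fun i => a i) (fun j _ => w.get j) x.1 x.2
  let N := Fintype.card (Σ k, Fin (m k))
  let e : (Σ k, Fin (m k)) ≃ Fin N := Fintype.equivFin _
  let c : Fin N → M := fun i => val (e.symm i)
  have hce : ∀ k, (fun i => c (e ⟨k, i⟩)) = fun i => val ⟨k, i⟩ := by
    intro k
    funext i
    simp [c]
  have hblock : ∀ k, (fun i => c (e ⟨k, i⟩)) ∈ A.dom (m k) := by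
    intro k
    rw [hce]
    refine Fin.cases ?_ (fun j => ?_) k
    · exact ha
    · exact (A.dom_one _).1
  have key := A.assoc m e c hblock
  have hsum : (fun k => A.sum fun i => c (e ⟨k, i⟩)) = Fin.cons (A.sum a) fun j => w.get j := by
    funext k
    rw [hce]
    refine Fin.cases ?_ (fun j => ?_) k
    · rfl
    · exact (A.dom_one _).2
  rw [hsum] at key
  have hL : (∑ i, ({a i} : Multiset M)) + (w : Multiset M) = ∑ i, {c i} := by
    rw [← Fintype.sum_equiv e (fun x => ({val x} : Multiset M)) (fun i => {c i})
      (fun x => by simp [c]), Fintype.sum_sigma, Fin.sum_univ_succ, hw]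
    congr 1
  have hR : ({A.sum a} : Multiset M) + (w : Multiset M) =
      ∑ k, {(Fin.cons (A.sum a) fun j => w.get j : Fin (w.length + 1) → M) k} := by
    rw [Fin.sum_univ_succ, hw]
    rfl
  rw [hL, hR]
  constructor
  · intro h
    obtain ⟨h1, h2⟩ := h.tuple
    exact ⟨_, _, rfl, key.1.1 h1, (key.2 h1).symm.trans h2⟩
  · intro h
    obtain ⟨h1, h2⟩ := h.tuple
    exact ⟨_, _, rfl, key.1.2 h1, (key.2 (key.1.2 h1)).trans h2⟩

theorem formalSum_congr (A : PartialMonoid G M) {S T : Multiset M} (h : addConGen A.SumRel S T) :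
    ∀ W s, A.FormalSum (S + W) s ↔ A.FormalSum (T + W) s := by
  change AddConGen.Rel A.SumRel S T at h
  induction h with
  | of S T h =>
    obtain ⟨a, ha⟩ := h
    exact A.formalSum_block a ha
  | refl => exact fun _ _ => Iff.rfl
  | symm _ ih => exact fun W s => (ih W s).symm
  | trans _ _ ih₁ ih₂ => exact fun W s => (ih₁ W s).trans (ih₂ W s)
  | @add S T S' T' _ _ ih₁ ih₂ =>
    intro W s
    rw [add_assoc, ih₁, ← add_assoc, add_comm T S', add_assoc, ih₂, ← add_assoc, add_comm T' T]

/-- Elements that are equal by virtue of the sum relations are equal. -/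
theorem eq_of_addConGen (A : PartialMonoid G M) {x y : M} (h : addConGen A.SumRel {x} {y}) :
    x = y := by
  have h1 : ∀ z : M, ({z} : Multiset M) = ∑ _i : Fin 1, {z} := fun z => by simp
  have hx : A.FormalSum ({x} + 0) x := by
    rw [add_zero]
    exact ⟨1, fun _ => x, h1 x, A.dom_one _⟩
  have hy := (A.formalSum_congr h 0 x).1 hx
  rw [add_zero, h1] at hy
  exact (hy.tuple.2.symm.trans (A.dom_one _).2)

variable {N : Type v} [Zero N] [MulAction G N]

/-- The distributivity relations `c₁ ∧ d + ⋯ + c_k ∧ d = (c₁ + ⋯ + c_k) ∧ d` and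
`c ∧ d₁ + ⋯ + c ∧ d_l = c ∧ (d₁ + ⋯ + d_l)`, between formal sums of elements of `M ∧ N`. -/
inductive DistribRel (A : PartialMonoid G M) (B : PartialMonoid G N) :
    Multiset (Smash M N) → Multiset (Smash M N) → Prop
  | left {k : ℕ} (c : Fin k → M) (hc : c ∈ A.dom k) (d : N) :
      DistribRel A B (∑ i, {Smash.mk (c i) d}) {Smash.mk (A.sum c) d}
  | right {l : ℕ} (c : M) (d : Fin l → N) (hd : d ∈ B.dom l) :
      DistribRel A B (∑ i, {Smash.mk c (d i)}) {Smash.mk c (B.sum d)}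

/-- The distributivity relations identify no two elements of `M ∧ N`; so the sum of a
tuple that can be summed up by using them is well defined. -/
def DistribSeparated (A : PartialMonoid G M) (B : PartialMonoid G N) : Prop :=
  ∀ x y : Smash M N, addConGen (A.DistribRel B) {x} {y} → x = y

/-- The sum in `M ∧ N` of a tuple that can be summed up by the distributivity relations. -/
def smashSum (A : PartialMonoid G M) (B : PartialMonoid G N) {n : ℕ}
    (x : Fin n → Smash M N) : Smash M N :=
  open Classical in
  if h : ∃ z, addConGen (A.DistribRel B) (∑ i, {x i}) {z} then h.choose else 0

theorem smashSum_eq {A : PartialMonoid G M} {B : PartialMonoid G N} (hAB : A.DistribSeparated B)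
    {n : ℕ} {x : Fin n → Smash M N} {z : Smash M N}
    (h : addConGen (A.DistribRel B) (∑ i, {x i}) {z}) : A.smashSum B x = z := by
  have h' : ∃ z, addConGen (A.DistribRel B) (∑ i, {x i}) {z} := ⟨z, h⟩
  rw [smashSum, dif_pos h']
  exact hAB _ _ ((addConGen _).trans ((addConGen _).symm h'.choose_spec) h)

section Smash

variable [TopologicalSpace M] [TopologicalSpace N] [IsPointedGSpace G M] [IsPointedGSpace G N]

theorem addConGen_smul (A : PartialMonoid G M) (B : PartialMonoid G N) (g : G)
    {S T : Multiset (Smash M N)} (h : addConGen (A.DistribRel B) S T) :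
    addConGen (A.DistribRel B) (S.map (g • ·)) (T.map (g • ·)) := by
  change AddConGen.Rel _ S T at h
  induction h with
  | of S T h =>
    refine AddConGen.Rel.of _ _ ?_
    cases h with
    | left c hc d =>
      have := DistribRel.left (A := A) (B := B) (fun i => g • c i) (A.smul_mem g c hc) (g • d)
      rw [A.sum_smul g c hc] at this
      simpa only [sum_singleton_eq_map, Multiset.map_map, Multiset.map_singleton,
        Function.comp_def, Smash.smul_mk] using this
    | right c d hd =>
      have := DistribRel.right (A := A) (B := B) (g • c) (fun i => g • d i) (B.smul_mem g d hd)
      rw [B.sum_smul g d hd] at this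
      simpa only [sum_singleton_eq_map, Multiset.map_map, Multiset.map_singleton,
        Function.comp_def, Smash.smul_mk] using this
  | refl => exact AddConGen.Rel.refl _
  | symm _ ih => exact AddConGen.Rel.symm ih
  | trans _ _ ih₁ ih₂ => exact AddConGen.Rel.trans ih₁ ih₂
  | add _ _ ih₁ ih₂ =>
    rw [Multiset.map_add, Multiset.map_add]
    exact AddConGen.Rel.add ih₁ ih₂

/-- The smash product of partial monoids: `(M ∧ N)_n` consists of the `n`-tuples that can be
summed up to an element of `M ∧ N` by using the distributivity relations. -/
def smash (A : PartialMonoid G M) (B : PartialMonoid G N) (hAB : A.DistribSeparated B) :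
    PartialMonoid G (Smash M N) where
  dom n := {x | ∃ z, addConGen (A.DistribRel B) (∑ i, {x i}) {z}}
  sum x := A.smashSum B x
  smul_mem g x := by
    rintro ⟨z, hz⟩
    refine ⟨g • z, ?_⟩
    have := A.addConGen_smul B g hz
    simpa only [sum_singleton_eq_map, Multiset.map_map, Multiset.map_singleton,
      Function.comp_def] using this
  sum_smul g x := by
    rintro ⟨z, hz⟩
    have := A.addConGen_smul B g hz
    rw [smashSum_eq hAB hz]
    refine smashSum_eq hAB ?_
    simpa only [sum_singleton_eq_map, Multiset.map_map, Multiset.map_singleton,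
      Function.comp_def] using this
  dom_zero x := by
    have h : addConGen (A.DistribRel B) (∑ i, {x i}) {(0 : Smash M N)} := by
      refine AddConGen.Rel.of _ _ ?_
      have := DistribRel.left (A := A) (B := B) Fin.elim0 (A.dom_zero _).1 0
      rw [(A.dom_zero _).2, Smash.mk_zero_left] at this
      simpa using this
    exact ⟨⟨0, h⟩, smashSum_eq hAB h⟩
  dom_one x := by
    have h : addConGen (A.DistribRel B) (∑ i, {x i}) {x 0} := by
      rw [Fin.sum_univ_one]
      exact AddConGen.Rel.refl _
    exact ⟨⟨_, h⟩, smashSum_eq hAB h⟩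
  assoc {n r} m e x h := by
    have h1 : ∀ k, addConGen (A.DistribRel B) (∑ i, {x (e ⟨k, i⟩)})
        {A.smashSum B fun i => x (e ⟨k, i⟩)} := by
      intro k
      obtain ⟨z, hz⟩ := h k
      rw [smashSum_eq hAB hz]
      exact hz
    have h2 : addConGen (A.DistribRel B) (∑ i, {x i})
        (∑ k, {A.smashSum B fun i => x (e ⟨k, i⟩)}) := by
      rw [← Fintype.sum_equiv e (fun y => ({x (e y)} : Multiset (Smash M N))) (fun i => {x i})
        (fun _ => rfl), Fintype.sum_sigma]
      exact (addConGen _).finsetSum _ fun k _ => h1 k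
    refine ⟨⟨?_, ?_⟩, ?_⟩
    · rintro ⟨z, hz⟩
      exact ⟨z, (addConGen _).trans ((addConGen _).symm h2) hz⟩
    · rintro ⟨z, hz⟩
      exact ⟨z, (addConGen _).trans h2 hz⟩
    · rintro ⟨z, hz⟩
      rw [smashSum_eq hAB hz]
      exact (smashSum_eq hAB ((addConGen _).trans ((addConGen _).symm h2) hz)).symm

end Smash

end PartialMonoid

/-! ### The space of intervals -/

/-- The bounded interval with end points `a`, `b`; the flags tell which end points belong to it. -/
def interval (left right : Bool) (a b : ℝ) : Set ℝ :=
  {x | (if left then a ≤ x else a < x) ∧ (if right then x ≤ b else x < b)}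

/-- The union of the intervals of a finite family. -/
def intervalUnion {k : ℕ} (left right : Fin k → Bool) (p : (Fin k → ℝ) × (Fin k → ℝ)) : Set ℝ :=
  ⋃ i, interval (left i) (right i) (p.1 i) (p.2 i)

/-- The space of families of `k` pairwise disjoint bounded intervals of given types. The intervals
have positive length, except that a half-open interval may have length `0` (it is then empty).
Moreover, it is required that no two of the intervals are separated by a single point, that is,
the complement of the union has no isolated point. -/
def intervalFamilies {k : ℕ} (left right : Fin k → Bool) : Set ((Fin k → ℝ) × (Fin k → ℝ)) :=
  {p | (∀ i, p.1 i ≤ p.2 i) ∧ (∀ i, left i = right i → p.1 i < p.2 i) ∧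
    (Pairwise fun i j => Disjoint (interval (left i) (right i) (p.1 i) (p.2 i))
      (interval (left j) (right j) (p.1 j) (p.2 j))) ∧
    ∀ x ∉ intervalUnion left right p, intervalUnion left right p ∉ 𝓝[≠] x}

/-- The space `I(ℝ)` of finite unions of pairwise disjoint bounded intervals. -/
structure IntervalSpace : Type where
  carrier : Set ℝ
  eq_union : ∃ (k : ℕ) (left right : Fin k → Bool), ∃ p ∈ intervalFamilies left right,
    carrier = intervalUnion left right p

namespace IntervalSpace

/-- The union of a family of intervals as a point of `I(ℝ)`. -/
def ofFamily {k : ℕ} (left right : Fin k → Bool) (p : intervalFamilies left right) :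
    IntervalSpace :=
  ⟨intervalUnion left right p.1, k, left, right, p.1, p.2, rfl⟩

/-- `I(ℝ)` is a quotient space of the disjoint union of the spaces of families of intervals: the
end points of the intervals move continuously, adjacent intervals such as `[a, c)` and `[c, b]` are
concatenated, and half-open intervals are deleted when their length tends to `0`. -/
instance : TopologicalSpace IntervalSpace :=
  ⨆ (k : ℕ) (left : Fin k → Bool) (right : Fin k → Bool),
    TopologicalSpace.coinduced (ofFamily left right) inferInstance

theorem empty_mem : ∃ (k : ℕ) (left right : Fin k → Bool), ∃ p ∈ intervalFamilies left right,
    (∅ : Set ℝ) = intervalUnion left right p := by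
  refine ⟨0, Fin.elim0, Fin.elim0, (Fin.elim0, Fin.elim0), ⟨fun i => i.elim0, fun i => i.elim0,
    fun i => i.elim0, fun x _ h => ?_⟩, ?_⟩
  · have : intervalUnion (Fin.elim0 : Fin 0 → Bool) Fin.elim0 (Fin.elim0, Fin.elim0) = ∅ := by
      simp [intervalUnion]
    rw [this] at h
    exact (NormedField.nhdsNE_neBot x).ne (Filter.empty_mem_iff_bot.1 h)
  · simp [intervalUnion]

instance : Zero IntervalSpace := ⟨⟨∅, empty_mem⟩⟩

theorem ext_iff {P Q : IntervalSpace} : P = Q ↔ P.carrier = Q.carrier := by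
  cases P
  cases Q
  simp

/-- The group `G` acts trivially on `I(ℝ)`. -/
instance (G : Type w) [Group G] : MulAction G IntervalSpace where
  smul _ P := P
  one_smul _ := rfl
  mul_smul _ _ _ := rfl

instance (G : Type w) [Group G] : IsPointedGSpace G IntervalSpace where
  smul_basepoint _ := rfl
  continuous_smul _ := continuous_id

/-- The union of a tuple if it belongs to `I(ℝ)` (and the empty set otherwise). -/
def sum {n : ℕ} (P : Fin n → IntervalSpace) : IntervalSpace :=
  open Classical in
  if h : ∃ Q : IntervalSpace, Q.carrier = ⋃ i, (P i).carrier then h.choose else 0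

theorem sum_val {n : ℕ} {P : Fin n → IntervalSpace} (h : ∃ Q : IntervalSpace, Q.carrier = ⋃ i, (P i).carrier) :
    (sum P).carrier = ⋃ i, (P i).carrier := by
  rw [sum, dif_pos h]
  exact h.choose_spec

/-- `I(ℝ)` as a partial monoid: an `n`-tuple is summable if its members are pairwise disjoint and
their union belongs to `I(ℝ)`, and this union is its sum. -/
def partialMonoid (G : Type w) [Group G] : PartialMonoid G IntervalSpace where
  dom n := {P | (Pairwise fun i j => Disjoint (P i).carrier (P j).carrier) ∧
    ∃ Q : IntervalSpace, Q.carrier = ⋃ i, (P i).carrier}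
  sum P := sum P
  smul_mem _ _ h := h
  sum_smul _ _ _ := rfl
  dom_zero P := by
    have h : ∃ Q : IntervalSpace, Q.carrier = ⋃ i, (P i).carrier := ⟨0, by simp; rfl⟩
    refine ⟨⟨fun i => i.elim0, h⟩, ext_iff.2 ?_⟩
    rw [sum_val h]
    simp
    rfl
  dom_one P := by
    have hP : (⋃ i, (P i).carrier) = (P 0).carrier := iSup_unique _
    have h : ∃ Q : IntervalSpace, Q.carrier = ⋃ i, (P i).carrier := ⟨P 0, hP.symm⟩
    exact ⟨⟨fun i j hij => absurd (Subsingleton.elim i j) hij, h⟩,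
      ext_iff.2 ((sum_val h).trans hP)⟩
  assoc {n r} m e P h := by
    have hS : ∀ k, (sum fun i => P (e ⟨k, i⟩)).carrier = ⋃ i, (P (e ⟨k, i⟩)).carrier := fun k => sum_val (h k).2
    have hU : (⋃ k, (sum fun i => P (e ⟨k, i⟩)).carrier) = ⋃ i, (P i).carrier := by
      rw [← e.surjective.iUnion_comp, Set.iUnion_sigma]
      exact Set.iUnion_congr hS
    refine ⟨and_congr ⟨fun hd k l hkl => ?_, fun hd i j hij => ?_⟩ (by rw [hU]), fun hd => ?_⟩
    · change Disjoint (sum fun i => P (e ⟨k, i⟩)).carrier (sum fun i => P (e ⟨l, i⟩)).carrier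
      rw [hS, hS, Set.disjoint_iUnion_left]
      intro i
      rw [Set.disjoint_iUnion_right]
      intro j
      exact hd fun he => hkl (congrArg Sigma.fst (e.injective he))
    · obtain ⟨⟨k, i⟩, rfl⟩ := e.surjective i
      obtain ⟨⟨l, j⟩, rfl⟩ := e.surjective j
      by_cases hkl : k = l
      · subst hkl
        exact (h k).1 fun he => hij (by rw [he])
      · have : Disjoint (sum fun i => P (e ⟨k, i⟩)).carrier (sum fun i => P (e ⟨l, i⟩)).carrier := hd hkl
        rw [hS, hS] at this
        exact this.mono (Set.subset_iUnion (fun i => (P (e ⟨k, i⟩)).carrier) i)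
          (Set.subset_iUnion (fun i => (P (e ⟨l, i⟩)).1) j)
    · refine ext_iff.2 ?_
      rw [sum_val hd.2, sum_val (by rw [hU]; exact hd.2), hU]

variable {G : Type w} [Group G] {M : Type u} [Zero M] [MulAction G M]

/-- The label at the point `t` of an element of `I(ℝ) ∧ M`. -/
def labelAt (t : ℝ) : Smash IntervalSpace M → M :=
  letI := Classical.propDecidable
  Quotient.lift (s := smashSetoid IntervalSpace M) (fun p : IntervalSpace × M => if t ∈ p.1.carrier then p.2 else 0) (by
    have key : ∀ p : IntervalSpace × M, p.1 = 0 ∨ p.2 = 0 →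
        (if t ∈ p.1.carrier then p.2 else 0) = 0 := by
      rintro p (h | h)
      · rw [h]
        exact if_neg (Set.notMem_empty t)
      · rw [h, ite_self]
    rintro p q (rfl | ⟨h, h'⟩)
    · rfl
    · rw [key p h, key q h'])

open Classical in
theorem labelAt_mk (t : ℝ) (P : IntervalSpace) (a : M) :
    labelAt t (Smash.mk P a) = if t ∈ P.carrier then a else 0 := rfl

theorem zero_rel (A : PartialMonoid G M) : addConGen A.SumRel {(0 : M)} 0 := by
  have := PartialMonoid.SumRel.of (A := A) Fin.elim0 (A.dom_zero _).1
  rw [(A.dom_zero _).2] at this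
  refine AddConGen.Rel.symm (AddConGen.Rel.of _ _ ?_)
  simpa using this

theorem labelAt_rel (A : PartialMonoid G M) (t : ℝ) {S T : Multiset (Smash IntervalSpace M)}
    (h : addConGen ((partialMonoid G).DistribRel A) S T) :
    addConGen A.SumRel (S.map (labelAt t)) (T.map (labelAt t)) := by
  classical
  change AddConGen.Rel _ S T at h
  have hmap : ∀ {n : ℕ} (x : Fin n → Smash IntervalSpace M),
      (∑ i, ({x i} : Multiset _)).map (labelAt t) = ∑ i, {labelAt t (x i)} := by
    intro n x
    simp only [PartialMonoid.sum_singleton_eq_map, Multiset.map_map, Function.comp_def]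
  induction h with
  | of S T h =>
    cases h with
    | @left k c hc d =>
      rw [hmap, Multiset.map_singleton]
      simp only [labelAt_mk]
      have hval : ((partialMonoid G).sum c).carrier = ⋃ i, (c i).carrier := sum_val hc.2
      have hz : ∀ s : Finset (Fin k), addConGen A.SumRel (∑ _i ∈ s, {(0 : M)}) 0 := by
        intro s
        have := (addConGen A.SumRel).finsetSum s (f := fun _ => {(0 : M)}) (g := fun _ => 0)
          fun _ _ => zero_rel A
        simpa using this
      by_cases ht : ∃ i, t ∈ (c i).carrier
      · obtain ⟨i, hi⟩ := ht
        have hmem : t ∈ ((partialMonoid G).sum c).carrier := by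
          rw [hval]
          exact Set.mem_iUnion.2 ⟨i, hi⟩
        rw [if_pos hmem, ← Finset.add_sum_erase _ _ (Finset.mem_univ i), if_pos hi]
        have hne : ∀ j ∈ Finset.univ.erase i,
            ({if t ∈ (c j).carrier then d else 0} : Multiset M) = {0} := by
          intro j hj
          rw [if_neg]
          intro hj'
          exact Set.disjoint_left.1 (hc.1 (Finset.ne_of_mem_erase hj)) hj' hi
        rw [Finset.sum_congr rfl hne]
        have := (addConGen A.SumRel).add ((addConGen A.SumRel).refl {d}) (hz (Finset.univ.erase i))
        rwa [add_zero] at this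
      · have hmem : t ∉ ((partialMonoid G).sum c).carrier := by
          rw [hval, Set.mem_iUnion]
          exact ht
        have hne : ∀ j ∈ Finset.univ, ({if t ∈ (c j).carrier then d else 0} : Multiset M) = {0} := by
          intro j _
          rw [if_neg fun h => ht ⟨j, h⟩]
        rw [if_neg hmem, Finset.sum_congr rfl hne]
        exact (addConGen _).trans (hz _) ((addConGen _).symm (zero_rel A))
    | @right l c d hd =>
      rw [hmap, Multiset.map_singleton]
      simp only [labelAt_mk]
      by_cases ht : t ∈ c.carrier
      · simp only [if_pos ht]
        exact AddConGen.Rel.of _ _ (PartialMonoid.SumRel.of d hd)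
      · simp only [if_neg ht]
        have := (addConGen A.SumRel).finsetSum Finset.univ (f := fun _ : Fin l => {(0 : M)})
          (g := fun _ => 0) fun _ _ => zero_rel A
        refine (addConGen _).trans ?_ ((addConGen _).symm (zero_rel A))
        simpa using this
  | refl => exact AddConGen.Rel.refl _
  | symm _ ih => exact AddConGen.Rel.symm ih
  | trans _ _ ih₁ ih₂ => exact AddConGen.Rel.trans ih₁ ih₂
  | add _ _ ih₁ ih₂ =>
    rw [Multiset.map_add, Multiset.map_add]
    exact AddConGen.Rel.add ih₁ ih₂

theorem eq_of_labelAt {x y : Smash IntervalSpace M} (h : ∀ t, labelAt t x = labelAt t y) :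
    x = y := by
  classical
  induction x using Smash.ind with | _ P a
  induction y using Smash.ind with | _ Q b
  simp only [labelAt_mk] at h
  have hz : ∀ (P : IntervalSpace) (a : M), (∀ t, (if t ∈ P.carrier then a else 0) = 0) →
      (Smash.mk P a : Smash IntervalSpace M) = 0 := by
    intro P a h
    by_cases ha : a = 0
    · rw [ha, Smash.mk_zero_right]
    · have hP : P = 0 := ext_iff.2 <| Set.eq_empty_of_forall_notMem fun t ht => ha (by
        have := h t
        rwa [if_pos ht] at this)
      rw [hP, Smash.mk_zero_left]
  by_cases h0 : ∃ t, t ∈ P.carrier ∧ a ≠ 0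
  · obtain ⟨t, ht, ha⟩ := h0
    have hab : a = b := by
      have := h t
      rw [if_pos ht] at this
      by_cases hq : t ∈ Q.carrier
      · rwa [if_pos hq] at this
      · rw [if_neg hq] at this
        exact absurd this ha
    subst hab
    have hPQ : P = Q := by
      refine ext_iff.2 (Set.ext fun s => ?_)
      have := h s
      by_cases h1 : s ∈ P.carrier <;> by_cases h2 : s ∈ Q.carrier
      · exact iff_of_true h1 h2
      · rw [if_pos h1, if_neg h2] at this
        exact absurd this ha
      · rw [if_neg h1, if_pos h2] at this
        exact absurd this.symm ha
      · exact iff_of_false h1 h2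
    rw [hPQ]
  · have hP0 : ∀ t, (if t ∈ P.carrier then a else 0) = 0 := by
      intro t
      by_cases ht : t ∈ P.carrier
      · rw [if_pos ht]
        by_contra ha
        exact h0 ⟨t, ht, ha⟩
      · exact if_neg ht
    rw [hz P a hP0, hz Q b fun t => (h t).symm.trans (hP0 t)]

theorem distribSeparated (A : PartialMonoid G M) : (partialMonoid G).DistribSeparated A := by
  intro x y h
  refine eq_of_labelAt fun t => A.eq_of_addConGen ?_
  simpa using labelAt_rel A t h

end IntervalSpace

/-- The partial monoid `I(ℝ) ∧ M` of labeled unions of intervals. -/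
def stringLabels {G : Type w} [Group G] {M : Type u} [TopologicalSpace M] [Zero M] [MulAction G M]
    [IsPointedGSpace G M] (A : PartialMonoid G M) : PartialMonoid G (Smash IntervalSpace M) :=
  (IntervalSpace.partialMonoid G).smash A (IntervalSpace.distribSeparated A)

/-- The space of strings with labels `I(V, M) = C(V, I(ℝ) ∧ M)`. -/
abbrev StringConf (V : Type u) {G : Type w} [Group G] {M : Type u} [TopologicalSpace M] [Zero M]
    [MulAction G M] [IsPointedGSpace G M] (A : PartialMonoid G M) : Type u :=
  Conf V (stringLabels A)

end

/-! The maps and homotopies on `C(V, M)` that are needed arise from disjoint union, push-forward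
along equivariant embeddings, and relabelling by homomorphisms, together with one homotopy that lets
particles collide.

Any two equivariant embeddings of a space into a universe are isotopic through equivariant
embeddings. The universe contains two orthogonal copies of itself, each reached from the identity by
a linear isotopy (`UniverseShifts`). Each embedding is shifted into its own copy, and a straight
line between orthogonal copies causes no collisions. The unit and associativity laws compare
push-forwards of the same configuration along two embeddings, so they follow from
`UniverseShifts.homotopic_push`.

For the inverse, two copies of a configuration carry the labels `a` and `τ a`. The homotopy `h`
makes the labels summable pair by pair, the two copies are moved onto each other inside the
universe, where labels add (`UniverseShifts.homotopic_superpose`), and the sums are contracted by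
the given null homotopy.

The second part is the first part for the labels `I(ℝ) ∧ M`, which are always homotopically
invertible (`stringLabels_homotopicallyInvertible`). The inversion reflects a union of intervals at
the origin and exchanges open and closed end points. Once the line is compressed into `(-4, 0)`, a
set and its mirror image are disjoint, and their union is `fold` of the set. Sliding the set across
the origin into `(0, 4)` makes it annihilate with its mirror image. This is continuous because of
the toggling: an interval whose right end has crossed the origin forms, with its mirror image, an
interval from `a` to `-a` that is half-open, and such an interval may shrink to nothing. These
operations are defined pointwise by one-sided germs, so they do not depend on a decomposition into
intervals.

Continuity is always checked on representatives, that is on families of particles or of end points,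
because products with compact spaces preserve quotient maps (`continuous_homotopy`,
`continuous_applyOp`). -/

noncomputable section

/-! ### Compactly generated refinements -/

/-- The set `X` with the compactly generated refinement of its topology. -/
def KSpace (X : Type u) : Type u := X

namespace KSpace

variable {X : Type u} [TopologicalSpace X]

instance : TopologicalSpace (KSpace X) := TopologicalSpace.compactlyGenerated.{u} X

/-- The refined topology is by construction coinduced from the disjoint union of all compact
Hausdorff test spaces, and a quotient of a compactly generated space is compactly generated. -/
instance : UCompactlyGeneratedSpace.{u} (KSpace X) := by
  let f : (Σ i : (S : CompHaus.{u}) × C(S, X), i.fst) → KSpace X := fun p => p.1.2 p.2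
  have ht : (inferInstance : TopologicalSpace (KSpace X)) =
      TopologicalSpace.coinduced f inferInstance := rfl
  have : UCompactlyGeneratedSpace.{u} (Σ i : (S : CompHaus.{u}) × C(S, X), i.fst) :=
    instUCompactlyGeneratedSpaceSigma
  exact uCompactlyGeneratedSpace_of_coinduced.{u} (Y := KSpace X) (f := f) (continuous_iff_coinduced_le.2 ht.ge) ht

theorem continuous_val : @Continuous (KSpace X) X _ _ fun x => x :=
  continuous_from_compactlyGenerated (X := X) _ fun _ g => g.continuous

/-- Continuity on `Y` is tested on compact Hausdorff spaces, and the composite of `f` with a test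
map is one of the maps that define the refinement. -/
theorem continuous_lift {Y : Type v} [TopologicalSpace Y] [UCompactlyGeneratedSpace.{u} Y]
    {f : Y → X} (hf : Continuous f) : @Continuous Y (KSpace X) _ _ f := by
  refine continuous_from_uCompactlyGeneratedSpace _ fun S g => ?_
  have h : @Continuous (Σ i : (S : CompHaus.{u}) × C(S, X), i.fst) (KSpace X) _ _
      fun p => p.1.2 p.2 := continuous_coinduced_rng
  exact (continuous_sigma_iff.1 h) ⟨S, ⟨fun s => f (g s), hf.comp g.continuous⟩⟩

end KSpace

section Quotients

variable {X : Type u} [TopologicalSpace X]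

/-- A compactly generated space is a quotient of a disjoint union of compact Hausdorff spaces. -/
theorem isQuotientMap_compHaus [UCompactlyGeneratedSpace.{w} X] :
    IsQuotientMap fun p : (Σ i : (S : CompHaus.{w}) × C(S, X), i.fst) => p.1.2 p.2 := by
  refine ⟨⟨?_⟩, fun x => ⟨⟨⟨CompHaus.of PUnit, ContinuousMap.const _ x⟩, PUnit.unit⟩, rfl⟩⟩
  exact eq_compactlyGenerated

/-- Taking the product with the compact space `T` preserves the presentation of `X` as a quotient of
compact pieces. Hence the ordinary product `unitInterval × X` is already the right one, and
homotopies need no refinement. -/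
theorem uCompactlyGeneratedSpace_prod {T : Type v} [TopologicalSpace T] [CompactSpace T]
    [T2Space T] [UCompactlyGeneratedSpace.{u} X] :
    UCompactlyGeneratedSpace.{max v u} (T × X) := by
  refine uCompactlyGeneratedSpace_of_continuous_maps fun f h => ?_
  refine (isQuotientMap_compHaus (X := X)).continuous_lift_prod_right ?_
  let e : (T × Σ i : (S : CompHaus.{u}) × C(S, X), i.fst) →
      Σ i : (S : CompHaus.{u}) × C(S, X), i.fst × T := fun p => ⟨p.2.1, p.2.2, p.1⟩
  have he : Continuous e := by
    have : e = fun p => Homeomorph.sigmaProdDistrib (p.2, p.1) := rfl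
    rw [this]
    fun_prop
  have hf : Continuous fun q : (Σ i : (S : CompHaus.{u}) × C(S, X), i.fst × T) =>
      f (q.2.2, q.1.2 q.2.1) := by
    refine continuous_sigma fun i => ?_
    exact (h (CompHaus.of (T × i.1)) ⟨fun p => (p.1, i.2 p.2), by fun_prop⟩).comp continuous_swap
  exact hf.comp he

instance {T : Type} [TopologicalSpace T] [CompactSpace T] [T2Space T]
    [UCompactlyGeneratedSpace.{u} X] : UCompactlyGeneratedSpace.{u} (T × X) :=
  uCompactlyGeneratedSpace_prod.{u, 0}

end Quotients

namespace KProd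

instance uCompactlyGeneratedSpace (X : Type u) (Y : Type v) [TopologicalSpace X]
    [TopologicalSpace Y] :
    UCompactlyGeneratedSpace.{max u v} (KProd X Y) :=
  inferInstanceAs (UCompactlyGeneratedSpace.{max u v} (KSpace (X × Y)))

variable {X : Type u} {Y : Type v} [TopologicalSpace X] [TopologicalSpace Y]

theorem continuous_val : Continuous fun p : KProd X Y => ((p.1, p.2) : X × Y) :=
  KSpace.continuous_val (X := X × Y)

theorem continuous_fst : Continuous fun p : KProd X Y => p.1 :=
  _root_.continuous_fst.comp continuous_val

theorem continuous_snd : Continuous fun p : KProd X Y => p.2 :=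
  _root_.continuous_snd.comp continuous_val

theorem continuous_mk {Z : Type w} [TopologicalSpace Z] [UCompactlyGeneratedSpace.{max u v} Z]
    {f : Z → X} {g : Z → Y} (hf : Continuous f) (hg : Continuous g) :
    @Continuous Z (KProd X Y) _ _ fun z => ((f z, g z) : X × Y) :=
  KSpace.continuous_lift (X := X × Y) (hf.prodMk hg)

end KProd

/-- Products with compactly generated spaces preserve quotients of disjoint unions. -/
theorem Topology.IsQuotientMap.continuous_kProd_left {ι : Type v} {X : ι → Type u}
    {X' Y Z : Type u} [∀ i, TopologicalSpace (X i)] [TopologicalSpace X'] [TopologicalSpace Y]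
    [TopologicalSpace Z] [∀ i, UCompactlyGeneratedSpace.{u} (X i)] {q : ∀ i, X i → X'}
    (hq : IsQuotientMap fun p : Σ i, X i => q p.1 p.2) {f : KProd X' Y → Z}
    (hf : ∀ i, Continuous fun p : KProd (X i) Y => f ((q i p.1, p.2) : X' × Y)) :
    Continuous f := by
  refine continuous_from_compactlyGeneratedSpace f fun S _ _ _ g hg => ?_
  -- Only the second coordinate of the test map `g` is kept, the first one being left free. This
  -- reduces the claim to the ordinary product of the quotient map with the compact space `S`; the
  -- graph of the first coordinate of `g` then recovers `f ∘ g`.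
  have h : Continuous fun p : X' × S => f ((p.1, (g p.2).2) : X' × Y) := by
    refine hq.continuous_lift_prod_left ?_
    have h2 : Continuous fun r : (Σ i, X i × S) => f ((q r.1 r.2.1, (g r.2.2).2) : X' × Y) := by
      refine continuous_sigma fun i => ?_
      have : UCompactlyGeneratedSpace.{u} (S × X i) := uCompactlyGeneratedSpace_prod.{u, u}
      have h1 : @Continuous (S × X i) (KProd (X i) Y) _ _ fun p => ((p.2, (g p.1).2) : X i × Y) :=
        KProd.continuous_mk _root_.continuous_snd
          ((KProd.continuous_snd.comp hg).comp _root_.continuous_fst)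
      exact ((hf i).comp h1).comp continuous_swap
    exact h2.comp (Homeomorph.sigmaProdDistrib (X := X) (Y := S)).continuous
  exact h.comp ((KProd.continuous_fst.comp hg).prodMk continuous_id)

theorem KProd.continuous_swap {X Y : Type u} [TopologicalSpace X] [TopologicalSpace Y] :
    @Continuous (KProd X Y) (KProd Y X) _ _ fun p => ((p.2, p.1) : Y × X) :=
  KProd.continuous_mk KProd.continuous_snd KProd.continuous_fst

theorem Topology.IsQuotientMap.continuous_kProd_right {ι : Type v} {X : ι → Type u}
    {X' Y Z : Type u} [∀ i, TopologicalSpace (X i)] [TopologicalSpace X'] [TopologicalSpace Y]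
    [TopologicalSpace Z] [∀ i, UCompactlyGeneratedSpace.{u} (X i)] {q : ∀ i, X i → X'}
    (hq : IsQuotientMap fun p : Σ i, X i => q p.1 p.2) {f : KProd Y X' → Z}
    (hf : ∀ i, Continuous fun p : KProd Y (X i) => f ((p.1, q i p.2) : Y × X')) :
    Continuous f := by
  have h : Continuous fun p : KProd X' Y => f ((p.2, p.1) : Y × X') :=
    hq.continuous_kProd_left (f := fun p : KProd X' Y => f ((p.2, p.1) : Y × X'))
      fun i => (hf i).comp KProd.continuous_swap
  exact h.comp KProd.continuous_swap

/-- A space whose topology is the supremum of coinduced topologies is a quotient of the disjoint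
union. -/
theorem isQuotientMap_sigma {ι : Type v} {X : ι → Type w} [t : ∀ i, TopologicalSpace (X i)]
    {Y : Type u} [tY : TopologicalSpace Y] (f : ∀ i, X i → Y)
    (hsurj : ∀ y, ∃ i x, f i x = y) (hY : tY = ⨆ i, TopologicalSpace.coinduced (f i) (t i)) :
    IsQuotientMap fun p : Σ i, X i => f p.1 p.2 := by
  refine ⟨⟨?_⟩, fun y => ?_⟩
  rotate_left
  · obtain ⟨i, x, h⟩ := hsurj y
    exact ⟨⟨i, x⟩, h⟩
  · rw [hY]
    simp only [instTopologicalSpaceSigma, coinduced_iSup, coinduced_compose]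
    rfl

/-! ### Homotopies -/

namespace GHomotopic

variable {G : Type w} [Group G] {X : Type u} {Y : Type v}
  [TopologicalSpace X] [Zero X] [MulAction G X] [TopologicalSpace Y] [Zero Y] [MulAction G Y]

theorem symm {f g : X → Y} (h : GHomotopic G f g) : GHomotopic G g f := by
  obtain ⟨H, hc, h0, h1, hs, hz⟩ := h
  refine ⟨fun p => H (unitInterval.symm p.1, p.2), by fun_prop, ?_, ?_, ?_, ?_⟩ <;>
    simp [h0, h1, hs, hz]

theorem trans {f g k : X → Y} (h : GHomotopic G f g) (h' : GHomotopic G g k) :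
    GHomotopic G f k := by
  obtain ⟨H, hc, h0, h1, hs, hz⟩ := h
  obtain ⟨H', hc', h0', h1', hs', hz'⟩ := h'
  have cont : ∀ (K : unitInterval × X → Y), Continuous K → ∀ t, Continuous fun x => K (t, x) :=
    fun K hK t => by fun_prop
  have hf : Continuous f := by simpa only [h0] using cont H hc 0
  have hg : Continuous g := by simpa only [h1] using cont H hc 1
  have hk : Continuous k := by simpa only [h1'] using cont H' hc' 1
  let F : ContinuousMap.Homotopy ⟨f, hf⟩ ⟨g, hg⟩ := ⟨⟨H, hc⟩, h0, h1⟩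
  let F' : ContinuousMap.Homotopy ⟨g, hg⟩ ⟨k, hk⟩ := ⟨⟨H', hc'⟩, h0', h1'⟩
  -- Each stage of the concatenation is a stage of `H` or of `H'`, so equivariance and the basepoint
  -- condition are inherited.
  have hFF : ∀ t, (∃ s, ∀ x, (F.trans F') (t, x) = H (s, x)) ∨
      ∃ s, ∀ x, (F.trans F') (t, x) = H' (s, x) := by
    intro t
    by_cases ht : (t : ℝ) ≤ 1 / 2
    · left
      refine ⟨⟨2 * t, (unitInterval.mul_pos_mem_iff zero_lt_two).2 ⟨t.2.1, ht⟩⟩, fun x => ?_⟩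
      rw [ContinuousMap.Homotopy.trans_apply, dif_pos ht]
      rfl
    · right
      refine ⟨⟨2 * t - 1, unitInterval.two_mul_sub_one_mem_iff.2 ⟨(not_le.1 ht).le, t.2.2⟩⟩,
        fun x => ?_⟩
      rw [ContinuousMap.Homotopy.trans_apply, dif_neg ht]
      rfl
  refine ⟨F.trans F', (F.trans F').continuous, fun x => (F.trans F').map_zero_left x,
    fun x => (F.trans F').map_one_left x, fun t γ x => ?_, fun t => ?_⟩
  · rcases hFF t with ⟨s, h⟩ | ⟨s, h⟩ <;> simp only [h, hs, hs']
  · rcases hFF t with ⟨s, h⟩ | ⟨s, h⟩ <;> simp only [h, hz, hz']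

/-- Precomposition with a pointed `G`-map. -/
theorem comp {Z : Type*} [TopologicalSpace Z] [Zero Z] [MulAction G Z] {f g : X → Y}
    (h : GHomotopic G f g) {r : Z → X} (hr : Continuous r) (hrs : ∀ (γ : G) z, r (γ • z) = γ • r z)
    (hr0 : r 0 = 0) : GHomotopic G (fun z => f (r z)) fun z => g (r z) := by
  obtain ⟨H, hc, h0, h1, hs, hz⟩ := h
  exact ⟨fun p => H (p.1, r p.2), by fun_prop, fun z => h0 _, fun z => h1 _,
    fun t γ z => by simp only [hrs, hs], fun t => by simp only [hr0, hz]⟩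

end GHomotopic

/-! ### Formal sums in partial monoids -/

namespace PartialMonoid

variable {G : Type w} [Group G] {M : Type u} [Zero M] [MulAction G M]
  {N : Type v} [Zero N] [MulAction G N]

theorem FormalSum.unique {A : PartialMonoid G M} {S : Multiset M} {s t : M}
    (hs : A.FormalSum S s) (ht : A.FormalSum S t) : s = t := by
  obtain ⟨n, a, rfl, -, rfl⟩ := hs
  exact ht.tuple.2

theorem formalSum_tuple (A : PartialMonoid G M) {n : ℕ} {a : Fin n → M} (ha : a ∈ A.dom n) :
    A.FormalSum (Finset.univ.val.map a) (A.sum a) :=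
  ⟨n, a, (sum_singleton_eq_map a).symm, ha, rfl⟩

theorem formalSum_zero (A : PartialMonoid G M) : A.FormalSum 0 0 :=
  ⟨0, Fin.elim0, by simp, (A.dom_zero _).1, (A.dom_zero _).2⟩

theorem formalSum_singleton (A : PartialMonoid G M) (a : M) : A.FormalSum {a} a :=
  ⟨1, fun _ => a, by simp, (A.dom_one _).1, (A.dom_one _).2⟩

theorem formalSum_pair (A : PartialMonoid G M) {a b : M} (h : ![a, b] ∈ A.dom 2) :
    A.FormalSum ({a} + {b}) (A.sum ![a, b]) :=
  ⟨2, ![a, b], by simp [Fin.sum_univ_two], h, rfl⟩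

/-- Associativity, used twice: a summable block may be replaced by its sum inside any formal sum. -/
theorem FormalSum.add {A : PartialMonoid G M} {S T : Multiset M} {s t z : M}
    (hS : A.FormalSum S s) (hT : A.FormalSum T t) (hz : A.FormalSum ({s} + {t}) z) :
    A.FormalSum (S + T) z := by
  obtain ⟨n, a, rfl, ha, rfl⟩ := hS
  obtain ⟨m, b, rfl, hb, rfl⟩ := hT
  rw [A.formalSum_block a ha, add_comm, A.formalSum_block b hb, add_comm]
  exact hz

theorem IsHom.formalSum [TopologicalSpace M] [TopologicalSpace N] {A : PartialMonoid G M}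
    {B : PartialMonoid G N} {f : M → N} (hf : A.IsHom B f) {S : Multiset M} {s : M}
    (h : A.FormalSum S s) : B.FormalSum (S.map f) (f s) := by
  obtain ⟨n, a, rfl, ha, rfl⟩ := h
  rw [hf.map_sum a ha, sum_singleton_eq_map, Multiset.map_map]
  exact B.formalSum_tuple (hf.map_dom a ha)

theorem IsHom.map_zero [TopologicalSpace M] [TopologicalSpace N] {A : PartialMonoid G M}
    {B : PartialMonoid G N} {f : M → N} (hf : A.IsHom B f) : f 0 = 0 :=
  (hf.formalSum A.formalSum_zero).unique B.formalSum_zero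

theorem formalSum_smul (A : PartialMonoid G M) (g : G) {S : Multiset M} {s : M}
    (h : A.FormalSum S s) : A.FormalSum (S.map (g • ·)) (g • s) := by
  obtain ⟨n, a, rfl, ha, rfl⟩ := h
  rw [← A.sum_smul g a ha, sum_singleton_eq_map, Multiset.map_map]
  exact A.formalSum_tuple (A.smul_mem g a ha)

end PartialMonoid

/-! ### Configurations represented by families of particles -/

namespace Conf

/-- Passes from the ordered tuples in the definition of configurations to multisets, for which any
finite index type will do. -/
theorem restrict_map {E : Type*} {n : ℕ} (s : Finset (Fin n)) (a : Fin n → E) :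
    Finset.univ.val.map (PartialMonoid.restrict s a) = s.val.map a := by
  have h : s.val = Finset.univ.val.map (s.orderEmbOfFin rfl) := by
    conv_lhs => rw [← Finset.map_orderEmbOfFin_univ s rfl]
    rfl
  conv_rhs => rw [h, Multiset.map_map]
  rfl

variable {G : Type w} [Group G] {M : Type u} [Zero M] [MulAction G M] {N : Type u} [Zero N]
  [MulAction G N] {X Y Z : Type u} {A : PartialMonoid G M} {B : PartialMonoid G N}

/-- The label of the point `y` in the configuration `c`. -/
def label (c : Conf X A) (y : X) : M := DFunLike.coe (F := X →₀ M) c y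

theorem ext_label {c d : Conf X A} (h : ∀ y, c.label y = d.label y) : c = d :=
  Finsupp.ext (M := M) h

/-- The family of particles at the points `x i` with labels `a i` represents the configuration
`c`. -/
def Represents {ι : Type*} [Fintype ι] (A : PartialMonoid G M) (x : ι → X) (a : ι → M)
    (c : Conf X A) : Prop :=
  open Classical in
  ∀ y, A.FormalSum ((Finset.univ.filter fun i => x i = y).val.map a) (c.label y)

theorem Represents.unique {ι : Type*} [Fintype ι] {x : ι → X} {a : ι → M} {c d : Conf X A}
    (hc : Represents A x a c) (hd : Represents A x a d) : c = d :=
  ext_label fun y => (hc y).unique (hd y)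

theorem Represents.reindex {ι κ : Type*} [Fintype ι] [Fintype κ] {x : ι → X} {a : ι → M}
    {c : Conf X A} (h : Represents A x a c) (e : κ ≃ ι) : Represents A (x ∘ e) (a ∘ e) c := by
  classical
  intro y
  have h' := h y
  have hu : (Finset.univ.filter fun i => x i = y) =
      (Finset.univ.filter fun k => x (e k) = y).map e.toEmbedding := by
    ext i
    simp only [Finset.mem_filter, Finset.mem_univ, true_and, Finset.mem_map_equiv,
      Equiv.apply_symm_apply]
  rw [hu, Finset.map_val, Multiset.map_map] at h'
  exact h'

theorem represents_ofTuple {n : ℕ} (p : tuples X A n) :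
    Represents A p.1.1 p.1.2 (ofTuple A n p) := by
  intro y
  have h := A.formalSum_tuple (p.2 y)
  rw [restrict_map] at h
  exact h

/-- Summability over each point is part of `FormalSum`, and it holds for every ordering of the
labels once it holds for one. -/
theorem Represents.mem_tuples {n : ℕ} {x : Fin n → X} {a : Fin n → M} {c : Conf X A}
    (h : Represents A x a c) : (x, a) ∈ tuples X A n := by
  intro y
  have h' := h y
  have e := restrict_map (indices x y) a
  rw [← PartialMonoid.sum_singleton_eq_map] at e
  refine PartialMonoid.FormalSum.tuple (s := c.label y) ?_ |>.1
  rw [e]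
  exact h'

theorem Represents.ofTuple_eq {n : ℕ} {x : Fin n → X} {a : Fin n → M} {c : Conf X A}
    (h : Represents A x a c) : ofTuple A n ⟨(x, a), h.mem_tuples⟩ = c :=
  (represents_ofTuple ⟨(x, a), h.mem_tuples⟩).unique h

/-- The points of the support serve as particles; over each position there is then at most one of
them. -/
theorem exists_represents (c : Conf X A) :
    ∃ (n : ℕ) (x : Fin n → X) (a : Fin n → M), Represents A x a c := by
  classical
  let s : Finset X := Finsupp.support (c : X →₀ M)
  have h : Represents A (fun i : s => (i : X)) (fun i : s => c.label i) c := by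
    intro y
    by_cases hy : y ∈ s
    · have : (Finset.univ.filter fun i : s => (i : X) = y) = {⟨y, hy⟩} := by
        ext i
        simp [Subtype.ext_iff]
      rw [this]
      exact A.formalSum_singleton _
    · have : (Finset.univ.filter fun i : s => (i : X) = y) = ∅ := by
        ext i
        simp only [Finset.mem_filter, Finset.mem_univ, true_and, Finset.notMem_empty, iff_false]
        rintro rfl
        exact hy i.2
      have hz : c.label y = 0 := Finsupp.notMem_support_iff.1 hy
      rw [this, hz]
      exact A.formalSum_zero
  exact ⟨_, _, _, h.reindex (Fintype.equivFin s).symm⟩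

/-! ### Topology -/

variable [TopologicalSpace X] [TopologicalSpace Y] [TopologicalSpace Z] [TopologicalSpace M]
  [TopologicalSpace N]

theorem continuous_tuples_val (A : PartialMonoid G M) (n : ℕ) :
    @Continuous (KSpace (tuples X A n)) ((Fin n → X) × (Fin n → M)) _ _ Subtype.val :=
  Continuous.comp (Y := tuples X A n) (continuous_subtype_val (p := (· ∈ tuples X A n)))
    KSpace.continuous_val

theorem isQuotientMap_ofTuple (A : PartialMonoid G M) :
    IsQuotientMap fun p : (Σ n : ℕ, KSpace (tuples X A n)) => ofTuple A p.1 p.2 := by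
  refine isQuotientMap_sigma (X := fun n => KSpace (tuples X A n)) (fun n p => ofTuple A n p)
    (fun c => ?_) rfl
  obtain ⟨n, x, a, h⟩ := exists_represents c
  exact ⟨n, _, h.ofTuple_eq⟩

instance : UCompactlyGeneratedSpace.{u} (Conf X A) :=
  uCompactlyGeneratedSpace_of_coinduced.{u} (isQuotientMap_ofTuple A).continuous
    (isQuotientMap_ofTuple A).eq_coinduced

/-- A map into a configuration space is continuous if it lifts to families of particles. -/
theorem continuous_of_represents {T : Type v} [TopologicalSpace T] [UCompactlyGeneratedSpace.{u} T]
    {ι : Type*} [Fintype ι] {x : T → ι → X} {a : T → ι → M} {F : T → Conf X A}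
    (hx : Continuous x) (ha : Continuous a) (h : ∀ t, Represents A (x t) (a t) (F t)) :
    Continuous F := by
  let e := (Fintype.equivFin ι).symm
  have h' : ∀ t, Represents A (x t ∘ e) (a t ∘ e) (F t) := fun t => (h t).reindex e
  have hc : Continuous fun t => (⟨(x t ∘ e, a t ∘ e), (h' t).mem_tuples⟩ : tuples X A _) := by
    refine Continuous.subtype_mk ?_ _
    exact (continuous_pi fun i => (continuous_apply (e i)).comp hx).prodMk
      (continuous_pi fun i => (continuous_apply (e i)).comp ha)
  have hF : F = fun t => ofTuple A _ ⟨(x t ∘ e, a t ∘ e), (h' t).mem_tuples⟩ :=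
    funext fun t => (h' t).ofTuple_eq.symm
  rw [hF]
  have hk := (continuous_sigmaMk (σ := fun n => KSpace (tuples X A n))).comp
    (KSpace.continuous_lift (X := tuples X A (Fintype.card ι)) hc)
  exact (isQuotientMap_ofTuple A).continuous.comp hk

/-- Compactness of `T` makes `T × Conf X A` a quotient of spaces of tuples. There `F` is given by
formulas `y`, `b` that move positions and labels separately and are continuous on all tuples,
summable or not. The index type `κ n` allows the number of particles to change, as it does when two
copies of a configuration are superposed. -/
theorem continuous_homotopy {T : Type} [TopologicalSpace T] [CompactSpace T] [T2Space T]
    {F : T × Conf X A → Conf Y B} {κ : ℕ → Type} [∀ n, Fintype (κ n)]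
    (y : ∀ {n}, T → (Fin n → X) → κ n → Y) (b : ∀ {n}, T → (Fin n → M) → κ n → N)
    (hy : ∀ n, Continuous fun p : T × (Fin n → X) => y p.1 p.2)
    (hb : ∀ n, Continuous fun p : T × (Fin n → M) => b p.1 p.2)
    (h : ∀ t n (x : Fin n → X) (a : Fin n → M) c, Represents A x a c →
      Represents B (y t x) (b t a) (F (t, c))) : Continuous F := by
  refine (isQuotientMap_ofTuple A).continuous_lift_prod_right ?_
  let e : (T × Σ n : ℕ, KSpace (tuples X A n)) → Σ n : ℕ, KSpace (tuples X A n) × T :=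
    fun p => ⟨p.2.1, p.2.2, p.1⟩
  have he : Continuous e := by
    have : e = fun p => Homeomorph.sigmaProdDistrib (p.2, p.1) := rfl
    rw [this]
    fun_prop
  have hF : Continuous fun q : (Σ n : ℕ, KSpace (tuples X A n) × T) =>
      F (q.2.2, ofTuple A q.1 q.2.1) := by
    refine continuous_sigma fun n => ?_
    have hK : Continuous fun p : T × KSpace (tuples X A n) => F (p.1, ofTuple A n p.2) := by
      have hv : Continuous fun p : T × KSpace (tuples X A n) => Subtype.val p.2 :=
        (continuous_tuples_val A n).comp continuous_snd
      refine continuous_of_represents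
        (x := fun p : T × KSpace (tuples X A n) => y p.1 (p.2 : tuples X A n).1.1)
        (a := fun p : T × KSpace (tuples X A n) => b p.1 (p.2 : tuples X A n).1.2) ?_ ?_ ?_
      · exact (hy n).comp (continuous_fst.prodMk (continuous_fst.comp hv))
      · exact (hb n).comp (continuous_fst.prodMk (continuous_snd.comp hv))
      · exact fun p => h _ _ _ _ _ (represents_ofTuple _)
    exact hK.comp continuous_swap
  exact hF.comp he

/-! ### Operations on configurations -/


end Conf

namespace Conf

variable {G : Type w} [Group G] {M : Type u} [Zero M] [MulAction G M] {N : Type u} [Zero N]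
  [MulAction G N] {X Y Z : Type u} {A : PartialMonoid G M} {B : PartialMonoid G N}

/-! ### Operations on configurations -/

/-- The image of a configuration under an embedding. -/
def push (A : PartialMonoid G M) (e : X ↪ Y) (c : Conf X A) : Conf Y A :=
  Finsupp.embDomain e (c : X →₀ M)

/-- The configuration with the labels mapped by `f`. -/
def mapLabels (A : PartialMonoid G M) (B : PartialMonoid G N) (f : M → N) (hf : f 0 = 0)
    (c : Conf X A) : Conf X B :=
  Finsupp.mapRange f hf (c : X →₀ M)

/-- The disjoint union of two configurations. -/
def disjUnion (A : PartialMonoid G M) (c : Conf X A) (d : Conf Y A) : Conf (X ⊕ Y) A :=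
  Finsupp.sumElim (c : X →₀ M) (d : Y →₀ M)

theorem label_push (e : X ↪ Y) (c : Conf X A) (x : X) : (push A e c).label (e x) = c.label x :=
  Finsupp.embDomain_apply_self e (c : X →₀ M) x

theorem label_push_of_notMem (e : X ↪ Y) (c : Conf X A) {y : Y} (hy : y ∉ Set.range e) :
    (push A e c).label y = 0 :=
  Finsupp.embDomain_of_notMem_range e (c : X →₀ M) y hy

/-- Allows the set of particles over a point to be presented in any convenient form. -/
theorem represents_of_exists {ι : Type*} [Fintype ι] {x : ι → X} {a : ι → M} {c : Conf X A}
    (h : ∀ y, ∃ s : Finset ι, (∀ i, i ∈ s ↔ x i = y) ∧ A.FormalSum (s.val.map a) (c.label y)) :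
    Represents A x a c := by
  classical
  intro y
  obtain ⟨s, hs, h⟩ := h y
  have : (Finset.univ.filter fun i => x i = y) = s := by
    ext i
    simp [hs]
  rw [this]
  exact h

section Represents

variable {ι κ : Type*} [Fintype ι] [Fintype κ] {x : ι → X} {a : ι → M} {c : Conf X A}

/-- Injectivity is essential: no new particles come together, so no new summability condition
arises. -/
theorem Represents.push (h : Represents A x a c) (e : X ↪ Y) :
    Represents A (fun i => e (x i)) a (push A e c) := by
  classical
  intro y
  by_cases hy : y ∈ Set.range e
  · obtain ⟨z, rfl⟩ := hy
    rw [label_push]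
    simpa only [e.injective.eq_iff] using h z
  · rw [label_push_of_notMem e c hy]
    have : (Finset.univ.filter fun i => e (x i) = y) = ∅ :=
      Finset.filter_eq_empty_iff.2 fun i _ hi => hy ⟨_, hi⟩
    rw [this]
    exact A.formalSum_zero

theorem Represents.mapLabels (h : Represents A x a c) {f : M → N} (hf : f 0 = 0)
    (hS : ∀ {S s}, A.FormalSum S s → B.FormalSum (S.map f) (f s)) :
    Represents B x (fun i => f (a i)) (mapLabels A B f hf c) := by
  classical
  intro y
  have := hS (h y)
  rw [Multiset.map_map] at this
  exact this

theorem Represents.disjUnion {y : κ → Y} {b : κ → M} {d : Conf Y A} (h : Represents A x a c)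
    (h' : Represents A y b d) :
    Represents A (Sum.map x y) (Sum.elim a b) (disjUnion A c d) := by
  classical
  refine represents_of_exists ?_
  rintro (z | z)
  · refine ⟨(Finset.univ.filter fun i => x i = z).map Function.Embedding.inl, ?_, ?_⟩
    · rintro (i | i) <;> simp
    · rw [Finset.map_val, Multiset.map_map]
      exact h z
  · refine ⟨(Finset.univ.filter fun i => y i = z).map Function.Embedding.inr, ?_, ?_⟩
    · rintro (i | i) <;> simp
    · rw [Finset.map_val, Multiset.map_map]
      exact h' z

/-- Two copies of the same particles with labels `f₁ a` and `f₂ a` lie on top of each other. Over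
each point the two copies sum to `f₁ s` and `f₂ s`, and `hsum` adds these. This is the moment of
collision in `UniverseShifts.homotopic_superpose`. -/
theorem Represents.superpose (h : Represents A x a c) {f₁ f₂ f : M → N} (hf : f 0 = 0)
    (h₁ : ∀ {S s}, A.FormalSum S s → B.FormalSum (S.map f₁) (f₁ s))
    (h₂ : ∀ {S s}, A.FormalSum S s → B.FormalSum (S.map f₂) (f₂ s))
    (hsum : ∀ s, B.FormalSum ({f₁ s} + {f₂ s}) (f s)) :
    Represents B (Sum.elim x x) (Sum.elim (fun i => f₁ (a i)) fun i => f₂ (a i))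
      (Conf.mapLabels A B f hf c) := by
  classical
  refine represents_of_exists fun y => ?_
  refine ⟨(Finset.univ.filter fun i => x i = y).disjSum (Finset.univ.filter fun i => x i = y),
    ?_, ?_⟩
  · rintro (i | i) <;> simp
  · have := (h₁ (h y)).add (h₂ (h y)) (hsum (c.label y))
    rw [Multiset.map_map, Multiset.map_map] at this
    rw [Finset.val_disjSum, Multiset.disjSum, Multiset.map_add, Multiset.map_map, Multiset.map_map]
    exact this

theorem Represents.smul [MulAction G X] (h : Represents A x a c) (g : G) :
    Represents A (fun i => g • x i) (fun i => g • a i) (g • c) := by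
  classical
  intro y
  have := A.formalSum_smul g (h (g⁻¹ • y))
  rw [Multiset.map_map] at this
  simp only [eq_inv_smul_iff] at this
  exact this

end Represents

theorem push_zero (e : X ↪ Y) : push A e 0 = 0 := Finsupp.embDomain_zero e

theorem mapLabels_zero (f : M → N) (hf : f 0 = 0) : mapLabels A B f hf (0 : Conf X A) = 0 :=
  Finsupp.mapRange_zero

theorem disjUnion_zero : disjUnion A (0 : Conf X A) (0 : Conf Y A) = 0 :=
  ext_label (by rintro (_ | _) <;> rfl)

theorem smul_zero' [MulAction G X] (g : G) : g • (0 : Conf X A) = 0 :=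
  ext_label fun _ => A.smul_basepoint g

section Equivariance

variable [MulAction G X] [MulAction G Y]

theorem push_smul (e : X ↪ Y) (he : ∀ (g : G) x, e (g • x) = g • e x) (g : G) (c : Conf X A) :
    push A e (g • c) = g • push A e c := by
  obtain ⟨n, x, a, h⟩ := exists_represents c
  have h₁ := (h.smul g).push e
  simp only [he] at h₁
  exact h₁.unique ((h.push e).smul g)

theorem mapLabels_smul (f : M → N) (hf : f 0 = 0) (hs : ∀ (g : G) a, f (g • a) = g • f a)
    (g : G) (c : Conf X A) : mapLabels A B f hf (g • c) = g • mapLabels A B f hf c :=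
  ext_label fun _ => hs g _

theorem disjUnion_smul (g : G) (c : Conf X A) (d : Conf Y A) :
    disjUnion A (g • c) (g • d) = g • disjUnion A c d :=
  ext_label (by rintro (_ | _) <;> rfl)

end Equivariance

variable [TopologicalSpace X] [TopologicalSpace Y] [TopologicalSpace Z] [TopologicalSpace M]
  [TopologicalSpace N]

/-- Here the compactly generated product is needed: both factors are quotients, and they are
replaced by spaces of tuples one after the other. -/
theorem continuous_disjUnion :
    Continuous fun p : KProd (Conf X A) (Conf Y A) => disjUnion A p.1 p.2 := by
  refine (isQuotientMap_ofTuple (X := X) A).continuous_kProd_left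
    (X := fun n => KSpace (tuples X A n)) fun n => ?_
  refine (isQuotientMap_ofTuple (X := Y) A).continuous_kProd_right
    (X := fun n => KSpace (tuples Y A n)) fun m => ?_
  have hX := (continuous_tuples_val (X := X) A n).comp
    (KProd.continuous_fst (X := KSpace (tuples X A n)) (Y := KSpace (tuples Y A m)))
  have hY := (continuous_tuples_val (X := Y) A m).comp
    (KProd.continuous_snd (X := KSpace (tuples X A n)) (Y := KSpace (tuples Y A m)))
  refine continuous_of_represents
    (x := fun p : KProd (KSpace (tuples X A n)) (KSpace (tuples Y A m)) =>
      Sum.map (Subtype.val p.1).1 (Subtype.val p.2).1)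
    (a := fun p : KProd (KSpace (tuples X A n)) (KSpace (tuples Y A m)) =>
      Sum.elim (Subtype.val p.1).2 (Subtype.val p.2).2)
    (continuous_pi ?_) (continuous_pi ?_) fun p =>
      (represents_ofTuple _).disjUnion (represents_ofTuple _)
  · rintro (i | i)
    · exact continuous_inl.comp ((continuous_apply i).comp (continuous_fst.comp hX))
    · exact continuous_inr.comp ((continuous_apply i).comp (continuous_fst.comp hY))
  · rintro (i | i)
    · exact (continuous_apply i).comp (continuous_snd.comp hX)
    · exact (continuous_apply i).comp (continuous_snd.comp hY)

theorem continuous_homotopy_push (e : unitInterval → X ↪ Y)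
    (hc : Continuous fun p : unitInterval × X => e p.1 p.2) :
    Continuous fun p : unitInterval × Conf X A => push A (e p.1) p.2 :=
  continuous_homotopy (κ := fun n => Fin n) (fun t x i => e t (x i)) (fun _ a => a)
    (fun _ => continuous_pi fun i => hc.comp
      (continuous_fst.prodMk ((continuous_apply i).comp continuous_snd)))
    (fun _ => continuous_snd) fun t _ _ _ _ h => h.push (e t)

theorem homotopic_push [MulAction G X] [MulAction G Y] (e : unitInterval → X ↪ Y)
    (hc : Continuous fun p : unitInterval × X => e p.1 p.2)
    (hs : ∀ t (g : G) x, e t (g • x) = g • e t x) :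
    GHomotopic G (push A (e 0)) (push A (e 1)) :=
  ⟨_, continuous_homotopy_push e hc, fun _ => rfl, fun _ => rfl, fun t => push_smul _ (hs t),
    fun _ => push_zero _⟩

theorem continuous_push (e : X ↪ Y) (hc : Continuous e) : Continuous (push A e) :=
  (continuous_homotopy_push (fun _ => e) (hc.comp continuous_snd)).comp
    (continuous_const (y := (0 : unitInterval)).prodMk continuous_id)

theorem continuous_homotopy_mapLabels (f : unitInterval → M → N) (hf : ∀ t, f t 0 = 0)
    (hc : Continuous fun p : unitInterval × M => f p.1 p.2)
    (hS : ∀ t {S s}, A.FormalSum S s → B.FormalSum (S.map (f t)) (f t s)) :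
    Continuous fun p : unitInterval × Conf X A => mapLabels A B (f p.1) (hf p.1) p.2 :=
  continuous_homotopy (κ := fun n => Fin n) (fun _ x => x) (fun t a i => f t (a i))
    (fun _ => continuous_snd) (fun _ => continuous_pi fun i => hc.comp
      (continuous_fst.prodMk ((continuous_apply i).comp continuous_snd)))
    fun t _ _ _ _ h => h.mapLabels (hf t) (hS t)

theorem continuous_mapLabels (f : M → N) (hf : f 0 = 0) (hc : Continuous f)
    (hS : ∀ {S s}, A.FormalSum S s → B.FormalSum (S.map f) (f s)) :
    Continuous (mapLabels A B f hf : Conf X A → Conf X B) :=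
  (continuous_homotopy_mapLabels (fun _ => f) (fun _ => hf) (hc.comp continuous_snd)
    fun _ _ _ => hS).comp (continuous_const (y := (0 : unitInterval)).prodMk continuous_id)

theorem isPointedGSpace [MulAction G X] (hX : ∀ g : G, Continuous fun x : X => g • x)
    [IsPointedGSpace G M] : IsPointedGSpace G (Conf X A) where
  smul_basepoint := smul_zero'
  continuous_smul g := by
    have h : Continuous fun p : unitInterval × Conf X A => g • p.2 :=
      continuous_homotopy (κ := fun n => Fin n) (fun _ x i => g • x i) (fun _ a i => g • a i)
        (fun _ => continuous_pi fun i => (hX g).comp ((continuous_apply i).comp continuous_snd))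
        (fun _ => continuous_pi fun i => (IsPointedGSpace.continuous_smul g).comp
          ((continuous_apply i).comp continuous_snd)) fun _ _ _ _ _ h => h.smul g
    exact h.comp (continuous_const (y := (0 : unitInterval)).prodMk continuous_id)

end Conf

/-! ### `G`-universes -/

/-- Two complementary equivariant isometries of a `G`-universe, each of which is isotopic to the
identity by a linear homotopy. -/
structure UniverseShifts (G : Type w) [Group G] (V : Type u) [NormedAddCommGroup V]
    [InnerProductSpace ℝ V] [MulAction G V] where
  smul_add' : ∀ (g : G) (x y : V), g • (x + y) = g • x + g • y
  smul_real : ∀ (g : G) (r : ℝ) (x : V), g • (r • x) = r • (g • x)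
  continuous_smul : ∀ g : G, Continuous fun x : V => g • x
  shift : Bool → V →ₗ[ℝ] V
  shift_smul : ∀ i (g : G) x, shift i (g • x) = g • shift i x
  norm_shift_add : ∀ x y, ‖shift false x + shift true y‖ ^ 2 = ‖x‖ ^ 2 + ‖y‖ ^ 2
  line_injective : ∀ i (t : ℝ) x, (1 - t) • x + t • shift i x = 0 → x = 0
  fixedVector : V
  smul_fixedVector : ∀ g : G, g • fixedVector = fixedVector
  fixedVector_ne : fixedVector ≠ 0

/-- If `N` is the largest index in the support of `x`, then in degree `σ N > N` only the shifted
summand contributes, with value `t • x N`. Hence `t = 0`, and the equation becomes `x = 0`. -/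
theorem Finsupp.line_injective {E : Type*} [AddCommGroup E] [Module ℝ E] {σ : ℕ → ℕ}
    (hσ : StrictMono σ) (hlt : ∀ n, n < σ n) (t : ℝ) (x : ℕ →₀ E)
    (h : (1 - t) • x + t • x.mapDomain σ = 0) : x = 0 := by
  by_contra hx
  have hne : x.support.Nonempty := Finsupp.support_nonempty_iff.2 hx
  set N := x.support.max' hne with hN
  have hNx : x N ≠ 0 := Finsupp.mem_support_iff.1 (x.support.max'_mem hne)
  have hz : x (σ N) = 0 := by
    by_contra h0
    exact absurd (x.support.le_max' _ (Finsupp.mem_support_iff.2 h0)) (not_le.2 (hlt N))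
  have h1 := DFunLike.congr_fun h (σ N)
  simp only [Finsupp.add_apply, Finsupp.smul_apply, hz, smul_zero, zero_add,
    Finsupp.mapDomain_apply hσ.injective, Finsupp.zero_apply, smul_eq_zero, hNx, or_false] at h1
  rw [h1] at h
  simp only [sub_zero, one_smul, zero_smul, add_zero] at h
  exact hx h

namespace IsGUniverse

variable {G : Type w} [Group G] [Fintype G] {V : Type u} [NormedAddCommGroup V]
  [InnerProductSpace ℝ V] [MulAction G V]

/-- Reindexing the countably many copies of the regular representation along two injections of `ℕ`
with disjoint images gives equivariant isometries with orthogonal images. -/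
theorem nonempty_shifts (hV : IsGUniverse G V) : Nonempty (UniverseShifts G V) := by
  obtain ⟨φ, hinner, hsmul⟩ := hV
  have hnorm : ∀ x : V, ‖x‖ ^ 2 = (φ x).sum fun _ a => ‖a‖ ^ 2 := by
    intro x
    rw [← real_inner_self_eq_norm_sq, hinner]
    exact Finsupp.sum_congr fun n _ => real_inner_self_eq_norm_sq _
  have hφ : ∀ x y : V, (∀ n h, φ x n h = φ y n h) → x = y := fun x y h =>
    φ.injective (Finsupp.ext fun n => PiLp.ext fun k => h n k)
  -- The action on `V` is given merely as an action on a set; its linearity is read off from the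
  -- coordinate formula `hsmul`.
  have hadd : ∀ (g : G) (x y : V), g • (x + y) = g • x + g • y := by
    intro g x y
    refine hφ _ _ fun n h => ?_
    simp [hsmul]
  have hreal : ∀ (g : G) (r : ℝ) (x : V), g • (r • x) = r • (g • x) := by
    intro g r x
    refine hφ _ _ fun n h => ?_
    simp [hsmul]
  have hnormg : ∀ (g : G) (x : V) n, ‖φ (g • x) n‖ ^ 2 = ‖φ x n‖ ^ 2 := by
    intro g x n
    simp only [EuclideanSpace.norm_sq_eq, hsmul]
    exact Fintype.sum_equiv (Equiv.mulLeft g⁻¹) _ _ fun h => rfl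
  have hisom : ∀ (g : G) (x : V), ‖g • x‖ = ‖x‖ := by
    intro g x
    refine (sq_eq_sq₀ (norm_nonneg _) (norm_nonneg _)).1 ?_
    rw [hnorm, hnorm]
    have hsupp : (φ (g • x)).support = (φ x).support := by
      ext n
      have := hnormg g x n
      rw [Finsupp.mem_support_iff, Finsupp.mem_support_iff, not_iff_not, ← norm_eq_zero,
        ← norm_eq_zero (a := φ x n), ← sq_eq_zero_iff, this, sq_eq_zero_iff]
    rw [Finsupp.sum, Finsupp.sum, hsupp]
    exact Finset.sum_congr rfl fun n _ => hnormg g x n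
  -- Odd numbers and positive even numbers. The offset matters: `2 * n` would fix `0`, whereas
  -- `Finsupp.line_injective` needs `n < σ n` for all `n`.
  let σ : Bool → ℕ → ℕ := fun i n => bif i then 2 * n + 2 else 2 * n + 1
  have hσ : ∀ i, StrictMono (σ i) := by
    rintro (_ | _) m n h <;> simp only [σ, cond_true, cond_false] <;> omega
  have hlt : ∀ i n, n < σ i n := by
    rintro (_ | _) n <;> simp only [σ, cond_true, cond_false] <;> omega
  let s : Bool → V →ₗ[ℝ] V := fun i =>
    φ.symm.toLinearMap ∘ₗ Finsupp.lmapDomain _ ℝ (σ i) ∘ₗ φ.toLinearMap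
  have hs : ∀ i x, φ (s i x) = (φ x).mapDomain (σ i) := fun i x => by simp [s]
  have hgφ : ∀ (g : G) (x : V) n, φ x n = 0 → φ (g • x) n = 0 := by
    intro g x n h
    have := hnormg g x n
    rw [h, norm_zero] at this
    simpa using this
  refine ⟨⟨hadd, hreal, fun g => ?_, s, fun i g x => ?_, fun x y => ?_, fun i t x h => ?_,
    -- The fixed vector is the constant function `1` in the first copy of the regular
    -- representation.
    φ.symm (Finsupp.single 0 (WithLp.toLp 2 fun _ => 1)), fun g => ?_, fun h => ?_⟩⟩
  · refine (AddMonoidHomClass.isometry_of_norm (⟨⟨fun x => g • x, ?_⟩, hadd g⟩ : V →+ V)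
      (hisom g)).continuous
    simpa using hreal g 0 0
  · refine hφ _ _ fun n k => ?_
    rw [hsmul, hs, hs]
    by_cases hn : n ∈ Set.range (σ i)
    · obtain ⟨m, rfl⟩ := hn
      rw [Finsupp.mapDomain_apply (hσ i).injective, Finsupp.mapDomain_apply (hσ i).injective,
        hsmul]
    · rw [Finsupp.mapDomain_of_notMem_range _ _ hn, Finsupp.mapDomain_of_notMem_range _ _ hn]
      rfl
  · rw [hnorm, hnorm, hnorm, map_add, hs, hs]
    have hd : Disjoint ((φ x).mapDomain (σ false)).support
        ((φ y).mapDomain (σ true)).support := by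
      classical
      refine Finset.disjoint_left.2 fun n h₁ h₂ => ?_
      obtain ⟨m, -, rfl⟩ := Finset.mem_image.1 (Finsupp.mapDomain_support h₁)
      obtain ⟨k, -, hk⟩ := Finset.mem_image.1 (Finsupp.mapDomain_support h₂)
      simp only [σ, cond_true, cond_false] at hk
      omega
    rw [Finsupp.sum_add_index_of_disjoint hd, Finsupp.sum_mapDomain_index_inj (hσ _).injective,
      Finsupp.sum_mapDomain_index_inj (hσ _).injective]
  · have h1 := congrArg φ h
    rw [map_add, map_smul, map_smul, hs, map_zero] at h1
    exact φ.map_eq_zero_iff.1 (Finsupp.line_injective (hσ i) (hlt i) t _ h1)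
  · refine hφ _ _ fun n k => ?_
    rw [hsmul, LinearEquiv.apply_symm_apply]
    by_cases hn : n = 0
    · subst hn
      simp
    · simp [Finsupp.single_eq_of_ne hn]
  · have h1 := congrArg (fun v => φ v 0 1) h
    simp at h1

end IsGUniverse

/-! ### Isotopies of embeddings into a universe -/

namespace UniverseShifts

variable {G : Type w} [Group G] {V : Type u} [NormedAddCommGroup V] [InnerProductSpace ℝ V]
  [MulAction G V] (s : UniverseShifts G V)

theorem smul_zero' (s : UniverseShifts G V) (g : G) : g • (0 : V) = 0 := by simpa using s.smul_real g 0 0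

theorem norm_shift (i : Bool) (x : V) : ‖s.shift i x‖ = ‖x‖ := by
  refine (sq_eq_sq₀ (norm_nonneg _) (norm_nonneg _)).1 ?_
  cases i
  · simpa using s.norm_shift_add x 0
  · simpa using s.norm_shift_add 0 x

theorem continuous_shift (i : Bool) : Continuous (s.shift i) :=
  (AddMonoidHomClass.isometry_of_norm (s.shift i) (s.norm_shift i)).continuous

/-- The images of the two shifts are orthogonal: by `norm_shift_add` the difference of the two sides
vanishes only if both components do. -/
theorem shift_add_inj {x y x' y' : V}
    (h : s.shift false x + s.shift true y = s.shift false x' + s.shift true y') :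
    x = x' ∧ y = y' := by
  have h1 : s.shift false (x - x') + s.shift true (y - y') = 0 := by
    rw [map_sub, map_sub, ← sub_eq_zero.2 h]
    abel
  have h2 := s.norm_shift_add (x - x') (y - y')
  rw [h1, norm_zero] at h2
  have h3 := sq_nonneg ‖x - x'‖
  have h4 := sq_nonneg ‖y - y'‖
  constructor
  · rw [← sub_eq_zero, ← norm_eq_zero, ← sq_eq_zero_iff]
    linarith
  · rw [← sub_eq_zero, ← norm_eq_zero, ← sq_eq_zero_iff]
    linarith

/-- The sum of the two shifts is an isometry of `V × V`, and the origin and the nonzero fixed vector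
are two distinct fixed points. -/
theorem nonempty_hopfData (s : UniverseShifts G V) : Nonempty (HopfData G V) := by
  let l : WithLp 2 (V × V) →ₗ[ℝ] V :=
    (s.shift false).coprod (s.shift true) ∘ₗ (WithLp.linearEquiv 2 ℝ (V × V)).toLinearMap
  have hl : ∀ p : WithLp 2 (V × V), l p = s.shift false p.fst + s.shift true p.snd := fun p => rfl
  refine ⟨⟨⟨l, fun p => ?_⟩, fun g x y => ?_, 0, s.fixedVector, s.fixedVector_ne.symm,
    s.smul_zero', s.smul_fixedVector⟩⟩
  · refine (sq_eq_sq₀ (norm_nonneg _) (norm_nonneg _)).1 ?_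
    rw [hl, s.norm_shift_add, WithLp.prod_norm_sq_eq_of_L2]
  · change s.shift false (g • x) + s.shift true (g • y) = g • (s.shift false x + s.shift true y)
    rw [s.shift_smul, s.shift_smul, s.smul_add']

/-- The linear homotopy from the identity to a shift. -/
def lineEmbedding (i : Bool) (t : ℝ) : V ↪ V where
  toFun x := (1 - t) • x + t • s.shift i x
  inj' x y h := by
    refine sub_eq_zero.1 (s.line_injective i t (x - y) ?_)
    rw [map_sub, smul_sub, smul_sub, ← sub_eq_zero.2 h]
    dsimp only
    abel

/-- The linear homotopy between two embeddings that are shifted apart. -/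
def crossEmbedding {X : Type*} (e e' : X ↪ V) (t : ℝ) : X ↪ V where
  toFun x := (1 - t) • s.shift false (e x) + t • s.shift true (e' x)
  inj' x y h := by
    simp only [← map_smul] at h
    obtain ⟨h1, h2⟩ := s.shift_add_inj h
    -- At least one of the coefficients `1 - t` and `t` is nonzero, so at every time one of the two
    -- orthogonal components determines the point.
    by_cases ht : t = 0
    · rw [ht, sub_zero, one_smul, one_smul] at h1
      exact e.injective h1
    · exact e'.injective (smul_right_injective V ht h2)

/-- An equivariant isometry onto a part of the universe, as an embedding. -/
def shiftEmbedding (i : Bool) : V ↪ V where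
  toFun := s.shift i
  inj' x y h := by
    cases i
    · exact (s.shift_add_inj (y := 0) (y' := 0) (by rw [h])).1
    · exact (s.shift_add_inj (x := 0) (x' := 0) (by rw [h])).2

open Conf

variable {M : Type u} [Zero M] [MulAction G M] [TopologicalSpace M] {A : PartialMonoid G M}
  {X : Type u} [TopologicalSpace X] [MulAction G X]

/-- The straight line from the identity to a shift consists of injective equivariant linear maps. -/
theorem homotopic_shift {e : X ↪ V} (hc : Continuous e) (he : ∀ (g : G) x, e (g • x) = g • e x)
    (i : Bool) :
    GHomotopic G (push A e) (push A (e.trans (s.shiftEmbedding i))) := by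
  have hs := s.continuous_shift i
  have h := homotopic_push (A := A) (fun t : unitInterval => e.trans (s.lineEmbedding i t))
    (G := G) ?_ ?_
  · have h0 : e.trans (s.lineEmbedding i (0 : unitInterval)) = e := by
      ext x
      simp [lineEmbedding]
    have h1 : e.trans (s.lineEmbedding i (1 : unitInterval)) = e.trans (s.shiftEmbedding i) := by
      refine DFunLike.ext _ _ fun x => ?_
      change (1 - ((1 : unitInterval) : ℝ)) • e x + ((1 : unitInterval) : ℝ) • s.shift i (e x) =
        s.shift i (e x)
      simp
    rwa [h0, h1] at h
  · change Continuous fun p : unitInterval × X =>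
      (1 - (p.1 : ℝ)) • e p.2 + (p.1 : ℝ) • s.shift i (e p.2)
    fun_prop
  · intro t g x
    change (1 - (t : ℝ)) • e (g • x) + (t : ℝ) • s.shift i (e (g • x)) =
      g • ((1 - (t : ℝ)) • e x + (t : ℝ) • s.shift i (e x))
    rw [s.smul_add', s.smul_real, s.smul_real, he, s.shift_smul]

/-- Any two equivariant embeddings into a universe are isotopic. -/
theorem homotopic_push (s : UniverseShifts G V) {e e' : X ↪ V} (hc : Continuous e) (hc' : Continuous e')
    (he : ∀ (g : G) x, e (g • x) = g • e x) (he' : ∀ (g : G) x, e' (g • x) = g • e' x) :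
    GHomotopic G (push A e) (push A e') := by
  have hs := s.continuous_shift
  -- The straight line from `e` to `e'` may have collisions. Therefore `e` and `e'` are first moved
  -- into orthogonal copies of the universe, and the line is drawn there.
  refine (s.homotopic_shift hc he false).trans
    (GHomotopic.trans ?_ (s.homotopic_shift hc' he' true).symm)
  have h := Conf.homotopic_push (A := A) (fun t : unitInterval => s.crossEmbedding e e' t)
    (G := G) ?_ ?_
  · have h0 : s.crossEmbedding e e' (0 : unitInterval) = e.trans (s.shiftEmbedding false) := by
      refine DFunLike.ext _ _ fun x => ?_
      change (1 - ((0 : unitInterval) : ℝ)) • s.shift false (e x) +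
        ((0 : unitInterval) : ℝ) • s.shift true (e' x) = s.shift false (e x)
      simp
    have h1 : s.crossEmbedding e e' (1 : unitInterval) = e'.trans (s.shiftEmbedding true) := by
      refine DFunLike.ext _ _ fun x => ?_
      change (1 - ((1 : unitInterval) : ℝ)) • s.shift false (e x) +
        ((1 : unitInterval) : ℝ) • s.shift true (e' x) = s.shift true (e' x)
      simp
    rwa [h0, h1] at h
  · change Continuous fun p : unitInterval × X =>
      (1 - (p.1 : ℝ)) • s.shift false (e p.2) + (p.1 : ℝ) • s.shift true (e' p.2)
    have h0 := hs false
    have h1 := hs true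
    fun_prop
  · intro t g x
    change (1 - (t : ℝ)) • s.shift false (e (g • x)) + (t : ℝ) • s.shift true (e' (g • x)) =
      g • ((1 - (t : ℝ)) • s.shift false (e x) + (t : ℝ) • s.shift true (e' x))
    rw [s.smul_add', s.smul_real, s.smul_real, he, he', s.shift_smul, s.shift_smul]

end UniverseShifts

/-! ### Compatibility of push-forwards and disjoint unions -/

namespace Conf

variable {G : Type w} [Group G] {M : Type u} [Zero M] [MulAction G M] {X Y Z : Type u}
  {A : PartialMonoid G M}

theorem push_push (e : X ↪ Y) (e' : Y ↪ Z) (c : Conf X A) :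
    push A e' (push A e c) = push A (e.trans e') c := by
  obtain ⟨n, x, a, h⟩ := exists_represents c
  exact ((h.push e).push e').unique (h.push (e.trans e'))

theorem push_refl (c : Conf X A) : push A (Function.Embedding.refl X) c = c := by
  obtain ⟨n, x, a, h⟩ := exists_represents c
  exact (h.push _).unique h

theorem disjUnion_push_push {X' Y' : Type u} (e : X ↪ X') (e' : Y ↪ Y') (c : Conf X A)
    (d : Conf Y A) :
    disjUnion A (push A e c) (push A e' d) = push A (e.sumMap e') (disjUnion A c d) := by
  obtain ⟨n, x, a, h⟩ := exists_represents c
  obtain ⟨m, y, b, h'⟩ := exists_represents d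
  have h1 := (h.disjUnion h').push (e.sumMap e')
  have h2 := (h.push e).disjUnion (h'.push e')
  have : (fun i => e.sumMap e' (Sum.map x y i)) = Sum.map (fun i => e (x i)) fun i => e' (y i) := by
    funext i
    cases i <;> rfl
  rw [this] at h1
  exact h2.unique h1

theorem disjUnion_assoc (c : Conf X A) (d : Conf Y A) (f : Conf Z A) :
    disjUnion A c (disjUnion A d f) =
      push A (Equiv.sumAssoc X Y Z).toEmbedding (disjUnion A (disjUnion A c d) f) := by
  refine ext_label ?_
  rintro (z | z | z)
  · exact (label_push (Equiv.sumAssoc X Y Z).toEmbedding (disjUnion A (disjUnion A c d) f) (Sum.inl (Sum.inl z))).symm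
  · exact (label_push (Equiv.sumAssoc X Y Z).toEmbedding (disjUnion A (disjUnion A c d) f) (Sum.inl (Sum.inr z))).symm
  · exact (label_push (Equiv.sumAssoc X Y Z).toEmbedding (disjUnion A (disjUnion A c d) f) (Sum.inr z)).symm

theorem disjUnion_comm (c : Conf X A) (d : Conf Y A) :
    disjUnion A d c = push A (Equiv.sumComm X Y).toEmbedding (disjUnion A c d) := by
  refine ext_label ?_
  rintro (z | z)
  · exact (label_push (Equiv.sumComm X Y).toEmbedding (disjUnion A c d) (Sum.inr z)).symm
  · exact (label_push (Equiv.sumComm X Y).toEmbedding (disjUnion A c d) (Sum.inl z)).symm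

theorem disjUnion_zero_left (c : Conf Y A) :
    disjUnion A (0 : Conf X A) c = push A Function.Embedding.inr c := by
  refine ext_label ?_
  rintro (z | z)
  · exact (label_push_of_notMem _ _ (by simp)).symm
  · exact (label_push Function.Embedding.inr c z).symm

theorem disjUnion_zero_right (c : Conf X A) :
    disjUnion A c (0 : Conf Y A) = push A Function.Embedding.inl c := by
  refine ext_label ?_
  rintro (z | z)
  · exact (label_push Function.Embedding.inl c z).symm
  · exact (label_push_of_notMem _ _ (by simp)).symm

end Conf

open Conf

namespace HopfData

variable {G : Type w} [Group G] {V : Type u} [NormedAddCommGroup V] [InnerProductSpace ℝ V]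
  [MulAction G V] (d : HopfData G V)

theorem continuous_embedding : Continuous d.embedding := by
  have h : ∀ p : V, Continuous fun x => d.isometry (WithLp.toLp 2 (p, x)) := fun p =>
    d.isometry.continuous.comp
      ((WithLp.prod_continuous_toLp 2 V V).comp (continuous_const.prodMk continuous_id))
  exact continuous_sum_dom.2 ⟨h _, h _⟩

theorem embedding_smul (g : G) (x : V ⊕ V) : d.embedding (g • x) = g • d.embedding x := by
  rcases x with x | x
  · have := d.isometry_smul g d.point₁ x
    rw [d.smul_point₁] at this
    exact this
  · have := d.isometry_smul g d.point₂ x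
    rw [d.smul_point₂] at this
    exact this

end HopfData

/-! ### The Hopf structure and its homotopy inversion -/

section Hopf

variable {G : Type w} [Group G] {V : Type u} [NormedAddCommGroup V] [InnerProductSpace ℝ V]
  [MulAction G V] {M : Type u} [TopologicalSpace M] [Zero M] [MulAction G M]

/-- Superposition of two labelings that become summable, by moving the two copies of `V` together
within the universe. -/
theorem UniverseShifts.homotopic_superpose (s : UniverseShifts G V) (A : PartialMonoid G M)
    {e : V ⊕ V ↪ V} (hc : Continuous e) (he : ∀ (g : G) x, e (g • x) = g • e x)
    {f₁ f₂ f : M → M} (h₁ : A.IsHom A f₁) (h₂ : A.IsHom A f₂) (hf : A.IsHom A f)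
    (hdom : ∀ a, ![f₁ a, f₂ a] ∈ A.dom 2) (hsum : ∀ a, f a = A.sum ![f₁ a, f₂ a]) :
    GHomotopic G
      (fun c : Conf V A => push A (e.trans (s.shiftEmbedding false))
        (disjUnion A (mapLabels A A f₁ h₁.map_zero c) (mapLabels A A f₂ h₂.map_zero c)))
      (fun c => push A (s.shiftEmbedding true) (mapLabels A A f hf.map_zero c)) := by
  classical
  have hs := s.continuous_shift
  -- For `t < 1` the first component has a nonzero coefficient and keeps the map injective. At `t =
  -- 1` only the second component is left, in which the two copies of `V` coincide.
  let E : unitInterval → V ⊕ V → V := fun t p =>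
    (1 - (t : ℝ)) • s.shift false (e p) + (t : ℝ) • s.shift true (Sum.elim id id p)
  have hE : ∀ t, t ≠ 1 → Function.Injective (E t) := by
    intro t ht p q hpq
    simp only [E, ← map_smul] at hpq
    have ht' : (1 - (t : ℝ)) ≠ 0 := fun h => ht (Subtype.ext (sub_eq_zero.1 h).symm)
    exact e.injective (smul_right_injective V ht' (s.shift_add_inj hpq).1)
  have hEc : Continuous fun p : unitInterval × (V ⊕ V) => E p.1 p.2 := by
    have h0 := hs false
    have h1 := hs true
    have h2 : Continuous (Sum.elim id id : V ⊕ V → V) := by fun_prop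
    change Continuous fun p : unitInterval × (V ⊕ V) =>
      (1 - (p.1 : ℝ)) • s.shift false (e p.2) + (p.1 : ℝ) • s.shift true (Sum.elim id id p.2)
    fun_prop
  have hEs : ∀ t (g : G) p, E t (g • p) = g • E t p := by
    intro t g p
    have : Sum.elim id id (g • p) = g • (Sum.elim id id p : V) := by cases p <;> rfl
    change (1 - (t : ℝ)) • s.shift false (e (g • p)) +
      (t : ℝ) • s.shift true (Sum.elim id id (g • p)) =
      g • ((1 - (t : ℝ)) • s.shift false (e p) + (t : ℝ) • s.shift true (Sum.elim id id p))
    rw [s.smul_add', s.smul_real, s.smul_real, he, this, s.shift_smul, s.shift_smul]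
  -- A case distinction is forced because `E 1` is not an embedding. Continuity at `t = 1` is not
  -- lost: on families of particles both cases are given by the same formula `E t`.
  let H : unitInterval × Conf V A → Conf V A := fun p =>
    if h : p.1 ≠ 1 then push A ⟨E p.1, hE p.1 h⟩
      (disjUnion A (mapLabels A A f₁ h₁.map_zero p.2) (mapLabels A A f₂ h₂.map_zero p.2))
    else push A (s.shiftEmbedding true) (mapLabels A A f hf.map_zero p.2)
  refine ⟨H, ?_, fun c => ?_, fun c => ?_, fun t g c => ?_, fun t => ?_⟩
  · refine continuous_homotopy (κ := fun n => Fin n ⊕ Fin n) (fun t x i => E t (Sum.map x x i))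
      (fun _ a => Sum.elim (fun i => f₁ (a i)) fun i => f₂ (a i)) (fun n => continuous_pi ?_)
      (fun n => continuous_pi ?_) fun t n x a c h => ?_
    · rintro (i | i)
      · exact hEc.comp (continuous_fst.prodMk
          (continuous_inl.comp ((continuous_apply i).comp continuous_snd)))
      · exact hEc.comp (continuous_fst.prodMk
          (continuous_inr.comp ((continuous_apply i).comp continuous_snd)))
    · rintro (i | i)
      · exact h₁.continuous.comp ((continuous_apply i).comp continuous_snd)
      · exact h₂.continuous.comp ((continuous_apply i).comp continuous_snd)
    · by_cases ht : t = 1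
      · simp only [H, ht, ne_eq, not_true, dite_false]
        have h3 := (h.superpose hf.map_zero h₁.formalSum h₂.formalSum fun a => by
          rw [hsum]
          exact A.formalSum_pair (hdom a)).push (s.shiftEmbedding true)
        have : (fun i => E 1 (Sum.map x x i)) =
            fun i => s.shiftEmbedding true (Sum.elim x x i) := by
          funext i
          change (1 - ((1 : unitInterval) : ℝ)) • _ + ((1 : unitInterval) : ℝ) • _ =
            s.shift true (Sum.elim x x i)
          cases i <;> simp
        rw [this]
        exact h3
      · simp only [H, ne_eq, ht, not_false_eq_true, dite_true]
        exact ((h.mapLabels h₁.map_zero h₁.formalSum).disjUnion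
          (h.mapLabels h₂.map_zero h₂.formalSum)).push ⟨E t, hE t ht⟩
  · simp only [H, ne_eq, zero_ne_one, not_false_eq_true, dite_true]
    congr 1
    refine DFunLike.ext _ _ fun p => ?_
    change (1 - ((0 : unitInterval) : ℝ)) • s.shift false (e p) + ((0 : unitInterval) : ℝ) • _ =
      s.shift false (e p)
    simp
  · simp only [H, ne_eq, not_true, dite_false]
  · by_cases ht : t = 1
    · simp only [H, ht, ne_eq, not_true, dite_false]
      rw [mapLabels_smul _ _ hf.map_smul, push_smul _ (s.shift_smul true)]
    · simp only [H, ne_eq, ht, not_false_eq_true, dite_true]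
      rw [mapLabels_smul _ _ h₁.map_smul, mapLabels_smul _ _ h₂.map_smul, disjUnion_smul,
        push_smul _ (hEs t)]
  · by_cases ht : t = 1
    · simp only [H, ht, ne_eq, not_true, dite_false]
      rw [mapLabels_zero, push_zero]
    · simp only [H, ne_eq, ht, not_false_eq_true, dite_true]
      rw [mapLabels_zero, mapLabels_zero, disjUnion_zero, push_zero]

theorem PartialMonoid.IsHom.fst {A B : PartialMonoid G M} {f : M → KProd M M}
    (h : A.IsHom (B.prod B) f) : A.IsHom B fun a => (f a).1 where
  continuous := KProd.continuous_fst.comp h.continuous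
  map_smul g a := congrArg Prod.fst (h.map_smul g a)
  map_dom a ha := (h.map_dom a ha).1
  map_sum a ha := congrArg Prod.fst (h.map_sum a ha)

theorem PartialMonoid.IsHom.snd {A B : PartialMonoid G M} {f : M → KProd M M}
    (h : A.IsHom (B.prod B) f) : A.IsHom B fun a => (f a).2 where
  continuous := KProd.continuous_snd.comp h.continuous
  map_smul g a := congrArg Prod.snd (h.map_smul g a)
  map_dom a ha := (h.map_dom a ha).2
  map_sum a ha := congrArg Prod.snd (h.map_sum a ha)

variable {A : PartialMonoid G M}

/-- Four homotopies are concatenated. The labels `(a, τ a)` on the two copies of `V` are deformed by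
`h` until they are summable. The image is shifted into one half of the universe. The two copies are
brought together in the other half, where the labels become `k (0, a)`. Finally `k` takes all labels
to `0`. -/
theorem UniverseShifts.homotopic_inverse (s : UniverseShifts G V) {e : V ⊕ V ↪ V}
    (hc : Continuous e) (he : ∀ (g : G) x, e (g • x) = g • e x) {τ : M → M}
    {h : unitInterval × M → KProd M M} {k : unitInterval × M → M} (hτ : A.IsHom A τ)
    (hh : Continuous h) (hhom : ∀ t, A.IsHom (A.prod A) fun a => h (t, a))
    (h0 : ∀ a, h (0, a) = ((a, τ a) : M × M))
    (hdom : ∀ a, ![(h (1, a)).1, (h (1, a)).2] ∈ A.dom 2) (hk : Continuous k)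
    (hkhom : ∀ t, A.IsHom A fun a => k (t, a))
    (hk0 : ∀ a, k (0, a) = A.sum ![(h (1, a)).1, (h (1, a)).2]) (hk1 : ∀ a, k (1, a) = 0) :
    GHomotopic G (fun c : Conf V A => push A e (disjUnion A c (mapLabels A A τ hτ.map_zero c)))
      fun _ => 0 := by
  let D : unitInterval → Conf V A → Conf (V ⊕ V) A := fun t c =>
    disjUnion A (mapLabels A A (fun a => (h (t, a)).1) (hhom t).fst.map_zero c)
      (mapLabels A A (fun a => (h (t, a)).2) (hhom t).snd.map_zero c)
  have hD : Continuous fun p : unitInterval × Conf V A => D p.1 p.2 :=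
    continuous_disjUnion.comp (KProd.continuous_mk
      (continuous_homotopy_mapLabels (fun t a => (h (t, a)).1) (fun t => (hhom t).fst.map_zero)
        (KProd.continuous_fst.comp hh) fun t _ _ => (hhom t).fst.formalSum)
      (continuous_homotopy_mapLabels (fun t a => (h (t, a)).2) (fun t => (hhom t).snd.map_zero)
        (KProd.continuous_snd.comp hh) fun t _ _ => (hhom t).snd.formalSum))
  have hDs : ∀ t (g : G) c, D t (g • c) = g • D t c := fun t g c => by
    simp only [D]
    rw [mapLabels_smul _ _ (hhom t).fst.map_smul, mapLabels_smul _ _ (hhom t).snd.map_smul,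
      disjUnion_smul]
  have hD0 : ∀ t, D t 0 = 0 := fun t => by
    simp only [D]
    rw [mapLabels_zero, mapLabels_zero, disjUnion_zero]
  have hs := s.continuous_shift
  have step1 : GHomotopic G
      (fun c : Conf V A => push A e (disjUnion A c (mapLabels A A τ hτ.map_zero c)))
      fun c => push A e (D 1 c) := by
    refine ⟨fun p => push A e (D p.1 p.2), (continuous_push e hc).comp hD, fun c => ?_,
      fun c => rfl, fun t g c => ?_, fun t => ?_⟩
    · have hl : mapLabels A A (fun a => (h (0, a)).1) (hhom 0).fst.map_zero c = c :=
        ext_label fun y => congrArg Prod.fst (h0 (c.label y))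
      have hr : mapLabels A A (fun a => (h (0, a)).2) (hhom 0).snd.map_zero c = mapLabels A A τ hτ.map_zero c :=
        ext_label fun y => congrArg Prod.snd (h0 (c.label y))
      simp only [D]
      rw [hl, hr]
    · simp only [hDs]
      exact push_smul _ he _ _
    · simp only [hD0]
      exact push_zero _
  have step2 : GHomotopic G (fun c => push A e (D 1 c))
      fun c => push A (e.trans (s.shiftEmbedding false)) (D 1 c) :=
    (s.homotopic_shift hc he false).comp
      (hD.comp (continuous_const (y := (1 : unitInterval)).prodMk continuous_id)) (hDs 1) (hD0 1)
  have step3 := s.homotopic_superpose A hc he (hhom 1).fst (hhom 1).snd (hkhom 0) hdom hk0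
  refine step1.trans (step2.trans (step3.trans ?_))
  refine ⟨fun p => push A (s.shiftEmbedding true)
    (mapLabels A A (fun a => k (p.1, a)) (hkhom p.1).map_zero p.2), ?_, fun c => rfl, fun c => ?_, fun t g c => ?_,
    fun t => ?_⟩
  · exact (continuous_push (s.shiftEmbedding true) (hs true)).comp
      (continuous_homotopy_mapLabels (fun t a => k (t, a)) (fun t => (hkhom t).map_zero) hk
        fun t _ _ => (hkhom t).formalSum)
  · have : mapLabels A A (fun a => k (1, a)) (hkhom 1).map_zero c = 0 := ext_label fun y => hk1 (c.label y)
    simp only [this]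
    exact push_zero _
  · change push A _ (mapLabels A A (fun a => k (t, a)) _ (g • c)) = g • push A _ _
    rw [mapLabels_smul (fun a => k (t, a)) _ (hkhom t).map_smul]
    exact push_smul (s.shiftEmbedding true) (s.shift_smul true) _ _
  · simp only [mapLabels_zero]
    exact push_zero _

/-- For units and associativity both sides are push-forwards of one configuration along two
equivariant embeddings; only the inversion uses the hypothesis on the labels. -/
theorem UniverseShifts.isGrouplikeHopfGSpace (s : UniverseShifts G V) (d : HopfData G V)
    [IsPointedGSpace G M] (hA : A.HomotopicallyInvertible) :
    IsGrouplikeHopfGSpace G (Conf V A) (d.mul A) := by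
  obtain ⟨τ, h, hτ, hh, hhom, h0, hdom, k, hk, hkhom, hk0, hk1⟩ := hA
  have hc := d.continuous_embedding
  have he := d.embedding_smul
  have hν : Continuous (mapLabels A A τ hτ.map_zero : Conf V A → Conf V A) :=
    continuous_mapLabels τ hτ.map_zero hτ.continuous hτ.formalSum
  have hinv := s.homotopic_inverse hc he hτ hh hhom h0 hdom hk hkhom hk0 hk1
  have hid : GHomotopic G (push A (Function.Embedding.refl V)) fun c => c := by
    have := s.homotopic_push (A := A) (e := .refl V) (e' := .refl V) continuous_id continuous_id
      (fun _ _ => rfl) fun _ _ => rfl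
    have h : push A (Function.Embedding.refl V) = fun c => c := funext push_refl
    rwa [h] at this ⊢
  refine
    { pointedGSpace := isPointedGSpace s.continuous_smul
      continuous_mul := (continuous_push _ hc).comp continuous_disjUnion
      mul_smul := fun g p => ?_
      mul_basepoint := ?_
      unit_left := ?_
      unit_right := ?_
      assoc := ?_
      inverse := ⟨mapLabels A A τ hτ.map_zero, hν, mapLabels_smul _ _ hτ.map_smul,
        mapLabels_zero _ _, hinv, ?_⟩ }
  · change push A d.embedding (disjUnion A (g • p.1) (g • p.2)) = _
    rw [disjUnion_smul, push_smul _ he]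
    rfl
  · change push A d.embedding (disjUnion A 0 0) = 0
    rw [disjUnion_zero, push_zero]
  · have : (fun y : Conf V A => d.mul A ((0, y) : Conf V A × Conf V A)) =
        push A (Function.Embedding.inr.trans d.embedding) := by
      funext y
      change push A d.embedding (disjUnion A 0 y) = _
      rw [disjUnion_zero_left, push_push]
    rw [this]
    exact (s.homotopic_push (e := Function.Embedding.inr.trans d.embedding) (hc.comp continuous_inr)
      continuous_id (fun g x => he g (Sum.inr x)) fun _ _ => rfl).trans hid
  · have : (fun y : Conf V A => d.mul A ((y, 0) : Conf V A × Conf V A)) =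
        push A (Function.Embedding.inl.trans d.embedding) := by
      funext y
      change push A d.embedding (disjUnion A y 0) = _
      rw [disjUnion_zero_right, push_push]
    rw [this]
    exact (s.homotopic_push (e := Function.Embedding.inl.trans d.embedding) (hc.comp continuous_inl)
      continuous_id (fun g x => he g (Sum.inl x)) fun _ _ => rfl).trans hid
  -- Both bracketings push the same threefold disjoint union forward, along different embeddings of
  -- three copies of `V`.
  · let D : KProd (KProd (Conf V A) (Conf V A)) (Conf V A) → Conf ((V ⊕ V) ⊕ V) A :=
      fun p => disjUnion A (disjUnion A p.1.1 p.1.2) p.2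
    have hD : Continuous D := continuous_disjUnion.comp
      (KProd.continuous_mk (continuous_disjUnion.comp KProd.continuous_fst) KProd.continuous_snd)
    let e₁ : (V ⊕ V) ⊕ V ↪ V :=
      (d.embedding.sumMap (Function.Embedding.refl V)).trans d.embedding
    let e₂ : (V ⊕ V) ⊕ V ↪ V := (Equiv.sumAssoc V V V).toEmbedding.trans
      (((Function.Embedding.refl V).sumMap d.embedding).trans d.embedding)
    have hl : (fun p : KProd (KProd (Conf V A) (Conf V A)) (Conf V A) =>
        d.mul A ((d.mul A p.1, p.2) : Conf V A × Conf V A)) = fun p => push A e₁ (D p) := by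
      funext p
      change push A d.embedding (disjUnion A (push A d.embedding (disjUnion A p.1.1 p.1.2)) p.2) = _
      have := disjUnion_push_push d.embedding (Function.Embedding.refl V)
        (disjUnion A p.1.1 p.1.2) p.2
      rw [push_refl] at this
      rw [this, push_push]
    have hr : (fun p : KProd (KProd (Conf V A) (Conf V A)) (Conf V A) =>
        d.mul A ((p.1.1, d.mul A ((p.1.2, p.2) : Conf V A × Conf V A)) : Conf V A × Conf V A)) =
        fun p => push A e₂ (D p) := by
      funext p
      change push A d.embedding
        (disjUnion A p.1.1 (push A d.embedding (disjUnion A p.1.2 p.2))) = _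
      have := disjUnion_push_push (Function.Embedding.refl V) d.embedding
        p.1.1 (disjUnion A p.1.2 p.2)
      rw [push_refl] at this
      rw [this, push_push, disjUnion_assoc, push_push]
    rw [hl, hr]
    refine GHomotopic.comp (s.homotopic_push ?_ ?_ ?_ ?_) hD (fun g p => ?_) ?_
    · exact hc.comp (hc.sumMap continuous_id)
    · exact hc.comp ((continuous_id.sumMap hc).comp (Homeomorph.sumAssoc V V V).continuous)
    · rintro g ((x | x) | x)
      · exact (congrArg (fun z => d.embedding (Sum.inl z)) (he g (Sum.inl x))).trans
          (he g (Sum.inl _))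
      · exact (congrArg (fun z => d.embedding (Sum.inl z)) (he g (Sum.inr x))).trans
          (he g (Sum.inl _))
      · exact he g (Sum.inr x)
    · rintro g ((x | x) | x)
      · exact he g (Sum.inl x)
      · exact (congrArg (fun z => d.embedding (Sum.inr z)) (he g (Sum.inl x))).trans
          (he g (Sum.inr _))
      · exact (congrArg (fun z => d.embedding (Sum.inr z)) (he g (Sum.inr x))).trans
          (he g (Sum.inr _))
    · change disjUnion A (disjUnion A (g • p.1.1) (g • p.1.2)) (g • p.2) = g • D p
      rw [disjUnion_smul, disjUnion_smul]
    · change disjUnion A (disjUnion A 0 0) 0 = 0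
      rw [disjUnion_zero, disjUnion_zero]
  -- Exchanging the factors precomposes the embedding of `V ⊕ V` with the swap, and the result is
  -- isotopic to the original embedding. So the left inverse reduces to the right one.
  · refine GHomotopic.trans ?_ hinv
    have hl : (fun y : Conf V A =>
        d.mul A ((mapLabels A A τ hτ.map_zero y, y) : Conf V A × Conf V A)) = fun y =>
        push A ((Equiv.sumComm V V).toEmbedding.trans d.embedding)
          (disjUnion A y (mapLabels A A τ hτ.map_zero y)) := by
      funext y
      change push A d.embedding (disjUnion A _ y) = _
      rw [disjUnion_comm, push_push]
    rw [hl]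
    refine GHomotopic.comp (s.homotopic_push ?_ hc ?_ he)
      (continuous_disjUnion.comp (KProd.continuous_mk continuous_id hν)) (fun g y => ?_) ?_
    · exact hc.comp (Homeomorph.sumComm V V).continuous
    · rintro g (x | x)
      · exact he g (Sum.inr x)
      · exact he g (Sum.inl x)
    · rw [mapLabels_smul _ _ hτ.map_smul, disjUnion_smul]
    · rw [mapLabels_zero, disjUnion_zero]

end Hopf

/-! ### One-sided germs of sets of reals -/

/-- Sets of reals with well defined one-sided germs at all points, such that neither the set nor
its complement has an isolated point. -/
structure IsTame (U : Set ℝ) : Prop where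
  left : ∀ x, U ∈ 𝓝[<] x ∨ Uᶜ ∈ 𝓝[<] x
  right : ∀ x, U ∈ 𝓝[>] x ∨ Uᶜ ∈ 𝓝[>] x
  of_mem : ∀ x ∈ U, U ∈ 𝓝[<] x ∨ U ∈ 𝓝[>] x
  of_notMem : ∀ x ∉ U, U ∈ 𝓝[<] x → U ∉ 𝓝[>] x

theorem mem_nhdsNE_iff {U : Set ℝ} {x : ℝ} : U ∈ 𝓝[≠] x ↔ U ∈ 𝓝[<] x ∧ U ∈ 𝓝[>] x := by
  rw [← Set.Iio_union_Ioi, nhdsWithin_union, Filter.mem_sup]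

theorem mem_interval {l r : Bool} {a b x : ℝ} : x ∈ interval l r a b ↔
    (if l then a ≤ x else a < x) ∧ (if r then x ≤ b else x < b) := Iff.rfl

theorem interval_subset_Icc {l r : Bool} {a b x : ℝ} (h : x ∈ interval l r a b) :
    a ≤ x ∧ x ≤ b := by
  rw [mem_interval] at h
  cases l <;> cases r <;> simp at h <;> constructor <;> linarith [h.1, h.2]

theorem mem_interval_of_Ioo {l r : Bool} {a b x : ℝ} (h : a < x) (h' : x < b) :
    x ∈ interval l r a b := by
  rw [mem_interval]
  cases l <;> cases r <;> simp [h, h', h.le, h'.le]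

section interval

variable {l r : Bool} {a b : ℝ}

theorem interval_mem_left {x : ℝ} (h : a < x ∧ x ≤ b) : interval l r a b ∈ 𝓝[<] x := by
  filter_upwards [Ioo_mem_nhdsLT h.1] with y hy
  exact mem_interval_of_Ioo hy.1 (hy.2.trans_le h.2)

theorem compl_interval_mem_left {x : ℝ} (h : ¬(a < x ∧ x ≤ b)) :
    (interval l r a b)ᶜ ∈ 𝓝[<] x := by
  by_cases hx : a < x
  · have hb : b < x := not_le.1 fun hb => h ⟨hx, hb⟩
    filter_upwards [Ioo_mem_nhdsLT hb] with y hy hy'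
    exact absurd (interval_subset_Icc hy').2 (not_le.2 hy.1)
  · filter_upwards [self_mem_nhdsWithin] with y (hy : y < x) hy'
    exact hx ((interval_subset_Icc hy').1.trans_lt hy)

theorem interval_mem_right {x : ℝ} (h : a ≤ x ∧ x < b) : interval l r a b ∈ 𝓝[>] x := by
  filter_upwards [Ioo_mem_nhdsGT h.2] with y hy
  exact mem_interval_of_Ioo (h.1.trans_lt hy.1) hy.2

theorem compl_interval_mem_right {x : ℝ} (h : ¬(a ≤ x ∧ x < b)) :
    (interval l r a b)ᶜ ∈ 𝓝[>] x := by
  by_cases hx : x < b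
  · have hb : x < a := not_le.1 fun hb => h ⟨hb, hx⟩
    filter_upwards [Ioo_mem_nhdsGT hb] with y hy hy'
    exact absurd (interval_subset_Icc hy').1 (not_le.2 hy.2)
  · filter_upwards [self_mem_nhdsWithin] with y (hy : x < y) hy'
    exact hx (hy.trans_le (interval_subset_Icc hy').2)

end interval

theorem not_mem_and_compl_mem {α : Type*} {f : Filter α} [f.NeBot] {U : Set α} (h : U ∈ f) :
    Uᶜ ∉ f := fun h' => by
  have := Filter.inter_mem h h'
  rw [Set.inter_compl_self] at this
  exact Filter.empty_notMem f this

theorem interval_mem_left_iff {l r : Bool} {a b x : ℝ} :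
    interval l r a b ∈ 𝓝[<] x ↔ a < x ∧ x ≤ b := by
  refine ⟨fun h => ?_, interval_mem_left⟩
  by_contra h'
  exact not_mem_and_compl_mem h (compl_interval_mem_left h')

theorem interval_mem_right_iff {l r : Bool} {a b x : ℝ} :
    interval l r a b ∈ 𝓝[>] x ↔ a ≤ x ∧ x < b := by
  refine ⟨fun h => ?_, interval_mem_right⟩
  by_contra h'
  exact not_mem_and_compl_mem h (compl_interval_mem_right h')

/-- The hypothesis excludes the one-point interval `[a, a]`, whose point is isolated. -/
theorem isTame_interval {l r : Bool} {a b : ℝ} (hab : l = r → a < b) :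
    IsTame (interval l r a b) where
  left x := (em _).imp interval_mem_left compl_interval_mem_left
  right x := (em _).imp interval_mem_right compl_interval_mem_right
  of_mem x hx := by
    rw [interval_mem_left_iff, interval_mem_right_iff]
    rw [mem_interval] at hx
    grind
  of_notMem x hx h h' := by
    rw [interval_mem_left_iff] at h
    rw [interval_mem_right_iff] at h'
    exact hx (mem_interval_of_Ioo h.1 h'.2)

section union

variable {ι : Type*} [Finite ι] {P : ι → Set ℝ}

theorem iUnion_mem_or_compl_mem {f : Filter ℝ} (h : ∀ i, P i ∈ f ∨ (P i)ᶜ ∈ f) :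
    (∃ i, P i ∈ f) ∨ (⋃ i, P i)ᶜ ∈ f := by
  by_cases h' : ∃ i, P i ∈ f
  · exact Or.inl h'
  · right
    rw [Set.compl_iUnion, Filter.iInter_mem]
    exact fun i => (h i).resolve_left fun hi => h' ⟨i, hi⟩

theorem iUnion_mem_iff {f : Filter ℝ} [f.NeBot] (h : ∀ i, P i ∈ f ∨ (P i)ᶜ ∈ f) :
    (⋃ i, P i) ∈ f ↔ ∃ i, P i ∈ f := by
  refine ⟨fun hU => ?_, fun ⟨i, hi⟩ => Filter.mem_of_superset hi (Set.subset_iUnion P i)⟩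
  exact (iUnion_mem_or_compl_mem h).resolve_right (not_mem_and_compl_mem hU)

/-- Only the last condition can be lost in a finite union, when two members abut at a point that
neither contains; this is what `hU` excludes. -/
theorem isTame_iUnion (h : ∀ i, IsTame (P i))
    (hU : ∀ x ∉ ⋃ i, P i, (⋃ i, P i) ∉ 𝓝[≠] x) : IsTame (⋃ i, P i) where
  left x := (iUnion_mem_or_compl_mem fun i => (h i).left x).imp_left fun ⟨i, hi⟩ =>
    Filter.mem_of_superset hi (Set.subset_iUnion P i)
  right x := (iUnion_mem_or_compl_mem fun i => (h i).right x).imp_left fun ⟨i, hi⟩ =>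
    Filter.mem_of_superset hi (Set.subset_iUnion P i)
  of_mem x hx := by
    obtain ⟨i, hi⟩ := Set.mem_iUnion.1 hx
    exact ((h i).of_mem x hi).imp (fun hi => Filter.mem_of_superset hi (Set.subset_iUnion P i))
      fun hi => Filter.mem_of_superset hi (Set.subset_iUnion P i)
  of_notMem x hx h1 h2 := hU x hx (mem_nhdsNE_iff.2 ⟨h1, h2⟩)

end union

theorem eq_of_mem_of_disjoint {ι : Type*} {P : ι → Set ℝ} {f : Filter ℝ} [f.NeBot]
    (hd : Pairwise fun i j => Disjoint (P i) (P j)) {i j : ι} (hi : P i ∈ f) (hj : P j ∈ f) :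
    i = j := by
  by_contra hij
  have := Filter.inter_mem hi hj
  rw [(hd hij).inter_eq] at this
  exact Filter.empty_notMem f this

/-! ### Toggling end points -/

/-- The set with its end points toggled. -/
def toggle (U : Set ℝ) : Set ℝ :=
  {x | (x ∈ U ∧ U ∈ 𝓝[<] x ∧ U ∈ 𝓝[>] x) ∨ (x ∉ U ∧ (U ∈ 𝓝[<] x ∨ U ∈ 𝓝[>] x))}

/-- Toggling respects the rule on lengths: half-open intervals stay half-open, and `hab` prevents
the empty `(a, a)` from being compared with `[a, a]`. -/
theorem toggle_interval {l r : Bool} {a b : ℝ} (hle : a ≤ b) (hab : l = r → a < b) :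
    toggle (interval l r a b) = interval (!l) (!r) a b := by
  ext x
  simp only [toggle, Set.mem_ofPred_eq, interval_mem_left_iff, interval_mem_right_iff,
    mem_interval]
  cases l <;> cases r <;> grind

section toggle

variable {U : Set ℝ}

theorem eventually_mem_nhds_left {x : ℝ} (h : U ∈ 𝓝[<] x) : ∀ᶠ y in 𝓝[<] x, U ∈ 𝓝 y := by
  filter_upwards [eventually_eventually_nhdsWithin.2 h, self_mem_nhdsWithin] with y hy hyx
  rwa [isOpen_Iio.nhdsWithin_eq hyx] at hy

theorem eventually_mem_nhds_right {x : ℝ} (h : U ∈ 𝓝[>] x) : ∀ᶠ y in 𝓝[>] x, U ∈ 𝓝 y := by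
  filter_upwards [eventually_eventually_nhdsWithin.2 h, self_mem_nhdsWithin] with y hy hyx
  rwa [isOpen_Ioi.nhdsWithin_eq hyx] at hy

theorem mem_toggle_of_mem_nhds {x : ℝ} (h : U ∈ 𝓝 x) : x ∈ toggle U :=
  Or.inl ⟨mem_of_mem_nhds h, nhdsWithin_le_nhds h, nhdsWithin_le_nhds h⟩

theorem notMem_toggle_of_mem_nhds {x : ℝ} (h : Uᶜ ∈ 𝓝 x) : x ∉ toggle U := by
  rintro (h' | ⟨-, h' | h'⟩)
  · exact mem_of_mem_nhds h h'.1
  · exact not_mem_and_compl_mem h' (nhdsWithin_le_nhds h)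
  · exact not_mem_and_compl_mem h' (nhdsWithin_le_nhds h)

/-- Points close to `x` on its left are interior to `U` or to its complement, and toggling changes
nothing at such points. -/
theorem IsTame.toggle_left_iff (hU : IsTame U) {x : ℝ} : toggle U ∈ 𝓝[<] x ↔ U ∈ 𝓝[<] x := by
  constructor
  · intro h
    refine (hU.left x).resolve_right fun h' => not_mem_and_compl_mem h ?_
    exact (eventually_mem_nhds_left h').mono fun y => notMem_toggle_of_mem_nhds
  · exact fun h => (eventually_mem_nhds_left h).mono fun y => mem_toggle_of_mem_nhds

theorem IsTame.toggle_right_iff (hU : IsTame U) {x : ℝ} : toggle U ∈ 𝓝[>] x ↔ U ∈ 𝓝[>] x := by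
  constructor
  · intro h
    refine (hU.right x).resolve_right fun h' => not_mem_and_compl_mem h ?_
    exact (eventually_mem_nhds_right h').mono fun y => notMem_toggle_of_mem_nhds
  · exact fun h => (eventually_mem_nhds_right h).mono fun y => mem_toggle_of_mem_nhds

theorem IsTame.toggle_of_notMem (hU : IsTame U) {x : ℝ} (hx : x ∉ toggle U)
    (h : toggle U ∈ 𝓝[<] x) : toggle U ∉ 𝓝[>] x := by
  intro h'
  rw [hU.toggle_left_iff] at h
  rw [hU.toggle_right_iff] at h'
  by_cases hxU : x ∈ U
  · exact hx (Or.inl ⟨hxU, h, h'⟩)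
  · exact hx (Or.inr ⟨hxU, Or.inl h⟩)

end toggle

section toggleUnion

variable {ι : Type*} {P : ι → Set ℝ}

theorem toggle_disjoint (hP : ∀ i, IsTame (P i))
    (hd : Pairwise fun i j => Disjoint (P i) (P j)) (hU : IsTame (⋃ i, P i)) :
    Pairwise fun i j => Disjoint (toggle (P i)) (toggle (P j)) := by
  intro i j hij
  refine Set.disjoint_left.2 fun x hi hj => ?_
  have hL : ∀ {i j}, P i ∈ 𝓝[<] x → P j ∈ 𝓝[<] x → i = j := eq_of_mem_of_disjoint hd
  have hR : ∀ {i j}, P i ∈ 𝓝[>] x → P j ∈ 𝓝[>] x → i = j := eq_of_mem_of_disjoint hd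
  have hM : ∀ {i j}, x ∈ P i → x ∈ P j → i = j := fun hi hj => by
    by_contra h
    exact Set.disjoint_left.1 (hd h) hi hj
  -- Where two members abut, tameness of the union forces `x` into some member. That member has a
  -- one-sided germ at `x`, and disjointness identifies it with `P i` or `P j`.
  have key : ∀ {i j}, i ≠ j → P i ∈ 𝓝[<] x → P j ∈ 𝓝[>] x → x ∈ P i ∨ x ∈ P j := by
    intro i j hij h1 h2
    have hx : x ∈ ⋃ i, P i := by
      by_contra hx
      exact hU.of_notMem x hx (Filter.mem_of_superset h1 (Set.subset_iUnion P i))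
        (Filter.mem_of_superset h2 (Set.subset_iUnion P j))
    obtain ⟨m, hm⟩ := Set.mem_iUnion.1 hx
    rcases (hP m).of_mem x hm with h | h
    · exact Or.inl (hL h h1 ▸ hm)
    · exact Or.inr (hR h h2 ▸ hm)
  rcases hi with ⟨h1, h2, h3⟩ | ⟨h1, h2⟩ <;> rcases hj with ⟨h1', h2', h3'⟩ | ⟨h1', h2'⟩
  · exact hij (hM h1 h1')
  · exact hij (h2'.elim (hL h2) (hR h3))
  · exact hij (h2.elim (fun h => hL h h2') fun h => hR h h3')
  · rcases h2 with h2 | h2 <;> rcases h2' with h2' | h2'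
    · exact hij (hL h2 h2')
    · exact (key hij h2 h2').elim h1 h1'
    · exact (key (Ne.symm hij) h2' h2).elim h1' h1
    · exact hij (hR h2 h2')

theorem toggle_iUnion [Finite ι] (hP : ∀ i, IsTame (P i))
    (hd : Pairwise fun i j => Disjoint (P i) (P j)) :
    toggle (⋃ i, P i) = ⋃ i, toggle (P i) := by
  ext x
  have hL := iUnion_mem_iff fun i => (hP i).left x
  have hR := iUnion_mem_iff fun i => (hP i).right x
  have hL' : ∀ {i j}, P i ∈ 𝓝[<] x → P j ∈ 𝓝[<] x → i = j := eq_of_mem_of_disjoint hd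
  have hR' : ∀ {i j}, P i ∈ 𝓝[>] x → P j ∈ 𝓝[>] x → i = j := eq_of_mem_of_disjoint hd
  rw [Set.mem_iUnion]
  constructor
  · rintro (⟨h1, h2, h3⟩ | ⟨h1, h2⟩)
    · obtain ⟨i, hi⟩ := Set.mem_iUnion.1 h1
      obtain ⟨j, hj⟩ := hL.1 h2
      obtain ⟨k, hk⟩ := hR.1 h3
      by_cases hjk : j = k
      · subst hjk
        by_cases hj' : x ∈ P j
        · exact ⟨j, Or.inl ⟨hj', hj, hk⟩⟩
        · exact ⟨j, Or.inr ⟨hj', Or.inl hj⟩⟩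
      -- Two different members abut at `x` and exactly one of them contains `x`. Toggling hands the
      -- point over to the other one, so the union keeps it.
      · rcases (hP i).of_mem x hi with h | h
        · obtain rfl := hL' h hj
          refine ⟨k, Or.inr ⟨fun h' => ?_, Or.inr hk⟩⟩
          exact Set.disjoint_left.1 (hd hjk) hi h'
        · obtain rfl := hR' h hk
          refine ⟨j, Or.inr ⟨fun h' => ?_, Or.inl hj⟩⟩
          exact Set.disjoint_left.1 (hd hjk) h' hi
    · rcases h2 with h2 | h2
      · obtain ⟨j, hj⟩ := hL.1 h2
        exact ⟨j, Or.inr ⟨fun h => h1 (Set.mem_iUnion.2 ⟨j, h⟩), Or.inl hj⟩⟩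
      · obtain ⟨j, hj⟩ := hR.1 h2
        exact ⟨j, Or.inr ⟨fun h => h1 (Set.mem_iUnion.2 ⟨j, h⟩), Or.inr hj⟩⟩
  · rintro ⟨i, ⟨h1, h2, h3⟩ | ⟨h1, h2⟩⟩
    · exact Or.inl ⟨Set.mem_iUnion.2 ⟨i, h1⟩, hL.2 ⟨i, h2⟩, hR.2 ⟨i, h3⟩⟩
    · by_cases hx : x ∈ ⋃ i, P i
      · obtain ⟨j, hj⟩ := Set.mem_iUnion.1 hx
        have hij : i ≠ j := fun h => h1 (h ▸ hj)
        refine Or.inl ⟨hx, ?_⟩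
        rcases h2 with h2 | h2
        · refine ⟨hL.2 ⟨i, h2⟩, hR.2 ⟨j, ((hP j).of_mem x hj).resolve_left fun h => ?_⟩⟩
          exact hij (hL' h2 h)
        · refine ⟨hL.2 ⟨j, ((hP j).of_mem x hj).resolve_right fun h => ?_⟩, hR.2 ⟨i, h2⟩⟩
          exact hij (hR' h2 h)
      · exact Or.inr ⟨hx, h2.imp (fun h => hL.2 ⟨i, h⟩) fun h => hR.2 ⟨i, h⟩⟩

end toggleUnion

/-! ### Mirror images and folding -/

/-- The mirror image with toggled end points. -/
def mirror (U : Set ℝ) : Set ℝ := {x | -x ∈ toggle U}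

/-- The part of a set on the negative half-line together with its mirror image with toggled end
points; the origin belongs to it if the set touches the origin from the left. -/
def fold (U : Set ℝ) : Set ℝ :=
  {x | (x < 0 ∧ x ∈ U) ∨ (x = 0 ∧ U ∈ 𝓝[<] (0 : ℝ)) ∨ (0 < x ∧ -x ∈ toggle U)}

theorem mirror_interval {l r : Bool} {a b : ℝ} (hle : a ≤ b) (hab : l = r → a < b) :
    mirror (interval l r a b) = interval (!r) (!l) (-b) (-a) := by
  ext x
  rw [mirror, Set.mem_ofPred_eq, toggle_interval hle hab, mem_interval, mem_interval]
  cases l <;> cases r <;> grind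

theorem preimage_neg_mem_left {S : Set ℝ} {x : ℝ} :
    {y | -y ∈ S} ∈ 𝓝[<] x ↔ S ∈ 𝓝[>] (-x) := by
  have : 𝓝[>] (-x) = Filter.map Neg.neg (𝓝[<] x) := by simp
  rw [this]
  rfl

theorem preimage_neg_mem_right {S : Set ℝ} {x : ℝ} :
    {y | -y ∈ S} ∈ 𝓝[>] x ↔ S ∈ 𝓝[<] (-x) := by
  have : 𝓝[<] (-x) = Filter.map Neg.neg (𝓝[>] x) := by simp
  rw [this]
  rfl

theorem IsTame.mirror_notMem_nhdsNE {U : Set ℝ} (hU : IsTame U) {x : ℝ} (hx : x ∉ mirror U) :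
    mirror U ∉ 𝓝[≠] x := by
  rw [mem_nhdsNE_iff]
  rintro ⟨h1, h2⟩
  exact hU.toggle_of_notMem hx (preimage_neg_mem_right.1 h2) (preimage_neg_mem_left.1 h1)

/-- The condition is local: on the negative half-line `fold U` is `U`, on the positive one it is the
mirror image. At the origin, a set that fills the left side contains the origin by the definition of
`fold`. -/
theorem IsTame.fold_notMem_nhdsNE {U : Set ℝ} (hU : IsTame U) {x : ℝ} (hx : x ∉ fold U) :
    fold U ∉ 𝓝[≠] x := by
  rcases lt_trichotomy x 0 with h0 | rfl | h0
  · intro h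
    rw [mem_nhdsNE_iff] at h
    have h3 : ∀ᶠ y in 𝓝 x, y < 0 := Iio_mem_nhds h0
    have key : ∀ y < 0, y ∈ fold U → y ∈ U := by
      rintro y hy (h | h | h)
      · exact h.2
      · exact absurd h.1 hy.ne
      · exact absurd h.1 hy.not_gt
    refine hU.of_notMem x (fun h' => hx (Or.inl ⟨h0, h'⟩)) ?_ ?_
    · filter_upwards [h.1, nhdsWithin_le_nhds h3] with y h1 h2 using key y h2 h1
    · filter_upwards [h.2, nhdsWithin_le_nhds h3] with y h1 h2 using key y h2 h1
  · intro h
    refine hx (Or.inr (Or.inl ⟨rfl, ?_⟩))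
    filter_upwards [(mem_nhdsNE_iff.1 h).1, self_mem_nhdsWithin] with y h (hy : y < 0)
    rcases h with h | h | h
    · exact h.2
    · exact absurd h.1 hy.ne
    · exact absurd h.1 hy.not_gt
  · intro h
    refine hU.mirror_notMem_nhdsNE (fun h' => hx (Or.inr (Or.inr ⟨h0, h'⟩))) ?_
    filter_upwards [h, nhdsWithin_le_nhds (Ioi_mem_nhds h0)] with y h (hy : 0 < y)
    rcases h with h | h | h
    · exact absurd h.1 hy.not_gt
    · exact absurd h.1 hy.ne'
    · exact h.2

/-- Folding a set on the negative half-line adds its mirror image. -/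
theorem fold_eq_union {U : Set ℝ} (h : U ⊆ Set.Iio 0) : fold U = U ∪ mirror U := by
  have hR : ∀ y : ℝ, 0 ≤ y → U ∉ 𝓝[>] y := by
    intro y hy h'
    refine not_mem_and_compl_mem h' ?_
    filter_upwards [self_mem_nhdsWithin] with z (hz : y < z) hz'
    exact absurd (h hz') (not_lt.2 (hy.trans hz.le))
  have hL : ∀ y : ℝ, 0 < y → U ∉ 𝓝[<] y := by
    intro y hy h'
    refine not_mem_and_compl_mem h' ?_
    filter_upwards [Ioo_mem_nhdsLT hy] with z hz hz'
    exact absurd (h hz') (not_lt.2 hz.1.le)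
  ext x
  rcases lt_trichotomy x 0 with h0 | rfl | h0
  · have h1 : x ∉ mirror U := by
      have h0' : 0 < -x := neg_pos.2 h0
      rintro (h' | ⟨-, h' | h'⟩)
      · exact absurd (h h'.1) (not_lt.2 h0'.le)
      · exact hL _ h0' h'
      · exact hR _ h0'.le h'
    simp [fold, h0, h0.ne, h0.not_gt, h1]
  · have h1 : (0 : ℝ) ∉ U := fun h' => lt_irrefl (0 : ℝ) (h h')
    have h2 := hR 0 le_rfl
    simp [fold, mirror, toggle, h1, h2]
  · have h1 : x ∉ U := fun h' => absurd (h h') (not_lt.2 h0.le)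
    simp [fold, mirror, h0, h0.ne', h0.not_gt, h1]

theorem mirror_disjoint_self {U : Set ℝ} (h : U ⊆ Set.Iio 0) : Disjoint U (mirror U) := by
  refine Set.disjoint_left.2 fun x hx hx' => ?_
  have h0 : x < 0 := h hx
  have h0' : 0 < -x := neg_pos.2 h0
  rcases hx' with h' | ⟨-, h' | h'⟩
  · exact absurd (h h'.1) (not_lt.2 h0'.le)
  · refine not_mem_and_compl_mem h' ?_
    filter_upwards [Ioo_mem_nhdsLT h0'] with z hz hz'
    exact absurd (h hz') (not_lt.2 hz.1.le)
  · refine not_mem_and_compl_mem h' ?_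
    filter_upwards [self_mem_nhdsWithin] with z (hz : -x < z) hz'
    exact absurd (h hz') (not_lt.2 (h0'.trans hz).le)

theorem fold_eq_empty {U : Set ℝ} (h : U ⊆ Set.Ioi 0) : fold U = ∅ := by
  have hlt : ∀ x : ℝ, x ≤ 0 → U ∉ 𝓝[<] x := by
    intro x hx h'
    refine not_mem_and_compl_mem h' ?_
    filter_upwards [self_mem_nhdsWithin] with z (hz : z < x) hz'
    exact absurd (h hz') (not_lt.2 (hz.le.trans hx))
  refine Set.eq_empty_of_forall_notMem fun x hx => ?_
  rcases hx with hx | hx | ⟨h0, hx⟩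
  · exact absurd (h hx.2) (not_lt.2 hx.1.le)
  · exact hlt 0 le_rfl hx.2
  · refine notMem_toggle_of_mem_nhds ?_ hx
    filter_upwards [Iio_mem_nhds (neg_neg_of_pos h0)] with z (hz : z < 0) hz'
    exact absurd (h hz') (not_lt.2 hz.le)

section unions

variable {ι : Type*} {P : ι → Set ℝ}

theorem mirror_disjoint (hP : ∀ i, IsTame (P i))
    (hd : Pairwise fun i j => Disjoint (P i) (P j)) (hU : IsTame (⋃ i, P i)) :
    Pairwise fun i j => Disjoint (mirror (P i)) (mirror (P j)) := fun _ _ hij =>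
  (toggle_disjoint hP hd hU hij).preimage Neg.neg

theorem mirror_iUnion [Finite ι] (hP : ∀ i, IsTame (P i))
    (hd : Pairwise fun i j => Disjoint (P i) (P j)) :
    mirror (⋃ i, P i) = ⋃ i, mirror (P i) := by
  have : mirror (⋃ i, P i) = Neg.neg ⁻¹' toggle (⋃ i, P i) := rfl
  rw [this, toggle_iUnion hP hd, Set.preimage_iUnion]
  rfl

theorem fold_disjoint (hP : ∀ i, IsTame (P i))
    (hd : Pairwise fun i j => Disjoint (P i) (P j)) (hU : IsTame (⋃ i, P i)) :
    Pairwise fun i j => Disjoint (fold (P i)) (fold (P j)) := by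
  intro i j hij
  refine Set.disjoint_left.2 fun x hi hj => ?_
  rcases lt_trichotomy x 0 with h0 | rfl | h0
  · simp only [fold, Set.mem_ofPred_eq, h0, h0.ne, h0.not_gt, true_and, false_and, or_false] at hi hj
    exact Set.disjoint_left.1 (hd hij) hi hj
  · simp only [fold, Set.mem_ofPred_eq, lt_irrefl, true_and, false_and, or_false, false_or] at hi hj
    exact hij (eq_of_mem_of_disjoint hd hi hj)
  · simp only [fold, Set.mem_ofPred_eq, h0, h0.ne', h0.not_gt, true_and, false_and, false_or] at hi hj
    exact Set.disjoint_left.1 (toggle_disjoint hP hd hU hij) hi hj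

theorem fold_iUnion [Finite ι] (hP : ∀ i, IsTame (P i))
    (hd : Pairwise fun i j => Disjoint (P i) (P j)) :
    fold (⋃ i, P i) = ⋃ i, fold (P i) := by
  ext x
  rw [Set.mem_iUnion]
  rcases lt_trichotomy x 0 with h0 | rfl | h0
  · simp [fold, h0, h0.ne, h0.not_gt]
  · simpa [fold] using iUnion_mem_iff fun i => (hP i).left 0
  · simp [fold, h0, h0.ne', h0.not_gt, toggle_iUnion hP hd]

end unions

/-- The interval is cut off at the origin and its mirror image is added. The flag `r'` belongs to
the right end of the part that is left. If `b > 0` and `a < 0`, the two parts meet at `0` with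
complementary flags, so either value of `r'` gives the same union. The value `!l` makes both parts
half-open, as is required once `a ≥ 0` and they have length `0`. The value `r` keeps the true right
end if `b ≤ 0`. -/
theorem fold_interval {l r r' : Bool} {a b : ℝ} (hle : a ≤ b) (hab : l = r → a < b)
    (h : (r' = !l ∧ 0 < b) ∨ (r' = r ∧ (l = r → a < 0))) :
    fold (interval l r a b) = interval l r' (min a 0) (min b 0) ∪
      interval (!r') (!l) (-min b 0) (-min a 0) := by
  ext x
  simp only [fold, Set.mem_ofPred_eq, toggle_interval hle hab, interval_mem_left_iff,
    mem_interval, Set.mem_union]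
  have h1 : min a 0 = a ∧ a ≤ 0 ∨ min a 0 = 0 ∧ 0 ≤ a := by
    rcases le_total a 0 with h | h <;> simp [h]
  have h2 : min b 0 = b ∧ b ≤ 0 ∨ min b 0 = 0 ∧ 0 ≤ b := by
    rcases le_total b 0 with h | h <;> simp [h]
  generalize min a 0 = a' at *
  generalize min b 0 = b' at *
  cases l <;> cases r <;> cases r' <;> simp at h hab ⊢ <;> grind

theorem fold_interval_disjoint {l r' : Bool} {a b : ℝ} :
    Disjoint (interval l r' (min a 0) (min b 0))
      (interval (!r') (!l) (-min b 0) (-min a 0)) := by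
  refine Set.disjoint_left.2 fun x hx hx' => ?_
  have h2 : min b 0 ≤ 0 := min_le_right _ _
  rw [mem_interval] at hx hx'
  cases r' <;> simp at hx hx' <;> grind

/-! ### Families of intervals over arbitrary index types -/

/-- The intervals with end points `a i`, `b i` are as required in the definition of the space of
families of intervals. -/
structure IsFamily {ι : Type*} (l r : ι → Bool) (a b : ι → ℝ) : Prop where
  le : ∀ i, a i ≤ b i
  lt : ∀ i, l i = r i → a i < b i
  disjoint : Pairwise fun i j =>
    Disjoint (interval (l i) (r i) (a i) (b i)) (interval (l j) (r j) (a j) (b j))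
  notMem : ∀ x ∉ ⋃ i, interval (l i) (r i) (a i) (b i),
    (⋃ i, interval (l i) (r i) (a i) (b i)) ∉ 𝓝[≠] x

theorem mem_intervalFamilies {k : ℕ} {l r : Fin k → Bool} {p : (Fin k → ℝ) × (Fin k → ℝ)} :
    p ∈ intervalFamilies l r ↔ IsFamily l r p.1 p.2 :=
  ⟨fun ⟨h1, h2, h3, h4⟩ => ⟨h1, h2, h3, h4⟩, fun ⟨h1, h2, h3, h4⟩ => ⟨h1, h2, h3, h4⟩⟩

namespace IsFamily

variable {ι κ : Type*} {l r : ι → Bool} {a b : ι → ℝ}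

theorem reindex (h : IsFamily l r a b) (e : κ ≃ ι) : IsFamily (l ∘ e) (r ∘ e) (a ∘ e) (b ∘ e) := by
  have hU : (⋃ k, interval ((l ∘ e) k) ((r ∘ e) k) ((a ∘ e) k) ((b ∘ e) k)) =
      ⋃ i, interval (l i) (r i) (a i) (b i) :=
    e.surjective.iUnion_comp fun i => interval (l i) (r i) (a i) (b i)
  exact ⟨fun k => h.le _, fun k => h.lt _, fun i j hij => h.disjoint (e.injective.ne hij),
    by rw [hU]; exact h.notMem⟩

theorem isTame_interval (h : IsFamily l r a b) (i : ι) :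
    IsTame (interval (l i) (r i) (a i) (b i)) :=
  _root_.isTame_interval (h.lt i)

theorem isTame [Finite ι] (h : IsFamily l r a b) :
    IsTame (⋃ i, interval (l i) (r i) (a i) (b i)) :=
  isTame_iUnion h.isTame_interval h.notMem

theorem mirror [Finite ι] (h : IsFamily l r a b) :
    IsFamily (fun i => !r i) (fun i => !l i) (fun i => -b i) (fun i => -a i) ∧
      _root_.mirror (⋃ i, interval (l i) (r i) (a i) (b i)) =
        ⋃ i, interval (!r i) (!l i) (-b i) (-a i) := by
  have hi : ∀ i, _root_.mirror (interval (l i) (r i) (a i) (b i)) =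
      interval (!r i) (!l i) (-b i) (-a i) := fun i => mirror_interval (h.le i) (h.lt i)
  have hU := mirror_iUnion h.isTame_interval h.disjoint
  simp only [hi] at hU
  refine ⟨⟨fun i => neg_le_neg (h.le i), fun i hlr => neg_lt_neg (h.lt i ?_), ?_, ?_⟩, hU⟩
  · simpa using hlr.symm
  · have := mirror_disjoint h.isTame_interval h.disjoint h.isTame
    simpa only [hi] using this
  · rw [← hU]
    exact fun x => h.isTame.mirror_notMem_nhdsNE

theorem fold [Finite ι] (h : IsFamily l r a b) (r' : ι → Bool)
    (h' : ∀ i, (r' i = !l i ∧ 0 < b i) ∨ (r' i = r i ∧ (l i = r i → a i < 0))) :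
    IsFamily (Sum.elim l fun i => !r' i) (Sum.elim r' fun i => !l i)
      (Sum.elim (fun i => min (a i) 0) fun i => -min (b i) 0)
      (Sum.elim (fun i => min (b i) 0) fun i => -min (a i) 0) ∧
    _root_.fold (⋃ i, interval (l i) (r i) (a i) (b i)) =
      ⋃ i, interval (Sum.elim l (fun i => !r' i) i) (Sum.elim r' (fun i => !l i) i)
        (Sum.elim (fun i => min (a i) 0) (fun i => -min (b i) 0) i)
        (Sum.elim (fun i => min (b i) 0) (fun i => -min (a i) 0) i) := by
  have hi := fun i => fold_interval (h.le i) (h.lt i) (h' i)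
  have hd := fold_disjoint h.isTame_interval h.disjoint h.isTame
  have hU : _root_.fold (⋃ i, interval (l i) (r i) (a i) (b i)) =
      ⋃ i, interval (Sum.elim l (fun i => !r' i) i) (Sum.elim r' (fun i => !l i) i)
        (Sum.elim (fun i => min (a i) 0) (fun i => -min (b i) 0) i)
        (Sum.elim (fun i => min (b i) 0) (fun i => -min (a i) 0) i) := by
    rw [fold_iUnion h.isTame_interval h.disjoint, Set.iUnion_sum, ← Set.iUnion_union_distrib]
    exact Set.iUnion_congr hi
  -- Equal flags rule out the choice `r' = !l`. In the remaining case `a i < 0`, so the part to the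
  -- left of the origin keeps positive length.
  have hlt : ∀ i, l i = r' i → min (a i) 0 < min (b i) 0 := by
    intro i hlr
    rcases h' i with ⟨h1, -⟩ | ⟨h1, h2⟩
    · rw [h1] at hlr
      simp at hlr
    · rw [h1] at hlr
      have h3 := h2 hlr
      rw [min_eq_left h3.le]
      exact lt_min (h.lt i hlr) h3
  have hsub₁ : ∀ i, interval (l i) (r' i) (min (a i) 0) (min (b i) 0) ⊆
      _root_.fold (interval (l i) (r i) (a i) (b i)) := fun i => by
    rw [hi]
    exact Set.subset_union_left
  have hsub₂ : ∀ i, interval (!r' i) (!l i) (-min (b i) 0) (-min (a i) 0) ⊆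
      _root_.fold (interval (l i) (r i) (a i) (b i)) := fun i => by
    rw [hi]
    exact Set.subset_union_right
  refine ⟨⟨?_, ?_, ?_, ?_⟩, hU⟩
  · rintro (i | i)
    · exact min_le_min_right 0 (h.le i)
    · exact neg_le_neg (min_le_min_right 0 (h.le i))
  · rintro (i | i) hlr
    · exact hlt i hlr
    · exact neg_lt_neg (hlt i (by simpa using hlr.symm))
  · rintro (i | i) (j | j) hij
    · exact (hd fun e => hij (congrArg Sum.inl e)).mono (hsub₁ i) (hsub₁ j)
    · by_cases e : i = j
      · subst e
        exact fold_interval_disjoint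
      · exact (hd e).mono (hsub₁ i) (hsub₂ j)
    · by_cases e : i = j
      · subst e
        exact fold_interval_disjoint.symm
      · exact (hd e).mono (hsub₂ i) (hsub₁ j)
    · exact (hd fun e => hij (congrArg Sum.inr e)).mono (hsub₂ i) (hsub₂ j)
  · rw [← hU]
    exact fun x => h.isTame.fold_notMem_nhdsNE

end IsFamily

theorem image_interval {f : ℝ → ℝ} (hc : Continuous f) (hf : StrictMono f) {l r : Bool} {a b : ℝ}
    (hle : a ≤ b) : interval l r (f a) (f b) = f '' interval l r a b := by
  have key : ∀ x, f x ∈ interval l r (f a) (f b) ↔ x ∈ interval l r a b := by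
    intro x
    simp only [mem_interval, hf.le_iff_le, hf.lt_iff_lt]
  ext y
  constructor
  · intro hy
    obtain ⟨x, -, rfl⟩ := intermediate_value_Icc hle hc.continuousOn (interval_subset_Icc hy)
    exact ⟨x, (key x).1 hy, rfl⟩
  · rintro ⟨x, hx, rfl⟩
    exact (key x).2 hx

/-- The map `f` need not be onto. But a point with values of `f` on both sides is itself a value by
the intermediate value theorem, so the condition can be pulled back along `f`. -/
theorem image_notMem_nhdsNE {f : ℝ → ℝ} (hc : Continuous f) (hf : StrictMono f) {U : Set ℝ}
    (hU : ∀ x ∉ U, U ∉ 𝓝[≠] x) {y : ℝ} (hy : y ∉ f '' U) : f '' U ∉ 𝓝[≠] y := by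
  intro h
  obtain ⟨h1, h2⟩ := mem_nhdsNE_iff.1 h
  obtain ⟨z₁, ⟨x₁, -, rfl⟩, hz₁⟩ := Filter.nonempty_of_mem (Filter.inter_mem h1 self_mem_nhdsWithin)
  obtain ⟨z₂, ⟨x₂, -, rfl⟩, hz₂⟩ := Filter.nonempty_of_mem (Filter.inter_mem h2 self_mem_nhdsWithin)
  have hlt : f x₁ < f x₂ := lt_trans hz₁ hz₂
  obtain ⟨x, -, rfl⟩ := intermediate_value_Icc (hf.lt_iff_lt.1 hlt).le hc.continuousOn
    ⟨le_of_lt hz₁, le_of_lt hz₂⟩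
  refine hU x (fun hx => hy ⟨x, hx, rfl⟩) ?_
  have ht : Filter.Tendsto f (𝓝[≠] x) (𝓝[≠] (f x)) :=
    tendsto_nhdsWithin_iff.2 ⟨hc.continuousAt.mono_left nhdsWithin_le_nhds,
      Filter.eventually_of_mem self_mem_nhdsWithin fun z hz => hf.injective.ne hz⟩
  have := ht h
  rwa [Filter.mem_map, Set.preimage_image_eq _ hf.injective] at this

theorem IsFamily.image {ι : Type*} {l r : ι → Bool} {a b : ι → ℝ} (h : IsFamily l r a b)
    {f : ℝ → ℝ} (hc : Continuous f) (hf : StrictMono f) :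
    IsFamily l r (fun i => f (a i)) (fun i => f (b i)) ∧
      f '' (⋃ i, interval (l i) (r i) (a i) (b i)) =
        ⋃ i, interval (l i) (r i) (f (a i)) (f (b i)) := by
  have hi := fun i => image_interval (l := l i) (r := r i) hc hf (h.le i)
  have hU : f '' (⋃ i, interval (l i) (r i) (a i) (b i)) =
      ⋃ i, interval (l i) (r i) (f (a i)) (f (b i)) := by
    simp only [hi]
    exact Set.image_iUnion
  refine ⟨⟨fun i => hf.monotone (h.le i), fun i hlr => hf (h.lt i hlr), fun i j hij => ?_, ?_⟩, hU⟩
  · simp only [hi, Set.disjoint_image_iff hf.injective]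
    exact h.disjoint hij
  · rw [← hU]
    exact fun y => image_notMem_nhdsNE hc hf h.notMem

/-! ### Operations on the space of intervals -/

/-- Operations on unions of intervals under which locally the end points move continuously. -/
def IsFamilywise {T : Type*} [TopologicalSpace T] (op : T → Set ℝ → Set ℝ) : Prop :=
  ∀ (t₀ : T) {k : ℕ} (l r : Fin k → Bool), ∀ p₀ ∈ intervalFamilies l r,
    ∃ (m : ℕ) (l' r' : Fin m → Bool)
      (φ : T × ((Fin k → ℝ) × (Fin k → ℝ)) → (Fin m → ℝ) × (Fin m → ℝ)), Continuous φ ∧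
      ∀ᶠ q in 𝓝 (t₀, p₀), q.2 ∈ intervalFamilies l r → φ q ∈ intervalFamilies l' r' ∧
        op q.1 (intervalUnion l r q.2) = intervalUnion l' r' (φ q)

theorem isFamilywise_mirror : IsFamilywise fun (_ : Unit) => mirror := by
  intro t₀ k l r p₀ hp₀
  refine ⟨k, fun i => !r i, fun i => !l i, fun q => (fun i => -q.2.2 i, fun i => -q.2.1 i),
    by fun_prop, Filter.Eventually.of_forall fun q hq => ?_⟩
  have := (mem_intervalFamilies.1 hq).mirror
  exact ⟨mem_intervalFamilies.2 this.1, this.2⟩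

theorem isFamilywise_image {T : Type*} [TopologicalSpace T] {f : T → ℝ → ℝ}
    (hc : Continuous fun p : T × ℝ => f p.1 p.2) (hf : ∀ t, StrictMono (f t)) :
    IsFamilywise fun t U => f t '' U := by
  intro t₀ k l r p₀ hp₀
  refine ⟨k, l, r, fun q => (fun i => f q.1 (q.2.1 i), fun i => f q.1 (q.2.2 i)), ?_,
    Filter.Eventually.of_forall fun q hq => ?_⟩
  · exact (continuous_pi fun i => hc.comp (g := fun p : T × ℝ => f p.1 p.2)
      (f := fun q : T × ((Fin k → ℝ) × (Fin k → ℝ)) => (q.1, q.2.1 i)) (by fun_prop)).prodMk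
      (continuous_pi fun i => hc.comp (g := fun p : T × ℝ => f p.1 p.2)
        (f := fun q : T × ((Fin k → ℝ) × (Fin k → ℝ)) => (q.1, q.2.2 i)) (by fun_prop))
  · have := (mem_intervalFamilies.1 hq).image (f := f q.1)
      (hc.comp (continuous_const.prodMk continuous_id)) (hf q.1)
    exact ⟨mem_intervalFamilies.2 this.1, this.2⟩

theorem isFamilywise_fold : IsFamilywise fun (_ : Unit) => fold := by
  intro t₀ k l r p₀ hp₀
  classical
  -- The flags are fixed at the base point `p₀` and must remain admissible for `fold_interval`
  -- nearby. A positive right end stays positive. If the right end is at most `0`, it may cross the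
  -- origin under perturbation; then the interval is half-open or its left end stays negative, and
  -- the flag `r i` still works.
  let r' : Fin k → Bool := fun i => if 0 < p₀.2 i then !l i else r i
  let e := (finSumFinEquiv (m := k) (n := k)).symm
  refine ⟨k + k, Sum.elim l (fun i => !r' i) ∘ e, Sum.elim r' (fun i => !l i) ∘ e,
    fun q => (Sum.elim (fun i => min (q.2.1 i) 0) (fun i => -min (q.2.2 i) 0) ∘ e,
      Sum.elim (fun i => min (q.2.2 i) 0) (fun i => -min (q.2.1 i) 0) ∘ e), ?_, ?_⟩
  · refine (continuous_pi fun i => ?_).prodMk (continuous_pi fun i => ?_)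
    · simp only [Function.comp_apply]
      rcases e i with j | j <;> simp only [Sum.elim_inl, Sum.elim_inr] <;> fun_prop
    · simp only [Function.comp_apply]
      rcases e i with j | j <;> simp only [Sum.elim_inl, Sum.elim_inr] <;> fun_prop
  · have hev : ∀ᶠ q : Unit × ((Fin k → ℝ) × (Fin k → ℝ)) in 𝓝 (t₀, p₀), ∀ i,
        (0 < p₀.2 i → 0 < q.2.2 i) ∧ (p₀.1 i < 0 → q.2.1 i < 0) := by
      refine Filter.eventually_all.2 fun i => Filter.Eventually.and ?_ ?_
      · by_cases h : 0 < p₀.2 i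
        · have hc : ContinuousAt (fun q : Unit × ((Fin k → ℝ) × (Fin k → ℝ)) => q.2.2 i)
            (t₀, p₀) := by fun_prop
          exact (hc.eventually (lt_mem_nhds h)).mono fun q hq _ => hq
        · exact Filter.Eventually.of_forall fun q hq => absurd hq h
      · by_cases h : p₀.1 i < 0
        · have hc : ContinuousAt (fun q : Unit × ((Fin k → ℝ) × (Fin k → ℝ)) => q.2.1 i)
            (t₀, p₀) := by fun_prop
          exact (hc.eventually (gt_mem_nhds h)).mono fun q hq _ => hq
        · exact Filter.Eventually.of_forall fun q hq => absurd hq h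
    filter_upwards [hev] with q hq hqf
    have := (mem_intervalFamilies.1 hqf).fold r' fun i => by
      by_cases h : 0 < p₀.2 i
      · exact Or.inl ⟨if_pos h, (hq i).1 h⟩
      · exact Or.inr ⟨if_neg h, fun hlr =>
          (hq i).2 (((mem_intervalFamilies.1 hp₀).lt i hlr).trans_le (not_lt.1 h))⟩
    refine ⟨mem_intervalFamilies.2 (this.1.reindex e), this.2.trans ?_⟩
    exact (e.surjective.iUnion_comp _).symm

namespace IntervalSpace

theorem isTame (Q : IntervalSpace) : IsTame Q.carrier := by
  obtain ⟨k, l, r, p, hp, h⟩ := Q.eq_union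
  rw [h]
  exact (mem_intervalFamilies.1 hp).isTame

section familywise

variable {T : Type} [TopologicalSpace T] {op : T → Set ℝ → Set ℝ}

theorem exists_carrier_eq (h : IsFamilywise op) (t : T) (Q : IntervalSpace) :
    ∃ Q' : IntervalSpace, Q'.carrier = op t Q.carrier := by
  obtain ⟨k, l, r, p, hp, hQ⟩ := Q.eq_union
  obtain ⟨m, l', r', φ, -, hφ⟩ := h t l r p hp
  obtain ⟨h1, h2⟩ := hφ.self_of_nhds hp
  exact ⟨ofFamily l' r' ⟨φ (t, p), h1⟩, by rw [hQ]; exact h2.symm⟩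

/-- The map of the space of intervals induced by an operation. -/
def applyOp (h : IsFamilywise op) (t : T) (Q : IntervalSpace) : IntervalSpace :=
  (exists_carrier_eq h t Q).choose

theorem carrier_applyOp (h : IsFamilywise op) (t : T) (Q : IntervalSpace) :
    (applyOp h t Q).carrier = op t Q.carrier :=
  (exists_carrier_eq h t Q).choose_spec

/-- The index of a space of families of intervals. -/
abbrev FamilyType : Type := Σ k : ℕ, (Fin k → Bool) × (Fin k → Bool)

theorem isQuotientMap_ofFamily :
    IsQuotientMap fun q : (Σ i : FamilyType, intervalFamilies i.2.1 i.2.2) =>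
      ofFamily q.1.2.1 q.1.2.2 q.2 := by
  refine isQuotientMap_sigma (X := fun i : FamilyType => intervalFamilies i.2.1 i.2.2)
    (fun i q => ofFamily i.2.1 i.2.2 q) (fun Q => ?_) ?_
  · obtain ⟨k, l, r, p, hp, h⟩ := Q.eq_union
    exact ⟨⟨k, l, r⟩, ⟨p, hp⟩, ext_iff.2 h.symm⟩
  · simp only [instTopologicalSpace, iSup_sigma, iSup_prod]

theorem continuous_ofFamily {k : ℕ} (l r : Fin k → Bool) : Continuous (ofFamily l r) :=
  isQuotientMap_ofFamily.continuous.comp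
    (continuous_sigmaMk (σ := fun i : FamilyType => intervalFamilies i.2.1 i.2.2)
      (i := ⟨k, l, r⟩))

/-- As `T` is locally compact, it suffices to treat end points in place of unions. Near a given
family the operation lifts to the continuous map `φ` between spaces of families, with flags valid on
a whole neighbourhood. -/
theorem continuous_applyOp [LocallyCompactSpace T] (h : IsFamilywise op) :
    Continuous fun p : T × IntervalSpace => applyOp h p.1 p.2 := by
  refine isQuotientMap_ofFamily.continuous_lift_prod_right ?_
  let e : (T × Σ i : FamilyType, intervalFamilies i.2.1 i.2.2) →
      Σ i : FamilyType, intervalFamilies i.2.1 i.2.2 × T := fun p => ⟨p.2.1, p.2.2, p.1⟩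
  have he : Continuous e := by
    have : e = fun p => Homeomorph.sigmaProdDistrib (p.2, p.1) := rfl
    rw [this]
    fun_prop
  have hF : Continuous fun q : (Σ i : FamilyType, intervalFamilies i.2.1 i.2.2 × T) =>
      applyOp h q.2.2 (ofFamily q.1.2.1 q.1.2.2 q.2.1) := by
    refine continuous_sigma fun ⟨k, l, r⟩ => ?_
    refine continuous_iff_continuousAt.2 fun ⟨⟨p₀, hp₀⟩, t₀⟩ => ?_
    obtain ⟨m, l', r', φ, hφc, hφ⟩ := h t₀ l r p₀ hp₀
    let ψ : intervalFamilies l r × T → T × ((Fin k → ℝ) × (Fin k → ℝ)) := fun q => (q.2, q.1.1)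
    have hψ : Continuous ψ := by fun_prop
    let s : Set (intervalFamilies l r × T) := {q | φ (ψ q) ∈ intervalFamilies l' r' ∧
      op q.2 (intervalUnion l r q.1.1) = intervalUnion l' r' (φ (ψ q))}
    have hs : s ∈ 𝓝 ((⟨p₀, hp₀⟩, t₀) : intervalFamilies l r × T) := by
      filter_upwards [hψ.continuousAt.eventually hφ] with q hq
      exact hq q.1.2
    refine ContinuousOn.continuousAt ?_ hs
    rw [continuousOn_iff_continuous_domRestrict]
    have heq : s.domRestrict (fun q : intervalFamilies l r × T =>
        applyOp h q.2 (ofFamily l r q.1)) =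
        fun q : s => ofFamily l' r' ⟨φ (ψ q.1), q.2.1⟩ := by
      funext q
      refine ext_iff.2 ?_
      exact (carrier_applyOp h _ _).trans q.2.2
    change Continuous (s.domRestrict fun q : intervalFamilies l r × T =>
        applyOp h q.2 (ofFamily l r q.1))
    rw [heq]
    exact (continuous_ofFamily l' r').comp
      (((hφc.comp hψ).comp continuous_subtype_val).subtype_mk _)
  exact hF.comp he

end familywise

/-- Maps of the space of intervals that preserve summable tuples and their sums. -/
structure IsAdditive (f : IntervalSpace → IntervalSpace) : Prop where
  additive : ∀ {n : ℕ} (P : Fin n → IntervalSpace),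
    (Pairwise fun i j => Disjoint (P i).carrier (P j).carrier) →
    (∃ Q : IntervalSpace, Q.carrier = ⋃ i, (P i).carrier) →
    (Pairwise fun i j => Disjoint (f (P i)).carrier (f (P j)).carrier) ∧
      (f (sum P)).carrier = ⋃ i, (f (P i)).carrier

theorem IsAdditive.of_op {f : IntervalSpace → IntervalSpace} {op : Set ℝ → Set ℝ}
    (hf : ∀ Q, (f Q).carrier = op Q.carrier)
    (hop : ∀ {n : ℕ} (P : Fin n → Set ℝ), (∀ i, IsTame (P i)) →
      (Pairwise fun i j => Disjoint (P i) (P j)) → IsTame (⋃ i, P i) →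
      (Pairwise fun i j => Disjoint (op (P i)) (op (P j))) ∧ op (⋃ i, P i) = ⋃ i, op (P i)) :
    IsAdditive f := by
  refine ⟨fun {n} P hd hQ => ?_⟩
  have hU : IsTame (⋃ i, (P i).carrier) := by
    obtain ⟨Q, hQ⟩ := hQ
    rw [← hQ]
    exact Q.isTame
  simp only [hf, sum_val hQ]
  exact hop (fun i => (P i).carrier) (fun i => (P i).isTame) hd hU

theorem IsAdditive.comp {f g : IntervalSpace → IntervalSpace} (hf : IsAdditive f)
    (hg : IsAdditive g) : IsAdditive fun Q => f (g Q) := by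
  refine ⟨fun {n} P hd hQ => ?_⟩
  obtain ⟨h1, h2⟩ := hg.additive P hd hQ
  have hQ' : ∃ Q : IntervalSpace, Q.carrier = ⋃ i, (g (P i)).carrier := ⟨_, h2⟩
  obtain ⟨h3, h4⟩ := hf.additive (fun i => g (P i)) h1 hQ'
  refine ⟨h3, ?_⟩
  have : g (sum P) = sum fun i => g (P i) := ext_iff.2 (h2.trans (sum_val hQ').symm)
  rw [← h4, ← this]

theorem isAdditive_mirror : IsAdditive (applyOp isFamilywise_mirror ()) :=
  IsAdditive.of_op (carrier_applyOp _ ()) fun _ hP hd hU =>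
    ⟨mirror_disjoint hP hd hU, mirror_iUnion hP hd⟩

theorem isAdditive_fold : IsAdditive (applyOp isFamilywise_fold ()) :=
  IsAdditive.of_op (carrier_applyOp _ ()) fun _ hP hd hU => ⟨fold_disjoint hP hd hU, fold_iUnion hP hd⟩

theorem isAdditive_image {T : Type} [TopologicalSpace T] {f : T → ℝ → ℝ}
    (hc : Continuous fun p : T × ℝ => f p.1 p.2) (hf : ∀ t, StrictMono (f t)) (t : T) :
    IsAdditive (applyOp (isFamilywise_image hc hf) t) :=
  IsAdditive.of_op (carrier_applyOp _ t) fun _ _ hd _ =>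
    ⟨fun _ _ hij => (Set.disjoint_image_iff (hf t).injective).2 (hd hij), Set.image_iUnion⟩

end IntervalSpace

/-! ### Induced maps of `I(ℝ) ∧ M` -/

namespace IntervalSpace

/-- Additivity for the empty tuple. -/
theorem IsAdditive.map_zero {f : IntervalSpace → IntervalSpace} (hf : IsAdditive f) : f 0 = 0 := by
  have h : ∃ Q : IntervalSpace, Q.carrier = ⋃ i : Fin 0, (Fin.elim0 i : IntervalSpace).carrier :=
    ⟨0, by simp; rfl⟩
  have h0 : sum (Fin.elim0 : Fin 0 → IntervalSpace) = 0 := by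
    rw [ext_iff, sum_val h]
    simp
    rfl
  have := (hf.additive (Fin.elim0 : Fin 0 → IntervalSpace) (fun i => i.elim0) h).2
  rw [h0] at this
  rw [ext_iff, this]
  simp
  rfl

variable {G : Type w} [Group G] {M : Type u} [Zero M] [MulAction G M]

/-- The map of `I(ℝ) ∧ M` induced by a pointed map of `I(ℝ)`. -/
def smashMap (M : Type u) [Zero M] (f : IntervalSpace → IntervalSpace) (hf : f 0 = 0) :
    Smash IntervalSpace M → Smash IntervalSpace M :=
  Quotient.map (sa := smashSetoid IntervalSpace M) (sb := smashSetoid IntervalSpace M)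
    (fun p : IntervalSpace × M => ((f p.1, p.2) : IntervalSpace × M)) (by
      rintro p q (rfl | ⟨h, h'⟩)
      · exact Or.inl rfl
      · exact Or.inr ⟨h.imp_left fun h => (congrArg f h).trans hf,
          h'.imp_left fun h => (congrArg f h).trans hf⟩)

theorem smashMap_mk (f : IntervalSpace → IntervalSpace) (hf : f 0 = 0) (P : IntervalSpace)
    (a : M) : smashMap M f hf (Smash.mk P a) = Smash.mk (f P) a := rfl

/-- Generators go to generators: additivity of `f` handles distributivity in the intervals, and
distributivity in the labels is untouched by `f`. -/
theorem addConGen_smashMap (A : PartialMonoid G M) {f : IntervalSpace → IntervalSpace}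
    (hf : IsAdditive f) {S T : Multiset (Smash IntervalSpace M)}
    (h : addConGen ((partialMonoid G).DistribRel A) S T) :
    addConGen ((partialMonoid G).DistribRel A) (S.map (smashMap M f hf.map_zero))
      (T.map (smashMap M f hf.map_zero)) := by
  change AddConGen.Rel _ S T at h
  induction h with
  | of S T h =>
    refine AddConGen.Rel.of _ _ ?_
    cases h with
    | left c hc d =>
      obtain ⟨h1, h2⟩ := hf.additive c hc.1 hc.2
      have h3 : (fun i => f (c i)) ∈ (partialMonoid G).dom _ := ⟨h1, _, h2⟩
      have := PartialMonoid.DistribRel.left (A := partialMonoid G) (B := A) _ h3 d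
      have h4 : (partialMonoid G).sum (fun i => f (c i)) = f ((partialMonoid G).sum c) :=
        ext_iff.2 ((sum_val h3.2).trans h2.symm)
      rw [h4] at this
      simpa only [PartialMonoid.sum_singleton_eq_map, Multiset.map_map, Multiset.map_singleton,
        Function.comp_def, smashMap_mk] using this
    | right c d hd =>
      have := PartialMonoid.DistribRel.right (A := partialMonoid G) (B := A) (f c) d hd
      simpa only [PartialMonoid.sum_singleton_eq_map, Multiset.map_map, Multiset.map_singleton,
        Function.comp_def, smashMap_mk] using this
  | refl => exact AddConGen.Rel.refl _
  | symm _ ih => exact AddConGen.Rel.symm ih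
  | trans _ _ ih₁ ih₂ => exact AddConGen.Rel.trans ih₁ ih₂
  | add _ _ ih₁ ih₂ =>
    rw [Multiset.map_add, Multiset.map_add]
    exact AddConGen.Rel.add ih₁ ih₂

variable [TopologicalSpace M]

theorem isQuotientMap_smash : @IsQuotientMap (KProd IntervalSpace M) (Smash IntervalSpace M) _ _
    (Quotient.mk (smashSetoid IntervalSpace M)) :=
  ⟨⟨rfl⟩, Quotient.mk_surjective⟩

instance : UCompactlyGeneratedSpace.{u} (Smash IntervalSpace M) :=
  have : UCompactlyGeneratedSpace.{u} (KProd IntervalSpace M) :=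
    KProd.uCompactlyGeneratedSpace.{0, u} IntervalSpace M
  uCompactlyGeneratedSpace_of_coinduced.{u} isQuotientMap_smash.continuous
    isQuotientMap_smash.eq_coinduced

theorem continuous_smashMap {F : unitInterval → IntervalSpace → IntervalSpace}
    (hF : Continuous fun p : unitInterval × IntervalSpace => F p.1 p.2) (h0 : ∀ t, F t 0 = 0) :
    Continuous fun p : unitInterval × Smash IntervalSpace M => smashMap M (F p.1) (h0 p.1) p.2 := by
  refine isQuotientMap_smash.continuous_lift_prod_right ?_
  have : UCompactlyGeneratedSpace.{u} (KProd IntervalSpace M) :=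
    KProd.uCompactlyGeneratedSpace.{0, u} IntervalSpace M
  have h1 : @Continuous (unitInterval × KProd IntervalSpace M) (KProd IntervalSpace M) _ _
      fun p => ((F p.1 p.2.1, p.2.2) : IntervalSpace × M) :=
    KProd.continuous_mk (hF.comp (continuous_fst.prodMk (KProd.continuous_fst.comp continuous_snd)))
      (KProd.continuous_snd.comp continuous_snd)
  exact isQuotientMap_smash.continuous.comp h1

variable [IsPointedGSpace G M]

instance : IsPointedGSpace G (Smash IntervalSpace M) where
  smul_basepoint g :=
    (Smash.smul_mk g (0 : IntervalSpace) (0 : M)).trans (Smash.mk_zero_left _)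
  continuous_smul g := by
    rw [isQuotientMap_smash.continuous_iff]
    have : UCompactlyGeneratedSpace.{u} (KProd IntervalSpace M) :=
      KProd.uCompactlyGeneratedSpace.{0, u} IntervalSpace M
    have h1 : @Continuous (KProd IntervalSpace M) (KProd IntervalSpace M) _ _
        fun p => ((p.1, g • p.2) : IntervalSpace × M) :=
      KProd.continuous_mk KProd.continuous_fst
        ((IsPointedGSpace.continuous_smul g).comp KProd.continuous_snd)
    exact isQuotientMap_smash.continuous.comp h1

theorem isHom_smashMap (A : PartialMonoid G M) {F : unitInterval → IntervalSpace → IntervalSpace}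
    (hF : Continuous fun p : unitInterval × IntervalSpace => F p.1 p.2)
    (hadd : ∀ t, IsAdditive (F t)) (t : unitInterval) :
    (stringLabels A).IsHom (stringLabels A) (smashMap M (F t) (hadd t).map_zero) where
  continuous := (continuous_smashMap hF fun t => (hadd t).map_zero).comp
    (continuous_const (y := t).prodMk continuous_id)
  map_smul g x := by
    induction x using Smash.ind with | _ P a
    rfl
  map_dom x := by
    rintro ⟨z, hz⟩
    refine ⟨smashMap M (F t) (hadd t).map_zero z, ?_⟩
    have := addConGen_smashMap A (hadd t) hz
    simpa only [PartialMonoid.sum_singleton_eq_map, Multiset.map_map, Multiset.map_singleton,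
      Function.comp_def] using this
  map_sum x := by
    rintro ⟨z, hz⟩
    have h1 : (stringLabels A).sum x = z := PartialMonoid.smashSum_eq (distribSeparated A) hz
    rw [h1]
    refine (PartialMonoid.smashSum_eq (distribSeparated A) ?_).symm
    have := addConGen_smashMap A (hadd t) hz
    simpa only [PartialMonoid.sum_singleton_eq_map, Multiset.map_map, Multiset.map_singleton,
      Function.comp_def] using this

/-! ### Homotopy inversion of strings -/

/-- An isotopy from the identity of the line to an embedding into `(-4, 0)`. -/
def squeeze (t : unitInterval) (x : ℝ) : ℝ := (1 - (t : ℝ)) * x + t * (Real.arctan x - 2)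

theorem continuous_squeeze : Continuous fun p : unitInterval × ℝ => squeeze p.1 p.2 := by
  change Continuous fun p : unitInterval × ℝ =>
    (1 - (p.1 : ℝ)) * p.2 + (p.1 : ℝ) * (Real.arctan p.2 - 2)
  have := Real.continuous_arctan
  fun_prop

theorem strictMono_squeeze (t : unitInterval) : StrictMono (squeeze t) := by
  intro x y hxy
  have h1 := Real.arctan_strictMono hxy
  simp only [squeeze]
  have h2 := t.2.1
  have h3 := t.2.2
  -- For `t = 0` strictness comes from the linear term, for `t > 0` from the arctangent.
  rcases h2.eq_or_lt with h | h
  · rw [← h]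
    linarith
  · nlinarith

/-- The translations of an embedding of the line into `(-4, 0)` to an embedding into `(0, 4)`. -/
def slide (t : unitInterval) (x : ℝ) : ℝ := Real.arctan x - 2 + 4 * t

theorem continuous_slide : Continuous fun p : unitInterval × ℝ => slide p.1 p.2 := by
  change Continuous fun p : unitInterval × ℝ => Real.arctan p.2 - 2 + 4 * (p.1 : ℝ)
  have := Real.continuous_arctan
  fun_prop

theorem strictMono_slide (t : unitInterval) : StrictMono (slide t) := by
  intro x y hxy
  have h1 := Real.arctan_strictMono hxy
  simp only [slide]
  linarith

/-- This crude bound explains the constants in `squeeze` and `slide`: subtracting `2` makes the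
arctangent negative, and a further translation by `4` makes it positive. -/
theorem abs_arctan_lt_two (x : ℝ) : -2 < Real.arctan x ∧ Real.arctan x < 2 := by
  have h1 := Real.neg_pi_div_two_lt_arctan x
  have h2 := Real.arctan_lt_pi_div_two x
  have h3 := Real.pi_lt_four
  constructor <;> linarith

/-- The isotopy `squeeze` on the space of intervals. -/
def squeezeMap : unitInterval → IntervalSpace → IntervalSpace :=
  applyOp (isFamilywise_image continuous_squeeze strictMono_squeeze)

/-- The translations `slide` on the space of intervals. -/
def slideMap : unitInterval → IntervalSpace → IntervalSpace :=
  applyOp (isFamilywise_image continuous_slide strictMono_slide)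

/-- The mirror image with toggled end points, on the space of intervals. -/
def mirrorMap : IntervalSpace → IntervalSpace := applyOp isFamilywise_mirror ()

/-- Folding of the space of intervals. -/
def foldMap : IntervalSpace → IntervalSpace := applyOp isFamilywise_fold ()

theorem carrier_squeezeMap (t : unitInterval) (Q : IntervalSpace) :
    (squeezeMap t Q).carrier = squeeze t '' Q.carrier := carrier_applyOp _ _ _

theorem carrier_slideMap (t : unitInterval) (Q : IntervalSpace) :
    (slideMap t Q).carrier = slide t '' Q.carrier := carrier_applyOp _ _ _

theorem carrier_mirrorMap (Q : IntervalSpace) : (mirrorMap Q).carrier = mirror Q.carrier :=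
  carrier_applyOp isFamilywise_mirror _ _

theorem carrier_foldMap (Q : IntervalSpace) : (foldMap Q).carrier = fold Q.carrier :=
  carrier_applyOp isFamilywise_fold _ _

theorem continuous_squeezeMap :
    Continuous fun p : unitInterval × IntervalSpace => squeezeMap p.1 p.2 :=
  continuous_applyOp _

theorem continuous_slideMap :
    Continuous fun p : unitInterval × IntervalSpace => slideMap p.1 p.2 :=
  continuous_applyOp _

theorem continuous_mirrorMap : Continuous mirrorMap :=
  (continuous_applyOp isFamilywise_mirror).comp (continuous_const.prodMk continuous_id)

theorem continuous_foldMap : Continuous foldMap :=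
  (continuous_applyOp isFamilywise_fold).comp (continuous_const.prodMk continuous_id)

theorem squeezeMap_zero (Q : IntervalSpace) : squeezeMap 0 Q = Q := by
  have : squeeze 0 = id := by
    funext x
    simp [squeeze]
  rw [ext_iff, carrier_squeezeMap, this, Set.image_id]

theorem squeezeMap_one_eq (Q : IntervalSpace) : squeezeMap 1 Q = slideMap 0 Q := by
  have : squeeze 1 = slide 0 := by
    funext x
    simp [squeeze, slide]
  rw [ext_iff, carrier_squeezeMap, carrier_slideMap, this]

theorem squeezeMap_one_subset (Q : IntervalSpace) : (squeezeMap 1 Q).carrier ⊆ Set.Iio 0 := by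
  rw [squeezeMap_one_eq, carrier_slideMap]
  rintro _ ⟨x, -, rfl⟩
  have := abs_arctan_lt_two x
  simp only [slide, Set.Icc.coe_zero, Set.mem_Iio]
  linarith

/-- After the slide the set lies in the positive half-line, and folding only retains what is on the
negative side. -/
theorem foldMap_slideMap_one (Q : IntervalSpace) : foldMap (slideMap 1 Q) = 0 := by
  rw [ext_iff, carrier_foldMap, carrier_slideMap]
  refine fold_eq_empty ?_
  rintro _ ⟨x, -, rfl⟩
  have := abs_arctan_lt_two x
  simp only [slide, Set.Icc.coe_one, Set.mem_Ioi]
  linarith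

theorem disjoint_squeezeMap_one (Q : IntervalSpace) :
    Disjoint (squeezeMap 1 Q).carrier (mirrorMap (squeezeMap 1 Q)).carrier := by
  rw [carrier_mirrorMap]
  exact mirror_disjoint_self (squeezeMap_one_subset Q)

/-- Identifies the sum of the compressed set and its mirror image with the start of the null
homotopy obtained by sliding and folding. -/
theorem carrier_foldMap_squeezeMap (Q : IntervalSpace) :
    (foldMap (slideMap 0 Q)).carrier =
      (squeezeMap 1 Q).carrier ∪ (mirrorMap (squeezeMap 1 Q)).carrier := by
  rw [carrier_foldMap, carrier_mirrorMap, ← squeezeMap_one_eq,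
    fold_eq_union (squeezeMap_one_subset Q)]

theorem pair_summable (A : PartialMonoid G M) {P P' Q : IntervalSpace}
    (hd : Disjoint P.carrier P'.carrier) (hQ : Q.carrier = P.carrier ∪ P'.carrier) (a : M) :
    ![(Smash.mk P a : Smash IntervalSpace M), Smash.mk P' a] ∈ (stringLabels A).dom 2 ∧
      (stringLabels A).sum ![(Smash.mk P a : Smash IntervalSpace M), Smash.mk P' a] =
        Smash.mk Q a := by
  have hU : Q.carrier = ⋃ i, (![P, P'] i).carrier := by
    rw [hQ]
    ext x
    simp [Fin.exists_fin_two]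
  have hc : ![P, P'] ∈ (partialMonoid G).dom 2 := by
    refine ⟨?_, Q, hU⟩
    intro i j hij
    fin_cases i <;> fin_cases j
    · exact absurd rfl hij
    · exact hd
    · exact hd.symm
    · exact absurd rfl hij
  have hs : (partialMonoid G).sum ![P, P'] = Q :=
    ext_iff.2 ((sum_val ⟨Q, hU⟩).trans hU.symm)
  have h : addConGen ((partialMonoid G).DistribRel A)
      (∑ i, {![(Smash.mk P a : Smash IntervalSpace M), Smash.mk P' a] i}) {Smash.mk Q a} := by
    refine AddConGen.Rel.of _ _ ?_
    have := PartialMonoid.DistribRel.left (A := partialMonoid G) (B := A) _ hc a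
    rw [hs] at this
    simpa [Fin.sum_univ_two] using this
  exact ⟨⟨_, h⟩, PartialMonoid.smashSum_eq (distribSeparated A) h⟩

end IntervalSpace

/-! ### Homotopical invertibility of string labels and the theorem -/

open IntervalSpace

variable {G : Type w} [Group G] {M : Type u} [TopologicalSpace M] [Zero M] [MulAction G M]

theorem PartialMonoid.IsHom.prodMk {A B : PartialMonoid G M} {f g : M → M}
    [UCompactlyGeneratedSpace.{u} M] (hf : A.IsHom B f) (hg : A.IsHom B g) :
    A.IsHom (B.prod B) fun a => ((f a, g a) : M × M) where
  continuous := KProd.continuous_mk hf.continuous hg.continuous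
  map_smul γ a := Prod.ext (hf.map_smul γ a) (hg.map_smul γ a)
  map_dom a ha := ⟨hf.map_dom a ha, hg.map_dom a ha⟩
  map_sum a ha := Prod.ext (hf.map_sum a ha) (hg.map_sum a ha)

/-- The inversion `τ` is induced by `mirrorMap`. The homotopy `h` compresses the line into the
negative half-line in both components, after which a set and its mirror image are disjoint. Their
union is a folded set, and `k` slides the set through the origin before folding, until nothing is
left. -/
theorem stringLabels_homotopicallyInvertible [IsPointedGSpace G M] (A : PartialMonoid G M) :
    (stringLabels A).HomotopicallyInvertible := by
  have hsc := continuous_squeezeMap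
  have hsa : ∀ t, IsAdditive (squeezeMap t) := isAdditive_image continuous_squeeze strictMono_squeeze
  have hma : IsAdditive mirrorMap := isAdditive_mirror
  have hmsc : Continuous fun p : unitInterval × IntervalSpace => mirrorMap (squeezeMap p.1 p.2) :=
    continuous_mirrorMap.comp hsc
  have hmsa : ∀ t, IsAdditive fun Q => mirrorMap (squeezeMap t Q) := fun t => hma.comp (hsa t)
  have hfsc : Continuous fun p : unitInterval × IntervalSpace => foldMap (slideMap p.1 p.2) :=
    continuous_foldMap.comp continuous_slideMap
  have hfsa : ∀ t, IsAdditive fun Q => foldMap (slideMap t Q) := fun t =>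
    isAdditive_fold.comp (isAdditive_image continuous_slide strictMono_slide t)
  have hhom₁ := isHom_smashMap A (F := squeezeMap) hsc hsa
  have hhom₂ := isHom_smashMap A (F := fun t Q => mirrorMap (squeezeMap t Q)) hmsc hmsa
  have hpair := fun (P : IntervalSpace) (a : M) =>
    pair_summable A (disjoint_squeezeMap_one P) (carrier_foldMap_squeezeMap P) a
  refine ⟨smashMap M mirrorMap hma.map_zero,
    fun p => ((smashMap M (squeezeMap p.1) (hsa p.1).map_zero p.2,
      smashMap M (fun Q => mirrorMap (squeezeMap p.1 Q)) (hmsa p.1).map_zero p.2) :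
      Smash IntervalSpace M × Smash IntervalSpace M),
    isHom_smashMap A (F := fun _ => mirrorMap) (continuous_mirrorMap.comp continuous_snd)
      (fun _ => hma) 0,
    KProd.continuous_mk (continuous_smashMap hsc fun t => (hsa t).map_zero)
      (continuous_smashMap (F := fun t Q => mirrorMap (squeezeMap t Q)) hmsc fun t => (hmsa t).map_zero),
    fun t => (hhom₁ t).prodMk (hhom₂ t), fun x => ?_, fun x => ?_,
    fun p => smashMap M (fun Q => foldMap (slideMap p.1 Q)) (hfsa p.1).map_zero p.2,
    continuous_smashMap (F := fun t Q => foldMap (slideMap t Q)) hfsc fun t => (hfsa t).map_zero,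
    isHom_smashMap A (F := fun t Q => foldMap (slideMap t Q)) hfsc hfsa, fun x => ?_, fun x => ?_⟩
  · induction x using Smash.ind with | _ P a
    simp only [smashMap_mk, squeezeMap_zero]
    rfl
  · induction x using Smash.ind with | _ P a
    exact (hpair P a).1
  · induction x using Smash.ind with | _ P a
    exact (hpair P a).2.symm
  · induction x using Smash.ind with | _ P a
    simp only [smashMap_mk, foldMap_slideMap_one]
    exact Smash.mk_zero_left a

end

theorem mainTheorem6 {G : Type w} [Group G] [Fintype G]
    {V : Type u} [NormedAddCommGroup V] [InnerProductSpace ℝ V] [MulAction G V]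
    (hV : IsGUniverse G V) :
    Nonempty (HopfData G V) ∧
    ∀ (d : HopfData G V) (M : Type u) [TopologicalSpace M] [Zero M] [MulAction G M]
      [IsPointedGSpace G M] (A : GPartialMonoid G M),
      (A.toPartialMonoid.HomotopicallyInvertible →
        IsGrouplikeHopfGSpace G (Conf V A.toPartialMonoid) (d.mul A.toPartialMonoid)) ∧
      IsGrouplikeHopfGSpace G (StringConf V A.toPartialMonoid)
        (d.mul (stringLabels A.toPartialMonoid)) := by
  obtain ⟨s⟩ := hV.nonempty_shifts
  exact ⟨s.nonempty_hopfData, fun d M _ _ _ _ A => ⟨s.isGrouplikeHopfGSpace d,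
    s.isGrouplikeHopfGSpace d (stringLabels_homotopicallyInvertible A.toPartialMonoid)⟩⟩
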